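/- Let $X_1, X_2, \ldots$ be independent, identically distributed integer-valued random variables with characteristic function $\varphi(x) = \mathbb{E}(e^{ixX_1})$, and let $S_n = \sum_{k=1}^n X_k$. Assume that $X_1$ is nondegenerate, that is, there is no integer $n$ with $X_1 = n$ almost surely. Let $\alpha$ be a badly approximable real number, that is, there is a constant $c>0$ such that $\min_{n \in \mathbb{Z}} |q\alpha - n| \ge c/q$ for all positive integers $q$. Let $\mu_N = N^{-1} \sum_{n=1}^N \delta_{S_n \alpha \ (\mathrm{mod}\ \mathbb{Z})}$ be the empirical measure on the circle group $\mathbb{T} = \mathbb{R}/\mathbb{Z}$, and let $\lambda$ be the normalized Haar measure on $\mathbb{T}$. Let $W_{\mathbb{T},2}$ be the quadratic Wasserstein metric with respect to the circular distance $\rho(x,y) = \min_{n\in\mathbb{Z}}|x-y-n|$, so that $W_{\mathbb{T},2}^2(\mu,\nu)=\inf_{\vartheta} \int_{\mathbb{T}\times\mathbb{T}} \rho(x,y)^2 \, \mathrm{d}\vartheta(x,y)$, where $\vartheta$ runs over the Borel probability measures on $\mathbb{T}\times\mathbb{T}$ with marginals $\mu$ and $\nu$. Then for all integers $N \ge 3$,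 \[ \mathbb{E}\left( W_{\mathbb{T},2}^2(\mu_N,\lambda) \right) = \frac{1}{N} \sum_{1 \le m \le \sqrt{N}} \frac{1}{2\pi^2 m^2} \cdot \frac{1-|\varphi(2\pi m\alpha)|^2}{|1-\varphi(2\pi m\alpha)|^2} + O\left( \frac{1}{N} \right) \] and \[ \mathrm{Var}\left( W_{\mathbb{T},2}^2(\mu_N,\lambda) \right) = \frac{1}{N^2} \sum_{1 \le m \le \sqrt{N}} \frac{1}{4\pi^4 m^4} \left( \frac{1-|\varphi(2\pi m\alpha)|^2}{|1-\varphi(2\pi m\alpha)|^2} \right)^2 + O\left( \frac{(\log\log N)^2}{N^2} \right), \] with implied constants depending only on $\alpha$ and the distribution of $X_1$. -/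

import Mathlib

open MeasureTheory ProbabilityTheory
open scoped ENNReal

noncomputable section

/-- The distance `‖x‖ = min_{n ∈ ℤ} |x - n|` from a real number to the nearest integer. -/
def distNearestInt (x : ℝ) : ℝ := |x - round x|

/-- `α` is badly approximable: `‖q α‖ ≥ C / q` for all positive integers `q`,
with some constant `C > 0`. -/
def BadlyApproximable (α : ℝ) : Prop :=
  ∃ C : ℝ, 0 < C ∧ ∀ q : ℕ, 1 ≤ q → C / (q : ℝ) ≤ distNearestInt ((q : ℝ) * α)

/-- `ϑ` is a coupling of `μ` and `ν`: a probability measure on `M × M` whose marginals are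
`μ` and `ν`. -/
def IsCoupling {M : Type*} [MeasurableSpace M] (μ ν : Measure M) (ϑ : Measure (M × M)) : Prop :=
  IsProbabilityMeasure ϑ ∧ ϑ.map Prod.fst = μ ∧ ϑ.map Prod.snd = ν

/-- The Wasserstein metric of finite order `p`, the infimum over all couplings `ϑ` of `μ` and `ν`
of `(∫ ρ(x,y)^p dϑ(x,y))^(1/p)`. -/
def wasserstein {M : Type*} [MetricSpace M] [MeasurableSpace M] (p : ℝ) (μ ν : Measure M) : ℝ :=
  (⨅ (ϑ : Measure (M × M)) (_ : IsCoupling μ ν ϑ),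
    (∫⁻ z, edist z.1 z.2 ^ p ∂ϑ) ^ (1 / p)).toReal

/-- The probability distribution `ν` on `ℤ` is nondegenerate: it is not concentrated on a single
integer. -/
def NondegenerateLaw (ν : Measure ℤ) : Prop :=
  ¬ ∃ n : ℤ, ∀ᵐ k ∂ν, k = n

/-- The characteristic function `φ(x) = E(e^{i x X})` of an integer-valued random variable `X`
with distribution `ν`. -/
def latticeCharFun (ν : Measure ℤ) (x : ℝ) : ℂ :=
  charFun (ν.map (fun n : ℤ => (n : ℝ))) x

/-- The partial sum `S_n = X_1 + ⋯ + X_n`; the sequence is indexed so that `X k` is the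
`(k+1)`-st step. -/
def partialSum {Ω : Type*} (X : ℕ → Ω → ℤ) (n : ℕ) (ω : Ω) : ℤ :=
  ∑ k ∈ Finset.range n, X k ω

/-- The empirical measure `μ_N = N⁻¹ ∑_{n=1}^N δ_{S_n α mod ℤ}` on the circle group `ℝ/ℤ`. -/
def empiricalMeasure {Ω : Type*} (X : ℕ → Ω → ℤ) (α : ℝ) (N : ℕ) (ω : Ω) :
    Measure UnitAddCircle :=
  (N : ℝ≥0∞)⁻¹ • ∑ n ∈ Finset.Icc 1 N,
    Measure.dirac ((((partialSum X n ω : ℤ) : ℝ) * α : ℝ) : UnitAddCircle)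

/-- The squared quadratic Wasserstein distance on the circle between the empirical measure and the
normalized Haar measure. -/
def wassersteinSq {Ω : Type*} (X : ℕ → Ω → ℤ) (α : ℝ) (N : ℕ) (ω : Ω) : ℝ :=
  wasserstein 2 (empiricalMeasure X α N ω)
    (AddCircle.haarAddCircle : Measure UnitAddCircle) ^ 2

/-- The ratio `(1 - |φ(2πx)|²) / |1 - φ(2πx)|²`. -/
def charRatio (ν : Measure ℤ) (x : ℝ) : ℝ :=
  (1 - ‖latticeCharFun ν (2 * Real.pi * x)‖ ^ 2) / ‖1 - latticeCharFun ν (2 * Real.pi * x)‖ ^ 2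

end

/-! The squared distance from the uniform measure on `N` points of the circle to Haar measure is a
quadratic energy. By Kantorovich duality it equals `1/(2N²)` times the sum of `circleBernoulli` over
all pairs of points (`wasserstein_two_sq_uniform`), and the Fourier series of the Bernoulli
polynomial turns this into a sum over frequencies m of |∑ₙ e(mαSₙ)|² / (2π²m²N²)
(`hasSum_wassersteinSq`). Mean and variance are thereby reduced to moments of exponential sums of
the walk.

Fix m and write φ for `charAt`, σ² = 1 - |φ|² for `charVar`. Rotated by its last character, the
exponential sum obeys U ↦ 1 + χ(Xₙ)U (`walkSum`). Adding the conditional expectation of the future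
summands gives V = `compSum`, which up to a unimodular factor is a martingale with increments
g·conj(Y), where Y is a centred character and g a finite geometric sum with |g| close to 1/|1-φ|
(`compSum_step`). Hence E|U|² is about σ²∑|g|², that is, Nσ²/|1-φ|². The increments of |V|², less
their deterministic drift, are centred too, so covariances add up step by step
(`covariance_compSq`). At a single frequency the dominant contribution of a step is 2σ²|g|²E|V|²,
and these add up to about (σ²∑|g|²)²: the variance is close to the square of the mean. At two
different frequencies only mixed moments appear, controlled by geometric sums at m + l and m - l.

All errors are measured by G = ∑_{k<N} |φ|^k (`geomSum`), with σ²G ≤ 2. Two atoms of the law at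
distance d give σ² ≥ κ‖mdα‖² (`exists_charVar_lower`). With β = dα, again badly approximable, K =
⌊√N⌋ and x_m = ‖mβ‖ + 1/K (`cappedDist`), it follows that G = O(x_m⁻²). Bad approximability spreads
out the multiples of β, whence ∑ m⁻²x_m⁻³ = O(K) (`sum_inv_sq_inv_cube_le`) and ∑_{m≥K} m⁻²x_m⁻² =
O(1) (`sum_tail_inv_sq_le`). The triangle inequality among x_m, x_l and x_{m±l} reduces the
off-diagonal double sum to products of two such sums (`triple_weight_le`), which are O(K²) = O(N).

The variance error obtained is O(N⁻²); the doubly logarithmic factor of the statement is used only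
through its positive lower bound for N ≥ 3. -/

/-! ### Sums over multiples of a badly approximable number. -/

/-- The distance of `m β` to the nearest integer, raised by `1 / K`. -/
noncomputable def cappedDist (β : ℝ) (K : ℕ) (m : ℤ) : ℝ :=
  ‖(((m : ℝ) * β : ℝ) : UnitAddCircle)‖ + 1 / (K : ℝ)

/-- `β` is badly approximable with constant `c`. -/
def BadlyApproximableWith (c β : ℝ) : Prop :=
  ∀ q : ℕ, 1 ≤ q → c / (q : ℝ) ≤ ‖(((q : ℝ) * β : ℝ) : UnitAddCircle)‖

theorem unitAddCircle_norm_le_abs (x : ℝ) : ‖(x : UnitAddCircle)‖ ≤ |x| := by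
  rw [UnitAddCircle.norm_eq]
  simpa using round_le x 0

theorem unitAddCircle_norm_le_one (x : ℝ) : ‖(x : UnitAddCircle)‖ ≤ 1 := by
  rw [UnitAddCircle.norm_eq]
  linarith [abs_sub_round x]

theorem BadlyApproximableWith.le_one {c β : ℝ} (h : BadlyApproximableWith c β) : c ≤ 1 := by
  have := (h 1 le_rfl).trans (unitAddCircle_norm_le_one _)
  simpa using this

theorem sum_range_inv_sq_le (n : ℕ) :
    ∑ b ∈ Finset.range n, 1 / ((b : ℝ) + 1) ^ 2 ≤ 2 := by
  -- The subtracted term makes the bound telescope, so that the induction closes.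
  have key : ∑ b ∈ Finset.range n, 1 / ((b : ℝ) + 1) ^ 2 ≤ 2 - 2 / ((n : ℝ) + 1) := by
    induction n with
    | zero => simp
    | succ k ih =>
      rw [Finset.sum_range_succ]
      have h : 1 / ((k : ℝ) + 1) ^ 2 ≤ 2 / ((k : ℝ) + 1) - 2 / ((k : ℝ) + 1 + 1) := by
        rw [div_sub_div _ _ (by positivity) (by positivity),
          div_le_div_iff₀ (by positivity) (by positivity)]
        have : (0 : ℝ) ≤ k := by positivity
        nlinarith [mul_nonneg this this, mul_nonneg this (mul_nonneg this this)]
      push_cast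
      linarith
  have : 0 ≤ 2 / ((n : ℝ) + 1) := by positivity
  linarith

theorem cappedDist_pos (β : ℝ) {K : ℕ} (hK : 1 ≤ K) (m : ℤ) : 0 < cappedDist β K m := by
  have : (0 : ℝ) < K := by exact_mod_cast hK
  unfold cappedDist
  positivity

theorem inv_le_cappedDist (β : ℝ) (K : ℕ) (m : ℤ) : 1 / (K : ℝ) ≤ cappedDist β K m := by
  unfold cappedDist
  have := norm_nonneg (((m : ℝ) * β : ℝ) : UnitAddCircle)
  linarith

theorem cappedDist_neg (β : ℝ) (K : ℕ) (m : ℤ) : cappedDist β K (-m) = cappedDist β K m := by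
  unfold cappedDist
  push_cast
  rw [neg_mul, AddCircle.coe_neg, norm_neg]

theorem cappedDist_add_le (β : ℝ) (K : ℕ) (m l : ℤ) :
    cappedDist β K (m + l) ≤ cappedDist β K m + cappedDist β K l := by
  unfold cappedDist
  have h := norm_add_le (((m : ℝ) * β : ℝ) : UnitAddCircle) (((l : ℝ) * β : ℝ) : UnitAddCircle)
  rw [← AddCircle.coe_add, ← add_mul] at h
  push_cast
  have : (0 : ℝ) ≤ 1 / (K : ℝ) := by positivity
  linarith

theorem norm_eq_fract_or (x : ℝ) :
    ‖(x : UnitAddCircle)‖ = Int.fract x ∨ ‖(x : UnitAddCircle)‖ = 1 - Int.fract x := by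
  rw [UnitAddCircle.norm_eq, abs_sub_round_eq_min]
  exact min_choice _ _

/-- Among `K` consecutive multiples of a badly approximable number the distances to the
nearest integer are spread out. -/
theorem sum_block_inv_sq_le {c β : ℝ} (hc : 0 < c) (hβ : BadlyApproximableWith c β)
    {K : ℕ} (hK : 1 ≤ K) (a : ℕ) :
    ∑ m ∈ Finset.Ico a (a + K), 1 / cappedDist β K (m : ℤ) ^ 2 ≤ 16 / c ^ 2 * (K : ℝ) ^ 2 := by
  have hK' : (1 : ℝ) ≤ K := by exact_mod_cast hK
  have hc1 := hβ.le_one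
  -- The circle is cut into `L` arcs of length 1/L ≤ c/K. Two of `K` consecutive multiples in one
  -- arc would be closer than c/K, against bad approximability.
  set L : ℕ := ⌈(K : ℝ) / c⌉₊ with hL
  have hL1 : (K : ℝ) / c ≤ L := Nat.le_ceil _
  have hKc : (K : ℝ) ≤ K / c := by rw [le_div_iff₀ hc]; nlinarith
  have hL2 : (L : ℝ) ≤ 2 * (K / c) := by
    have := (Nat.ceil_lt_add_one (show 0 ≤ (K : ℝ) / c by positivity)).le
    rw [← hL] at this
    linarith
  have hLpos : (0 : ℝ) < L := by linarith
  have hLK : 1 / (L : ℝ) ≤ 1 / K := one_div_le_one_div_of_le (by linarith) (by linarith)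
  set b : ℕ → ℕ := fun m => ⌊(L : ℝ) * Int.fract ((m : ℝ) * β)⌋₊ with hb
  have hfr : ∀ m : ℕ, (b m : ℝ) ≤ L * Int.fract ((m : ℝ) * β) := fun m =>
    Nat.floor_le (mul_nonneg hLpos.le (Int.fract_nonneg _))
  have hfr2 : ∀ m : ℕ, (L : ℝ) * Int.fract ((m : ℝ) * β) < b m + 1 := fun m =>
    Nat.lt_floor_add_one _
  have hbL : ∀ m, b m < L := fun m => by
    have h1 := hfr m
    have h2 := Int.fract_lt_one ((m : ℝ) * β)
    have : (b m : ℝ) < L := by nlinarith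
    exact_mod_cast this
  have hinj' : ∀ m m' : ℕ, m < m' → m' - m < K → b m ≠ b m' := by
    intro m m' hlt hd heq
    have h1 := hβ (m' - m) (by omega)
    have h2 : ‖((((m' - m : ℕ) : ℝ) * β : ℝ) : UnitAddCircle)‖
        ≤ |Int.fract ((m' : ℝ) * β) - Int.fract ((m : ℝ) * β)| := by
      rw [UnitAddCircle.norm_eq]
      have := round_le (((m' - m : ℕ) : ℝ) * β) (⌊(m' : ℝ) * β⌋ - ⌊(m : ℝ) * β⌋)
      refine this.trans (le_of_eq ?_)
      congr 1
      rw [Nat.cast_sub hlt.le]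
      unfold Int.fract
      push_cast
      ring
    have h3 : |Int.fract ((m' : ℝ) * β) - Int.fract ((m : ℝ) * β)| < 1 / L := by
      have e1 := hfr m
      have e2 := hfr2 m
      have e3 := hfr m'
      have e4 := hfr2 m'
      rw [heq] at e1 e2
      rw [lt_div_iff₀ hLpos, ← abs_of_pos hLpos, ← abs_mul, abs_lt]
      constructor <;> linarith
    have h4 : 1 / (L : ℝ) ≤ c / K := by
      rw [div_le_div_iff₀ hLpos (by linarith)]
      rw [div_le_iff₀ hc] at hL1
      linarith
    have h5 : c / (K : ℝ) ≤ c / ((m' - m : ℕ) : ℝ) := by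
      apply div_le_div_of_nonneg_left hc.le
      · exact_mod_cast (by omega : 0 < m' - m)
      · exact_mod_cast hd.le
    linarith
  have hinj : Set.InjOn b (Finset.Ico a (a + K) : Finset ℕ) := by
    intro m hm m' hm' heq
    simp only [Finset.coe_Ico, Set.mem_Ico] at hm hm'
    by_contra hne
    rcases lt_or_gt_of_ne hne with h | h
    · exact hinj' m m' h (by omega) heq
    · exact hinj' m' m h (by omega) heq.symm
  -- The nearest integer may be at either end of the unit interval, so the bin `b m` is measured
  -- from both ends. The summand 1/K ≥ 1/L keeps the comparison valid in the two extreme bins.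
  have hterm : ∀ m : ℕ, 1 / cappedDist β K (m : ℤ) ^ 2 ≤
      (L : ℝ) ^ 2 * (1 / ((b m : ℝ) + 1) ^ 2 + 1 / (((L - 1 - b m : ℕ) : ℝ) + 1) ^ 2) := by
    intro m
    have e1 := hfr m
    have e2 := hfr2 m
    have hcast : (((L - 1 - b m : ℕ) : ℝ) + 1) = L - b m := by
      have := hbL m
      rw [show L - 1 - b m = L - (b m + 1) by omega, Nat.cast_sub (by omega)]
      push_cast; ring
    have hbl : (0 : ℝ) < L - b m := by
      have : (b m : ℝ) < L := by exact_mod_cast hbL m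
      linarith
    rw [hcast]
    have aux : ∀ u : ℝ, 0 < u → u / L ≤ cappedDist β K (m : ℤ) →
        1 / cappedDist β K (m : ℤ) ^ 2 ≤ (L : ℝ) ^ 2 * (1 / u ^ 2) := by
      intro u hu h
      rw [mul_one_div, ← div_pow, ← one_div_pow, ← inv_div u (L : ℝ), inv_eq_one_div]
      exact pow_le_pow_left₀ (by have := cappedDist_pos β hK (m : ℤ); positivity)
        (one_div_le_one_div_of_le (by positivity) h) 2
    rcases norm_eq_fract_or ((m : ℝ) * β) with h | h
    · have := aux ((b m : ℝ) + 1) (by positivity) (by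
        unfold cappedDist
        rw [Int.cast_natCast, h]
        have : (b m : ℝ) / L ≤ Int.fract ((m : ℝ) * β) := by
          rw [div_le_iff₀ hLpos]; linarith
        rw [add_div]; linarith)
      refine this.trans ?_
      rw [mul_add]
      have : 0 ≤ (L : ℝ) ^ 2 * (1 / ((L : ℝ) - b m) ^ 2) := by positivity
      linarith
    · have := aux ((L : ℝ) - b m) hbl (by
        unfold cappedDist
        rw [Int.cast_natCast, h]
        have : ((L : ℝ) - b m) / L ≤ 1 - Int.fract ((m : ℝ) * β) + 1 / L := by
          rw [div_le_iff₀ hLpos, add_mul, one_div_mul_cancel hLpos.ne']; linarith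
        linarith)
      refine this.trans ?_
      rw [mul_add]
      have : 0 ≤ (L : ℝ) ^ 2 * (1 / ((b m : ℝ) + 1) ^ 2) := by positivity
      linarith
  have hsub : (Finset.Ico a (a + K)).image b ⊆ Finset.range L := by
    intro x hx
    obtain ⟨m, -, rfl⟩ := Finset.mem_image.mp hx
    exact Finset.mem_range.mpr (hbL m)
  calc ∑ m ∈ Finset.Ico a (a + K), 1 / cappedDist β K (m : ℤ) ^ 2
      ≤ ∑ m ∈ Finset.Ico a (a + K), (L : ℝ) ^ 2 *
          (1 / ((b m : ℝ) + 1) ^ 2 + 1 / (((L - 1 - b m : ℕ) : ℝ) + 1) ^ 2) :=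
        Finset.sum_le_sum fun m _ => hterm m
    _ = ∑ j ∈ (Finset.Ico a (a + K)).image b, (L : ℝ) ^ 2 *
          (1 / ((j : ℝ) + 1) ^ 2 + 1 / (((L - 1 - j : ℕ) : ℝ) + 1) ^ 2) := by
        rw [Finset.sum_image hinj]
    _ ≤ ∑ j ∈ Finset.range L, (L : ℝ) ^ 2 *
          (1 / ((j : ℝ) + 1) ^ 2 + 1 / (((L - 1 - j : ℕ) : ℝ) + 1) ^ 2) :=
        Finset.sum_le_sum_of_subset_of_nonneg hsub fun _ _ _ => by positivity
    _ ≤ (L : ℝ) ^ 2 * (2 + 2) := by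
        rw [← Finset.mul_sum, Finset.sum_add_distrib,
          Finset.sum_range_reflect (fun j : ℕ => 1 / ((j : ℝ) + 1) ^ 2) L]
        gcongr <;> exact sum_range_inv_sq_le L
    _ ≤ (2 * (K / c)) ^ 2 * (2 + 2) := by gcongr
    _ = 16 / c ^ 2 * (K : ℝ) ^ 2 := by field_simp; ring

/-- Tail sums: `∑_{m ≥ K} m⁻² x_m⁻²` is bounded. -/
theorem sum_tail_inv_sq_le {c β : ℝ} (hc : 0 < c) (hβ : BadlyApproximableWith c β)
    {K : ℕ} (hK : 1 ≤ K) (M : ℕ) :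
    ∑ m ∈ Finset.Ico K M, 1 / (m : ℝ) ^ 2 * (1 / cappedDist β K (m : ℤ) ^ 2) ≤ 32 / c ^ 2 := by
  have hK' : (1 : ℝ) ≤ K := by exact_mod_cast hK
  -- The factor m⁻² ≤ ((b+1)K)⁻² cancels the K² of the block sum and leaves a convergent series in
  -- `b`.
  have hblock : ∀ b : ℕ, ∑ m ∈ Finset.Ico ((b + 1) * K) ((b + 1) * K + K),
      1 / (m : ℝ) ^ 2 * (1 / cappedDist β K (m : ℤ) ^ 2) ≤
        16 / c ^ 2 * (1 / ((b : ℝ) + 1) ^ 2) := by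
    intro b
    calc _ ≤ ∑ m ∈ Finset.Ico ((b + 1) * K) ((b + 1) * K + K),
          1 / (((b : ℝ) + 1) * K) ^ 2 * (1 / cappedDist β K (m : ℤ) ^ 2) := by
          refine Finset.sum_le_sum fun m hm => ?_
          have h1 := (Finset.mem_Ico.mp hm).1
          have : ((b : ℝ) + 1) * K ≤ m := by exact_mod_cast h1
          gcongr
      _ ≤ 1 / (((b : ℝ) + 1) * K) ^ 2 * (16 / c ^ 2 * (K : ℝ) ^ 2) := by
          rw [← Finset.mul_sum]
          gcongr
          exact sum_block_inv_sq_le hc hβ hK _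
      _ = _ := by field_simp
  have hind : ∀ B : ℕ, ∑ m ∈ Finset.Ico K ((B + 1) * K),
      1 / (m : ℝ) ^ 2 * (1 / cappedDist β K (m : ℤ) ^ 2) ≤
        ∑ b ∈ Finset.range B, 16 / c ^ 2 * (1 / ((b : ℝ) + 1) ^ 2) := by
    intro B
    induction B with
    | zero => simp
    | succ B ih =>
      rw [Finset.sum_range_succ, ← Finset.sum_Ico_consecutive _
        (show K ≤ (B + 1) * K by nlinarith) (show (B + 1) * K ≤ (B + 1 + 1) * K by nlinarith)]
      refine add_le_add ih ?_
      rw [show (B + 1 + 1) * K = (B + 1) * K + K by ring]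
      exact hblock B
  calc _ ≤ ∑ m ∈ Finset.Ico K ((M + 1) * K),
        1 / (m : ℝ) ^ 2 * (1 / cappedDist β K (m : ℤ) ^ 2) := by
        apply Finset.sum_le_sum_of_subset_of_nonneg
        · apply Finset.Ico_subset_Ico_right; nlinarith
        · intros; positivity
    _ ≤ _ := hind M
    _ = 16 / c ^ 2 * ∑ b ∈ Finset.range M, 1 / ((b : ℝ) + 1) ^ 2 := by rw [Finset.mul_sum]
    _ ≤ 16 / c ^ 2 * 2 := by gcongr; exact sum_range_inv_sq_le M
    _ = 32 / c ^ 2 := by ring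

theorem one_div_cappedDist_le (β : ℝ) {K : ℕ} (hK : 1 ≤ K) (m : ℤ) :
    1 / cappedDist β K m ≤ K := by
  have hK' : (0 : ℝ) < K := by exact_mod_cast hK
  rw [div_le_iff₀ (cappedDist_pos β hK m)]
  have := inv_le_cappedDist β K m
  rw [div_le_iff₀ hK'] at this
  linarith

/-- For 2^J ≤ m < 2^(J+1) bad approximability gives ‖mβ‖ ≥ c/2^(J+1). One factor of x⁻³ is thus
O(2^J), and the other two are compared with the cap 1/2^J, for which the dyadic range is a single
block of `sum_block_inv_sq_le`. The last range dominates, whatever `K` is. -/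
theorem sum_dyadic_le {c β : ℝ} (hc : 0 < c) (hβ : BadlyApproximableWith c β) (K : ℕ) (J : ℕ) :
    ∑ m ∈ Finset.Ico 1 ((2 : ℕ) ^ J), 1 / (m : ℝ) ^ 2 * (1 / cappedDist β K (m : ℤ) ^ 3) ≤
      (2 / c) * (3 / c) ^ 2 * (16 / c ^ 2) * 2 ^ J := by
  have hc1 := hβ.le_one
  induction J with
  | zero => simp; positivity
  | succ J ih =>
    rw [← Finset.sum_Ico_consecutive _ (show 1 ≤ 2 ^ J from Nat.one_le_two_pow)
      (show 2 ^ J ≤ 2 ^ (J + 1) from Nat.pow_le_pow_right (by norm_num) (by omega))]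
    have hblock : ∑ m ∈ Finset.Ico ((2 : ℕ) ^ J) (2 ^ (J + 1)),
        1 / (m : ℝ) ^ 2 * (1 / cappedDist β K (m : ℤ) ^ 3) ≤
          (2 / c) * (3 / c) ^ 2 * (16 / c ^ 2) * 2 ^ J := by
      have hP : (0 : ℝ) < 2 ^ J := by positivity
      calc _ ≤ ∑ m ∈ Finset.Ico ((2 : ℕ) ^ J) (2 ^ (J + 1)), 1 / ((2 : ℝ) ^ J) ^ 2 *
            ((2 / c) * 2 ^ J * ((3 / c) ^ 2 * (1 / cappedDist β (2 ^ J) (m : ℤ) ^ 2))) := by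
            refine Finset.sum_le_sum fun m hm => ?_
            obtain ⟨h1, h2⟩ := Finset.mem_Ico.mp hm
            have h1' : (2 : ℝ) ^ J ≤ m := by exact_mod_cast h1
            have h2' : (m : ℝ) ≤ 2 * 2 ^ J := by
              have : m ≤ 2 * 2 ^ J := by rw [pow_succ] at h2; omega
              exact_mod_cast this
            have hm0 : (0 : ℝ) < m := lt_of_lt_of_le hP h1'
            set n := ‖(((m : ℝ) * β : ℝ) : UnitAddCircle)‖ with hn
            have hlow : c / (2 * 2 ^ J) ≤ n := by
              refine le_trans ?_ (hβ m (by exact_mod_cast (show (0:ℝ) < m from hm0)))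
              exact div_le_div_of_nonneg_left hc.le hm0 h2'
            have hnpos : 0 < n := lt_of_lt_of_le (by positivity) hlow
            have hx : n ≤ cappedDist β K (m : ℤ) := by
              unfold cappedDist
              rw [Int.cast_natCast]
              have : (0 : ℝ) ≤ 1 / (K : ℝ) := by positivity
              linarith
            have hy : cappedDist β (2 ^ J) (m : ℤ) ≤ (3 / c) * n := by
              unfold cappedDist
              rw [Int.cast_natCast, ← hn]
              push_cast
              have e1 : 1 / (2 : ℝ) ^ J ≤ 2 / c * n := by
                calc 1 / (2 : ℝ) ^ J = 2 / c * (c / (2 * 2 ^ J)) := by field_simp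
                  _ ≤ _ := by gcongr
              have e2 : n ≤ 1 / c * n := by
                rw [one_div_mul_eq_div, le_div_iff₀ hc]; nlinarith
              calc n + 1 / 2 ^ J ≤ 1 / c * n + 2 / c * n := add_le_add e2 e1
                _ = 3 / c * n := by ring
            have hypos : 0 < cappedDist β (2 ^ J) (m : ℤ) := cappedDist_pos β Nat.one_le_two_pow _
            have hinv : 1 / n ≤ 3 / c * (1 / cappedDist β (2 ^ J) (m : ℤ)) := by
              rw [mul_one_div, div_le_div_iff₀ hnpos hypos, one_mul]; exact hy
            have hinv2 : 1 / n ≤ 2 / c * 2 ^ J := by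
              calc 1 / n ≤ 1 / (c / (2 * 2 ^ J)) := one_div_le_one_div_of_le (by positivity) hlow
                _ = _ := by field_simp
            have h3 : 1 / cappedDist β K (m : ℤ) ^ 3 ≤
                (2 / c) * 2 ^ J * ((3 / c) ^ 2 * (1 / cappedDist β (2 ^ J) (m : ℤ) ^ 2)) := by
              calc 1 / cappedDist β K (m : ℤ) ^ 3 ≤ 1 / n ^ 3 := by gcongr
                _ = (1 / n) * (1 / n) ^ 2 := by field_simp
                _ ≤ (2 / c * 2 ^ J) * (3 / c * (1 / cappedDist β (2 ^ J) (m : ℤ))) ^ 2 := by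
                    gcongr
                _ = _ := by ring
            have h4 : 0 ≤ 1 / cappedDist β K (m : ℤ) ^ 3 := by
              have : 0 < cappedDist β K (m : ℤ) := hnpos.trans_le hx
              positivity
            gcongr
        _ = 1 / ((2 : ℝ) ^ J) ^ 2 * ((2 / c) * 2 ^ J * ((3 / c) ^ 2 *
              ∑ m ∈ Finset.Ico ((2 : ℕ) ^ J) (2 ^ J + 2 ^ J),
                1 / cappedDist β (2 ^ J) (m : ℤ) ^ 2)) := by
            rw [← two_mul, ← pow_succ', Finset.mul_sum, Finset.mul_sum, Finset.mul_sum]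
        _ ≤ 1 / ((2 : ℝ) ^ J) ^ 2 * ((2 / c) * 2 ^ J * ((3 / c) ^ 2 *
              (16 / c ^ 2 * (2 ^ J) ^ 2))) := by
            gcongr
            have := sum_block_inv_sq_le hc hβ (K := 2 ^ J) Nat.one_le_two_pow (2 ^ J)
            push_cast at this
            exact this
        _ = _ := by field_simp
    have : (2 : ℝ) ^ (J + 1) = 2 * 2 ^ J := pow_succ' _ _
    rw [this]
    linarith

/-- `∑_{m ≥ 1} m⁻² x_m⁻³ = O(K)`. -/
theorem sum_inv_sq_inv_cube_le {c β : ℝ} (hc : 0 < c) (hβ : BadlyApproximableWith c β)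
    {K : ℕ} (hK : 1 ≤ K) (M : ℕ) :
    ∑ m ∈ Finset.Icc 1 M, 1 / (m : ℝ) ^ 2 * (1 / cappedDist β K (m : ℤ) ^ 3) ≤
      (608 / c ^ 5) * K := by
  have hc1 := hβ.le_one
  have hnn : ∀ m : ℕ, 0 ≤ 1 / (m : ℝ) ^ 2 * (1 / cappedDist β K (m : ℤ) ^ 3) := fun m => by
    have := cappedDist_pos β hK (m : ℤ); positivity
  -- With K < 2^J ≤ 2K the dyadic ranges reach beyond `K`; the overlap with the tail is harmless
  -- because the terms are nonnegative. In the tail one factor of x⁻³ is at most `K`.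
  set J := Nat.log 2 K + 1
  have hJ : K < 2 ^ J := Nat.lt_pow_succ_log_self (by norm_num) K
  have hJ2 : 2 ^ J ≤ 2 * K := by
    have := Nat.pow_log_le_self 2 (show K ≠ 0 by omega)
    rw [pow_succ]; omega
  have hJ2' : (2 : ℝ) ^ J ≤ 2 * K := by exact_mod_cast hJ2
  have htail : ∑ m ∈ Finset.Ico K (M + 1), 1 / (m : ℝ) ^ 2 * (1 / cappedDist β K (m : ℤ) ^ 3) ≤
      32 / c ^ 2 * K := by
    calc _ ≤ ∑ m ∈ Finset.Ico K (M + 1),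
          (1 / (m : ℝ) ^ 2 * (1 / cappedDist β K (m : ℤ) ^ 2)) * K := by
          refine Finset.sum_le_sum fun m _ => ?_
          have h1 := one_div_cappedDist_le β hK (m : ℤ)
          have h0 := cappedDist_pos β hK (m : ℤ)
          calc 1 / (m : ℝ) ^ 2 * (1 / cappedDist β K (m : ℤ) ^ 3)
              = (1 / (m : ℝ) ^ 2 * (1 / cappedDist β K (m : ℤ) ^ 2)) *
                (1 / cappedDist β K (m : ℤ)) := by field_simp
            _ ≤ _ := by gcongr
      _ ≤ _ := by
          rw [← Finset.sum_mul]
          gcongr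
          exact sum_tail_inv_sq_le hc hβ hK _
  calc _ ≤ ∑ m ∈ Finset.Ico 1 ((2 : ℕ) ^ J) ∪ Finset.Ico K (M + 1),
        1 / (m : ℝ) ^ 2 * (1 / cappedDist β K (m : ℤ) ^ 3) := by
        apply Finset.sum_le_sum_of_subset_of_nonneg
        · intro m hm
          simp only [Finset.mem_Icc, Finset.mem_union, Finset.mem_Ico] at hm ⊢
          omega
        · intros; exact hnn _
    _ ≤ ∑ m ∈ Finset.Ico 1 ((2 : ℕ) ^ J), 1 / (m : ℝ) ^ 2 * (1 / cappedDist β K (m : ℤ) ^ 3) +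
        ∑ m ∈ Finset.Ico K (M + 1), 1 / (m : ℝ) ^ 2 * (1 / cappedDist β K (m : ℤ) ^ 3) := by
        rw [← Finset.sum_union_inter]
        have := Finset.sum_nonneg (s := Finset.Ico 1 ((2 : ℕ) ^ J) ∩ Finset.Ico K (M + 1))
          fun m _ => hnn m
        linarith
    _ ≤ (2 / c) * (3 / c) ^ 2 * (16 / c ^ 2) * 2 ^ J + 32 / c ^ 2 * K :=
        add_le_add (sum_dyadic_le hc hβ K J) htail
    _ ≤ (2 / c) * (3 / c) ^ 2 * (16 / c ^ 2) * (2 * K) + 32 / c ^ 5 * K := by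
        have : c ^ 5 ≤ c ^ 2 := pow_le_pow_of_le_one hc.le hc1 (by norm_num)
        gcongr
    _ = (608 / c ^ 5) * K := by field_simp; ring

/-! ### The Bernoulli kernel on the circle. -/

/-- The second periodized Bernoulli polynomial on the circle. -/
noncomputable def circleBernoulli (x : UnitAddCircle) : ℝ := ‖x‖ ^ 2 - ‖x‖ + 1 / 6

theorem continuous_circleBernoulli : Continuous circleBernoulli := by
  unfold circleBernoulli; fun_prop

theorem circleBernoulli_coe (x : ℝ) :
    circleBernoulli (x : UnitAddCircle) = Int.fract x ^ 2 - Int.fract x + 1 / 6 := by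
  unfold circleBernoulli
  rcases norm_eq_fract_or x with h | h <;> rw [h]
  ring

/-- The kernel is the lower envelope of its parabolic pieces, each extended to the whole line;
neighbouring parabolas cross at the integers. This semiconcavity is the source of the dual
inequality for the transport problem. -/
theorem circleBernoulli_le (x : ℝ) (n : ℤ) :
    circleBernoulli (x : UnitAddCircle) ≤ x ^ 2 - (2 * n + 1) * x + n * (n + 1) + 1 / 6 := by
  rw [circleBernoulli_coe]
  have hx := Int.floor_add_fract x
  set f := Int.fract x
  have hf0 : 0 ≤ f := Int.fract_nonneg x
  have hf1 : f < 1 := Int.fract_lt_one x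
  obtain ⟨k, hk⟩ : ∃ k : ℤ, ⌊x⌋ = n + k := ⟨⌊x⌋ - n, by ring⟩
  rw [hk] at hx
  push_cast at hx
  rw [← hx]
  -- For x = n + k + f this is the gap between the two parabolas.
  have key : 0 ≤ (k : ℝ) * (k - 1 + 2 * f) := by
    rcases le_or_gt 1 k with h | h
    · have : (1 : ℝ) ≤ k := by exact_mod_cast h
      exact mul_nonneg (by linarith) (by linarith)
    · rcases eq_or_lt_of_le (Int.lt_add_one_iff.mp (by simpa using h) : k ≤ 0) with h0 | h0
      · simp [h0]
      · have : (k : ℝ) ≤ -1 := by exact_mod_cast (by omega : k ≤ -1)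
        exact mul_nonneg_of_nonpos_of_nonpos (by linarith) (by linarith)
  nlinarith

theorem circleBernoulli_eq (x : ℝ) (n : ℤ) (h1 : (n : ℝ) ≤ x) (h2 : x ≤ n + 1) :
    circleBernoulli (x : UnitAddCircle) = x ^ 2 - (2 * n + 1) * x + n * (n + 1) + 1 / 6 := by
  rw [circleBernoulli_coe]
  rcases eq_or_lt_of_le h2 with h | h
  · have : Int.fract x = 0 := by
      rw [h, show ((n : ℝ) + 1) = ((n + 1 : ℤ) : ℝ) by push_cast; ring, Int.fract_intCast]
    rw [this, h]; ring
  · have : ⌊x⌋ = n := Int.floor_eq_iff.mpr ⟨h1, h⟩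
    unfold Int.fract
    rw [this]; ring

theorem circleBernoulli_eq_abs (x : ℝ) (hx : |x| ≤ 1) :
    circleBernoulli (x : UnitAddCircle) = x ^ 2 - |x| + 1 / 6 := by
  rw [abs_le] at hx
  rcases le_total 0 x with h | h
  · rw [circleBernoulli_eq x 0 (by simpa using h) (by simpa using hx.2), abs_of_nonneg h]
    simp
  · rw [circleBernoulli_eq x (-1) (by simpa using hx.1) (by simpa using h), abs_of_nonpos h]
    simp; ring

/-! ### The transport map for sorted points, and its cost. -/

section Sorted

variable {N : ℕ} {t : ℕ → ℝ}

/-- The dual potential of the uniform measure on the points `t 0, …, t (N - 1)`. -/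
noncomputable def bernoulliPotential (N : ℕ) (t : ℕ → ℝ) (x : UnitAddCircle) : ℝ :=
  1 / (N : ℝ) * ∑ j ∈ Finset.range N, circleBernoulli (x - (t j : UnitAddCircle))

/-- The left end point of the fundamental domain that is optimally transported. -/
noncomputable def transportShift (N : ℕ) (t : ℕ → ℝ) : ℝ :=
  1 / (N : ℝ) * ∑ j ∈ Finset.range N, t j - 1 / 2

theorem sum_sign_range (N i : ℕ) (hi : i < N) (s : ℝ) :
    ∑ j ∈ Finset.range N, (if j < i then (1 : ℝ) else if j = i then s else -1) =
      2 * i - N + 1 + s := by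
  obtain ⟨k, rfl⟩ : ∃ k, N = i + 1 + k := ⟨N - (i + 1), by omega⟩
  rw [Finset.sum_range_add, Finset.sum_range_succ]
  have h1 : ∑ j ∈ Finset.range i, (if j < i then (1 : ℝ) else if j = i then s else -1) = i := by
    rw [Finset.sum_congr rfl (g := fun _ => (1 : ℝ))]
    · simp
    · intro j hj; simp [Finset.mem_range.mp hj]
  have h2 : ∑ j ∈ Finset.range k, (if i + 1 + j < i then (1 : ℝ) else
      if i + 1 + j = i then s else -1) = -k := by
    rw [Finset.sum_congr rfl (g := fun _ => (-1 : ℝ))]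
    · simp
    · intro j _
      rw [if_neg (by omega), if_neg (by omega)]
  rw [h1, h2]
  simp
  ring

/-- This is the dual inequality: `t i` maximises the potential minus (x - y)². Replacing each kernel
by a parabola gives slope sign 1 for j < i and -1 for j > i; at j = i the kernel has a concave kink,
where every `s` in [-1, 1] is admissible. The value of `s` is chosen so that the sum is exactly the
right-hand side, and -1 ≤ s ≤ 1 says precisely that `y` lies in the `i`-th arc of length 1/N counted
from `transportShift`. -/
theorem potential_sub_le (hN : 1 ≤ N) (ht : Monotone t) (h01 : ∀ i, t i ∈ Set.Icc (0 : ℝ) 1)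
    {i : ℕ} (hi : i < N) {y : ℝ} (hy1 : transportShift N t + i / N ≤ y)
    (hy2 : y ≤ transportShift N t + (i + 1) / N) (x : ℝ) :
    bernoulliPotential N t (x : UnitAddCircle) - bernoulliPotential N t (t i : UnitAddCircle) ≤
      (x - y) ^ 2 - (t i - y) ^ 2 := by
  have hN' : (0 : ℝ) < N := by exact_mod_cast hN
  set S := ∑ j ∈ Finset.range N, t j with hS
  set s : ℝ := 2 * N * y - 2 * S - (2 * i - N + 1) with hs
  have hshift : N * transportShift N t = S - N / 2 := by
    unfold transportShift; rw [← hS]; field_simp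
  have hs1 : -1 ≤ s := by
    have : N * (transportShift N t + i / N) ≤ N * y := mul_le_mul_of_nonneg_left hy1 hN'.le
    rw [mul_add, hshift, mul_div_cancel₀ _ hN'.ne'] at this
    linarith
  have hs2 : s ≤ 1 := by
    have : N * y ≤ N * (transportShift N t + (i + 1) / N) := mul_le_mul_of_nonneg_left hy2 hN'.le
    rw [mul_add, hshift, mul_div_cancel₀ _ hN'.ne'] at this
    linarith
  have hterm : ∀ j ∈ Finset.range N,
      circleBernoulli ((x : UnitAddCircle) - (t j : UnitAddCircle)) -
        circleBernoulli ((t i : UnitAddCircle) - (t j : UnitAddCircle)) ≤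
      (x - t i) * (x + t i - 2 * t j - (if j < i then (1 : ℝ) else if j = i then s else -1)) := by
    intro j _
    rw [← AddCircle.coe_sub, ← AddCircle.coe_sub]
    have hi01 := h01 i
    have hj01 := h01 j
    rw [Set.mem_Icc] at hi01 hj01
    have e0 := circleBernoulli_le (x - t j) 0
    have e1 := circleBernoulli_le (x - t j) (-1)
    push_cast at e0 e1
    split_ifs with hji hji'
    · have := ht hji.le
      have e2 := circleBernoulli_eq (t i - t j) 0 (by simpa using this) (by push_cast; linarith)
      push_cast at e2
      rw [e2]; nlinarith
    · subst hji'
      have e2 := circleBernoulli_eq (t j - t j) 0 (by simp) (by simp)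
      push_cast at e2
      rw [e2]
      rcases le_total 0 (x - t j) with h | h
      · nlinarith
      · nlinarith
    · have := ht (show i ≤ j by omega)
      have e2 := circleBernoulli_eq (t i - t j) (-1) (by push_cast; linarith)
        (by push_cast; linarith)
      push_cast at e2
      rw [e2]; nlinarith
  have hsum := Finset.sum_le_sum hterm
  rw [Finset.sum_sub_distrib, ← Finset.mul_sum, Finset.sum_sub_distrib, sum_sign_range N i hi s,
    Finset.sum_sub_distrib, ← Finset.mul_sum, ← hS] at hsum
  simp only [Finset.sum_const, Finset.card_range, nsmul_eq_mul] at hsum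
  unfold bernoulliPotential
  rw [← mul_sub, one_div_mul_eq_div, div_le_iff₀ hN']
  refine hsum.trans (le_of_eq ?_)
  rw [hs]; ring

/-- The index of the point to which the optimal transport plan sends `y`. -/
noncomputable def transportIndex (N : ℕ) (t : ℕ → ℝ) (y : ℝ) : ℕ :=
  ⌈(N : ℝ) * (y - transportShift N t)⌉₊ - 1

theorem measurable_transportIndex : Measurable (transportIndex N t) := by
  unfold transportIndex
  have h : Measurable (fun y : ℝ => (N : ℝ) * (y - transportShift N t)) := by fun_prop
  exact (measurable_from_nat (f := fun n : ℕ => n - 1)).comp h.nat_ceil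

/-- The ceiling matches arcs open on the left. At or left of `transportShift` the truncated
subtraction would also return 0, hence the strict inequality in the hypothesis. -/
theorem transportIndex_eq_iff (hN : 1 ≤ N) {y : ℝ} (hy : transportShift N t < y) (k : ℕ) :
    transportIndex N t y = k ↔
      y ∈ Set.Ioc (transportShift N t + k / N) (transportShift N t + (k + 1) / N) := by
  have hN' : (0 : ℝ) < N := by exact_mod_cast hN
  have hpos : 0 < (N : ℝ) * (y - transportShift N t) := mul_pos hN' (by linarith)
  have h1 : 1 ≤ ⌈(N : ℝ) * (y - transportShift N t)⌉₊ := Nat.ceil_pos.mpr hpos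
  have : transportIndex N t y = k ↔ ⌈(N : ℝ) * (y - transportShift N t)⌉₊ = k + 1 := by
    unfold transportIndex; omega
  rw [this, Nat.ceil_eq_iff (by omega)]
  simp only [Nat.add_sub_cancel, Set.mem_Ioc]
  push_cast
  rw [← lt_sub_iff_add_lt', div_lt_iff₀ hN', ← sub_le_iff_le_add' (a := y),
    le_div_iff₀ hN', mul_comm (N : ℝ)]

theorem transportIndex_lt (hN : 1 ≤ N) {y : ℝ}
    (hy : y ∈ Set.Ioc (transportShift N t) (transportShift N t + 1)) :
    transportIndex N t y < N := by
  have hN' : (0 : ℝ) < N := by exact_mod_cast hN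
  have h2 : ⌈(N : ℝ) * (y - transportShift N t)⌉₊ ≤ N := by
    apply Nat.ceil_le.mpr
    nlinarith [hy.2]
  unfold transportIndex; omega

theorem map_transportIndex (hN : 1 ≤ N) :
    (volume.restrict (Set.Ioc (transportShift N t) (transportShift N t + 1))).map
      (transportIndex N t) = (N : ℝ≥0∞)⁻¹ • ∑ i ∈ Finset.range N, Measure.dirac i := by
  have hN' : (0 : ℝ) < N := by exact_mod_cast hN
  refine Measure.ext_of_singleton fun k => ?_
  rw [Measure.map_apply measurable_transportIndex (measurableSet_singleton k),
    Measure.restrict_apply (measurable_transportIndex (measurableSet_singleton k))]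
  simp only [Measure.smul_apply, Measure.finsetSum_apply, smul_eq_mul, Measure.dirac_apply]
  by_cases hk : k < N
  · have hset : transportIndex N t ⁻¹' {k} ∩
        Set.Ioc (transportShift N t) (transportShift N t + 1) =
        Set.Ioc (transportShift N t + k / N) (transportShift N t + (k + 1) / N) := by
      ext y
      simp only [Set.mem_inter_iff, Set.mem_preimage, Set.mem_singleton_iff]
      constructor
      · rintro ⟨h1, h2⟩
        exact (transportIndex_eq_iff hN h2.1 k).mp h1
      · intro h
        have h0 : (0 : ℝ) ≤ k / N := by positivity
        have h1 : ((k : ℝ) + 1) / N ≤ 1 := by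
          rw [div_le_one hN']; exact_mod_cast hk
        have hy : y ∈ Set.Ioc (transportShift N t) (transportShift N t + 1) :=
          ⟨by linarith [h.1], by linarith [h.2]⟩
        exact ⟨(transportIndex_eq_iff hN hy.1 k).mpr h, hy⟩
    rw [hset, Real.volume_Ioc, Finset.sum_eq_single k]
    · simp only [Set.indicator_apply, Set.mem_singleton_iff, if_true, Pi.one_apply, mul_one]
      rw [show transportShift N t + (k + 1) / N - (transportShift N t + k / N) = (N : ℝ)⁻¹ by
        field_simp; ring, ENNReal.ofReal_inv_of_pos hN', ENNReal.ofReal_natCast]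
    · intro j _ hj; simp [hj]
    · intro h; exact absurd (Finset.mem_range.mpr hk) h
  · have hset : transportIndex N t ⁻¹' {k} ∩
        Set.Ioc (transportShift N t) (transportShift N t + 1) = ∅ := by
      ext y
      simp only [Set.mem_inter_iff, Set.mem_preimage, Set.mem_singleton_iff, Set.mem_empty_iff_false,
        iff_false, not_and]
      intro h1 h2
      exact hk (h1 ▸ transportIndex_lt hN h2)
    rw [hset, measure_empty, Finset.sum_eq_zero, mul_zero]
    intro j hj
    have : j ≠ k := by have := Finset.mem_range.mp hj; omega
    simp [this]

/-- In sorted order `t i` enters with sign + against the i smaller indices and with sign - against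
the N - 1 - i larger ones; each pair is counted twice. -/
theorem sum_sum_abs_sub (ht : Monotone t) (N : ℕ) :
    ∑ i ∈ Finset.range N, ∑ j ∈ Finset.range N, |t i - t j| =
      2 * ∑ i ∈ Finset.range N, (2 * (i : ℝ) + 1 - N) * t i := by
  induction N with
  | zero => simp
  | succ N ih =>
    have h1 : ∀ i ∈ Finset.range N, |t i - t N| = t N - t i := fun i hi => by
      rw [abs_sub_comm, abs_of_nonneg]
      linarith [ht (Finset.mem_range.mp hi).le]
    have h2 : ∀ i ∈ Finset.range N, |t N - t i| = t N - t i := fun i hi => by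
      rw [abs_of_nonneg]
      linarith [ht (Finset.mem_range.mp hi).le]
    simp_rw [Finset.sum_range_succ]
    rw [Finset.sum_add_distrib, ih, Finset.sum_congr rfl h1, Finset.sum_congr rfl h2,
      Finset.sum_sub_distrib]
    have h3 : ∑ i ∈ Finset.range N, (2 * (i : ℝ) + 1 - ((N + 1 : ℕ) : ℝ)) * t i =
        ∑ i ∈ Finset.range N, (2 * (i : ℝ) + 1 - N) * t i - ∑ i ∈ Finset.range N, t i := by
      rw [← Finset.sum_sub_distrib]
      refine Finset.sum_congr rfl fun i _ => ?_
      push_cast; ring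
    rw [h3]
    simp
    ring

theorem sum_cubes_aux (N : ℕ) :
    ∑ i ∈ Finset.range N, (3 * (i : ℝ) ^ 2 + 3 * i + 1) = (N : ℝ) ^ 3 := by
  induction N with
  | zero => simp
  | succ N ih => rw [Finset.sum_range_succ, ih]; push_cast; ring

/-- The cost of the optimal transport plan, as an energy. -/
theorem sum_integral_sq_eq (hN : 1 ≤ N) (ht : Monotone t) (h01 : ∀ i, t i ∈ Set.Icc (0 : ℝ) 1) :
    ∑ i ∈ Finset.range N, ∫ y in (transportShift N t + i / N)..(transportShift N t + (i + 1) / N),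
      (t i - y) ^ 2 = 1 / (2 * (N : ℝ) ^ 2) * ∑ i ∈ Finset.range N, ∑ j ∈ Finset.range N,
        circleBernoulli ((t i : UnitAddCircle) - (t j : UnitAddCircle)) := by
  have hN' : (0 : ℝ) < N := by exact_mod_cast hN
  set θ := transportShift N t with hθ
  -- After this shift the sum of `u` is N/2, and both sides become the same expression in ∑ u², ∑
  -- (2i+1)u and N.
  set u : ℕ → ℝ := fun i => t i - θ with hu
  have humono : Monotone u := fun i j h => sub_le_sub_right (ht h) _
  have hint : ∀ i ∈ Finset.range N, ∫ y in (θ + i / N)..(θ + (i + 1) / N), (t i - y) ^ 2 =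
      u i ^ 2 / N - (2 * (i : ℝ) + 1) * u i / N ^ 2 +
        (3 * (i : ℝ) ^ 2 + 3 * i + 1) / (3 * N ^ 3) := by
    intro i _
    rw [intervalIntegral.integral_comp_sub_left (fun y => y ^ 2) (t i), integral_pow]
    simp only [hu]
    push_cast
    field_simp
    ring
  have hb : ∀ i ∈ Finset.range N, ∀ j ∈ Finset.range N,
      circleBernoulli ((t i : UnitAddCircle) - (t j : UnitAddCircle)) =
        (u i ^ 2 + u j ^ 2 - 2 * u i * u j) - |u i - u j| + 1 / 6 := by
    intro i _ j _
    have hi01 := h01 i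
    have hj01 := h01 j
    rw [Set.mem_Icc] at hi01 hj01
    rw [← AddCircle.coe_sub, circleBernoulli_eq_abs _ (by rw [abs_le]; constructor <;> linarith)]
    simp only [hu, sub_sub_sub_cancel_right]
    ring
  have hS : ∑ i ∈ Finset.range N, u i = N / 2 := by
    simp only [hu, Finset.sum_sub_distrib, Finset.sum_const, Finset.card_range, nsmul_eq_mul, hθ]
    unfold transportShift
    field_simp
    ring
  have hcube : ∑ i ∈ Finset.range N, (3 * (i : ℝ) ^ 2 + 3 * i + 1) / (3 * (N : ℝ) ^ 3) = 1 / 3 := by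
    rw [← Finset.sum_div, sum_cubes_aux]
    field_simp
  rw [Finset.sum_congr rfl hint, Finset.sum_add_distrib, hcube,
    Finset.sum_congr rfl fun i hi => Finset.sum_congr rfl fun j hj => hb i hi j hj]
  simp only [Finset.sum_add_distrib, Finset.sum_sub_distrib, Finset.sum_const, Finset.card_range,
    nsmul_eq_mul, ← Finset.mul_sum, ← Finset.sum_div, ← Finset.sum_mul, sum_sum_abs_sub humono N,
    hS]
  have h4 : ∑ i ∈ Finset.range N, (2 * (i : ℝ) + 1 - N) * u i =
      ∑ i ∈ Finset.range N, (2 * (i : ℝ) + 1) * u i - N * (N / 2) := by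
    rw [← hS, Finset.mul_sum, ← Finset.sum_sub_distrib]
    refine Finset.sum_congr rfl fun i _ => ?_
    ring
  rw [h4]
  field_simp
  ring

end Sorted

/-! ### Couplings, duality and the Wasserstein distance. -/

section Sorted

variable {N : ℕ} {t : ℕ → ℝ}

theorem volume_eq_haarAddCircle :
    (volume : Measure UnitAddCircle) = AddCircle.haarAddCircle := by
  rw [AddCircle.volume_eq_smul_haarAddCircle]
  simp

/-- The optimal transport plan between the uniform measure on `t 0, …, t (N - 1)` and the Haar
measure. -/
noncomputable def optimalPlan (N : ℕ) (t : ℕ → ℝ) : Measure (UnitAddCircle × UnitAddCircle) :=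
  (volume.restrict (Set.Ioc (transportShift N t) (transportShift N t + 1))).map
    (fun y => (((t (transportIndex N t y) : ℝ) : UnitAddCircle), (y : UnitAddCircle)))

theorem measurable_comp_transportIndex {E : Type*} [MeasurableSpace E] (f : ℕ → E) :
    Measurable fun y => f (transportIndex N t y) :=
  (measurable_from_nat (f := f)).comp measurable_transportIndex

theorem measurable_coe_unitAddCircle : Measurable (fun y : ℝ => (y : UnitAddCircle)) :=
  AddCircle.measurable_mk'

theorem map_restrict_comp_transportIndex (hN : 1 ≤ N) :
    (volume.restrict (Set.Ioc (transportShift N t) (transportShift N t + 1))).map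
      (fun y => ((t (transportIndex N t y) : ℝ) : UnitAddCircle)) =
    (N : ℝ≥0∞)⁻¹ • ∑ i ∈ Finset.range N, Measure.dirac ((t i : ℝ) : UnitAddCircle) := by
  have h := map_transportIndex (t := t) hN
  have hm : Measurable (fun i : ℕ => ((t i : ℝ) : UnitAddCircle)) := measurable_from_nat
  have h2 := congrArg (Measure.map (fun i : ℕ => ((t i : ℝ) : UnitAddCircle))) h
  rw [Measure.map_map hm measurable_transportIndex, Measure.map_smul] at h2
  rw [show (fun y => ((t (transportIndex N t y) : ℝ) : UnitAddCircle)) =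
    (fun i : ℕ => ((t i : ℝ) : UnitAddCircle)) ∘ transportIndex N t from rfl, h2]
  congr 1
  rw [← Measure.mapₗ_apply_of_measurable hm, map_sum]
  refine Finset.sum_congr rfl fun i _ => ?_
  rw [Measure.mapₗ_apply_of_measurable hm]
  exact Measure.map_dirac' hm i

theorem isCoupling_optimalPlan (hN : 1 ≤ N) :
    IsCoupling ((N : ℝ≥0∞)⁻¹ • ∑ i ∈ Finset.range N, Measure.dirac ((t i : ℝ) : UnitAddCircle))
      (AddCircle.haarAddCircle : Measure UnitAddCircle) (optimalPlan N t) := by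
  have hm : Measurable
      (fun y => (((t (transportIndex N t y) : ℝ) : UnitAddCircle), (y : UnitAddCircle))) :=
    (measurable_comp_transportIndex (fun i => ((t i : ℝ) : UnitAddCircle))).prodMk
      measurable_coe_unitAddCircle
  have hsnd : (optimalPlan N t).map Prod.snd = AddCircle.haarAddCircle := by
    unfold optimalPlan
    rw [Measure.map_map measurable_snd hm, ← volume_eq_haarAddCircle]
    exact (AddCircle.measurePreserving_mk 1 (transportShift N t)).map_eq
  refine ⟨?_, ?_, hsnd⟩
  · have : IsProbabilityMeasure ((optimalPlan N t).map Prod.snd) := by rw [hsnd]; infer_instance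
    constructor
    have h := this.measure_univ
    rwa [Measure.map_apply measurable_snd MeasurableSet.univ, Set.preimage_univ] at h
  · unfold optimalPlan
    rw [Measure.map_map measurable_fst hm]
    exact map_restrict_comp_transportIndex hN

theorem transportIndex_mem (hN : 1 ≤ N) {y : ℝ}
    (hy : y ∈ Set.Ioc (transportShift N t) (transportShift N t + 1)) :
    transportIndex N t y < N ∧ transportShift N t + transportIndex N t y / N ≤ y ∧
      y ≤ transportShift N t + (transportIndex N t y + 1) / N := by
  have h := (transportIndex_eq_iff hN hy.1 _).mp rfl
  exact ⟨transportIndex_lt hN hy, h.1.le, h.2⟩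

theorem abs_sub_le_two (h01 : ∀ i, t i ∈ Set.Icc (0 : ℝ) 1) (hN : 1 ≤ N) {y : ℝ}
    (hy : y ∈ Set.Ioc (transportShift N t) (transportShift N t + 1)) (i : ℕ) :
    (t i - y) ^ 2 ≤ 4 := by
  have hN' : (0 : ℝ) < N := by exact_mod_cast hN
  have h1 : -1 / 2 ≤ transportShift N t := by
    unfold transportShift
    have : 0 ≤ 1 / (N : ℝ) * ∑ j ∈ Finset.range N, t j :=
      mul_nonneg (by positivity) (Finset.sum_nonneg fun j _ => (h01 j).1)
    linarith
  have h2 : transportShift N t ≤ 1 / 2 := by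
    unfold transportShift
    have : ∑ j ∈ Finset.range N, t j ≤ ∑ j ∈ Finset.range N, 1 :=
      Finset.sum_le_sum fun j _ => (h01 j).2
    have : 1 / (N : ℝ) * ∑ j ∈ Finset.range N, t j ≤ 1 := by
      rw [one_div_mul_eq_div, div_le_one hN']; simpa using this
    linarith
  have := h01 i
  rw [Set.mem_Icc] at this
  nlinarith [hy.1, hy.2]

theorem integrableOn_transport (h01 : ∀ i, t i ∈ Set.Icc (0 : ℝ) 1) (hN : 1 ≤ N) :
    IntegrableOn (fun y => (t (transportIndex N t y) - y) ^ 2)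
      (Set.Ioc (transportShift N t) (transportShift N t + 1)) := by
  apply Measure.integrableOn_of_bounded (M := 4)
  · simp
  · apply Measurable.aestronglyMeasurable
    have := measurable_comp_transportIndex (N := N) (t := t) t
    exact (this.sub measurable_id).pow_const 2
  · rw [ae_restrict_iff' measurableSet_Ioc]
    filter_upwards with y hy
    rw [Real.norm_of_nonneg (sq_nonneg _)]
    exact abs_sub_le_two h01 hN hy _

theorem integral_transport_eq (hN : 1 ≤ N) (ht : Monotone t)
    (h01 : ∀ i, t i ∈ Set.Icc (0 : ℝ) 1) :
    ∫ y in Set.Ioc (transportShift N t) (transportShift N t + 1),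
      (t (transportIndex N t y) - y) ^ 2 =
    1 / (2 * (N : ℝ) ^ 2) * ∑ i ∈ Finset.range N, ∑ j ∈ Finset.range N,
        circleBernoulli ((t i : UnitAddCircle) - (t j : UnitAddCircle)) := by
  have hN' : (0 : ℝ) < N := by exact_mod_cast hN
  rw [← sum_integral_sq_eq hN ht h01, ← intervalIntegral.integral_of_le (by linarith)]
  have h0 : transportShift N t = transportShift N t + ((0 : ℕ) : ℝ) / N := by simp
  have h1 : transportShift N t + 1 = transportShift N t + (N : ℝ) / N := by
    rw [div_self hN'.ne']
  have hle : ∀ k : ℕ, transportShift N t + (k : ℝ) / N ≤ transportShift N t + ((k : ℝ) + 1) / N :=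
    fun k => by gcongr; linarith
  have hmain := intervalIntegral.sum_integral_adjacent_intervals
    (f := fun y => (t (transportIndex N t y) - y) ^ 2) (μ := volume)
    (a := fun k : ℕ => transportShift N t + (k : ℝ) / N) (n := N) (fun k hk => by
      have hk' : ((k : ℝ) + 1) / N ≤ 1 := by
        rw [div_le_one hN']; exact_mod_cast hk
      have hk0 : (0 : ℝ) ≤ k / N := by positivity
      push_cast
      rw [intervalIntegrable_iff_integrableOn_Ioc_of_le (hle k)]
      refine (integrableOn_transport h01 hN).mono_set (Set.Ioc_subset_Ioc ?_ ?_) <;> linarith)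
  rw [← h0, ← h1] at hmain
  rw [← hmain]
  refine Finset.sum_congr rfl fun k hk => ?_
  push_cast
  apply intervalIntegral.integral_congr_ae
  filter_upwards with y hy
  rw [Set.uIoc_of_le (hle k)] at hy
  have hk0 : (0 : ℝ) ≤ k / N := by positivity
  rw [(transportIndex_eq_iff hN (by linarith [hy.1]) k).mpr hy]

/-- The dual potential on the side of the Haar measure. -/
noncomputable def dualPotential (N : ℕ) (t : ℕ → ℝ) (y : UnitAddCircle) : ℝ :=
  (t (transportIndex N t (AddCircle.measurableEquivIoc 1 (transportShift N t) y)) -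
      AddCircle.measurableEquivIoc 1 (transportShift N t) y) ^ 2 -
    bernoulliPotential N t
      ((t (transportIndex N t (AddCircle.measurableEquivIoc 1 (transportShift N t) y)) : ℝ) :
        UnitAddCircle)

/-- Among the real representatives of `x`, the one nearest to that of `y` turns the circle distance
into a real distance. `potential_sub_le` holds for every representative, in particular for this one.
-/
theorem potential_add_dual_le (hN : 1 ≤ N) (ht : Monotone t)
    (h01 : ∀ i, t i ∈ Set.Icc (0 : ℝ) 1) (x y : UnitAddCircle) :
    bernoulliPotential N t x + dualPotential N t y ≤ dist x y ^ 2 := by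
  obtain ⟨r, rfl⟩ := QuotientAddGroup.mk_surjective x
  set s := AddCircle.measurableEquivIoc 1 (transportShift N t) y with hs
  have hy : ((s : ℝ) : UnitAddCircle) = y := (AddCircle.equivIoc 1 (transportShift N t)).symm_apply_apply y
  obtain ⟨hi, h1, h2⟩ := transportIndex_mem hN s.2
  have hx : ((r : ℝ) : UnitAddCircle) = ((r - round (r - s) : ℝ) : UnitAddCircle) := by
    rw [AddCircle.coe_sub]
    have : ((round (r - (s : ℝ)) : ℝ) : UnitAddCircle) = 0 := by
      rw [AddCircle.coe_eq_zero_iff]; exact ⟨round (r - (s : ℝ)), by simp⟩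
    rw [this, sub_zero]
  have hd : dist ((r : ℝ) : UnitAddCircle) y = |(r - round (r - s) : ℝ) - s| := by
    rw [dist_eq_norm, ← hy, ← AddCircle.coe_sub, UnitAddCircle.norm_eq]
    congr 1; ring
  have key := potential_sub_le hN ht h01 hi h1 h2 (r - round (r - s))
  unfold dualPotential
  rw [← hs]
  change bernoulliPotential N t ((r : ℝ) : UnitAddCircle) + _ ≤ dist ((r : ℝ) : UnitAddCircle) y ^ 2
  rw [hd, sq_abs, hx]
  linarith

theorem continuous_bernoulliPotential : Continuous (bernoulliPotential N t) := by
  unfold bernoulliPotential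
  refine continuous_const.mul (continuous_finsetSum _ fun j _ => ?_)
  exact continuous_circleBernoulli.comp (continuous_id.sub continuous_const)

theorem measurable_dualPotential : Measurable (dualPotential N t) := by
  have h1 : Measurable fun y : UnitAddCircle =>
      ((AddCircle.measurableEquivIoc 1 (transportShift N t) y : ℝ)) :=
    measurable_subtype_coe.comp (AddCircle.measurableEquivIoc 1 (transportShift N t)).measurable
  have h2 : Measurable fun y : UnitAddCircle =>
      t (transportIndex N t (AddCircle.measurableEquivIoc 1 (transportShift N t) y)) :=
    (measurable_comp_transportIndex t).comp h1
  unfold dualPotential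
  exact ((h2.sub h1).pow_const 2).sub
    (continuous_bernoulliPotential.measurable.comp (measurable_coe_unitAddCircle.comp h2))

theorem exists_bound_potential :
    ∃ B, ∀ x, |bernoulliPotential N t x| ≤ B := by
  obtain ⟨B, hB⟩ := isCompact_univ.exists_bound_of_continuousOn
    (continuous_bernoulliPotential (N := N) (t := t)).continuousOn
  exact ⟨B, fun x => by simpa using hB x (Set.mem_univ x)⟩

theorem integrable_dualPotential (hN : 1 ≤ N) (h01 : ∀ i, t i ∈ Set.Icc (0 : ℝ) 1)
    (μ : Measure UnitAddCircle) [IsFiniteMeasure μ] : Integrable (dualPotential N t) μ := by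
  obtain ⟨B, hB⟩ := exists_bound_potential (N := N) (t := t)
  refine Integrable.of_bound measurable_dualPotential.aestronglyMeasurable (4 + B) ?_
  filter_upwards with y
  unfold dualPotential
  refine (norm_sub_le _ _).trans (add_le_add ?_ (hB _))
  rw [Real.norm_of_nonneg (sq_nonneg _)]
  exact abs_sub_le_two h01 hN (Subtype.coe_prop _) _

theorem measurableEquivIoc_coe_of_mem {y a : ℝ} (hy : y ∈ Set.Ioc a (a + 1)) :
    ((AddCircle.measurableEquivIoc 1 a (y : UnitAddCircle) : ℝ)) = y := by
  have := AddCircle.equivIoc_coe_of_mem (p := (1 : ℝ)) (a := a) hy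
  exact this

/-- The transport map pushes Lebesgue measure on the fundamental domain to the empirical measure, so
the potential at the transported point integrates to its empirical mean. Consequently the dual value
of the two potentials is exactly the cost of the plan. -/
theorem integral_dualPotential (hN : 1 ≤ N) (h01 : ∀ i, t i ∈ Set.Icc (0 : ℝ) 1) :
    ∫ y, dualPotential N t y ∂(AddCircle.haarAddCircle : Measure UnitAddCircle) =
      (∫ y in Set.Ioc (transportShift N t) (transportShift N t + 1),
        (t (transportIndex N t y) - y) ^ 2) -
      ∫ x, bernoulliPotential N t x ∂((N : ℝ≥0∞)⁻¹ •
        ∑ i ∈ Finset.range N, Measure.dirac ((t i : ℝ) : UnitAddCircle)) := by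
  obtain ⟨B, hB⟩ := exists_bound_potential (N := N) (t := t)
  have hmeas := (continuous_bernoulliPotential (N := N) (t := t)).measurable
  rw [← volume_eq_haarAddCircle, ← AddCircle.integral_preimage 1 (transportShift N t),
    ← map_restrict_comp_transportIndex hN,
    integral_map (measurable_comp_transportIndex
      (fun i => ((t i : ℝ) : UnitAddCircle))).aemeasurable hmeas.aestronglyMeasurable,
    ← integral_sub (integrableOn_transport h01 hN)]
  · refine setIntegral_congr_fun measurableSet_Ioc fun y hy => ?_
    simp only [dualPotential, measurableEquivIoc_coe_of_mem hy]
  · refine Integrable.of_bound (C := B) ?_ ?_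
    · exact (hmeas.comp (measurable_comp_transportIndex
        (fun i => ((t i : ℝ) : UnitAddCircle)))).aestronglyMeasurable
    · filter_upwards with y; exact hB _

theorem lintegral_edist_sq_eq (ϑ : Measure (UnitAddCircle × UnitAddCircle))
    [IsProbabilityMeasure ϑ] :
    ∫⁻ z, edist z.1 z.2 ^ (2 : ℝ) ∂ϑ = ENNReal.ofReal (∫ z, dist z.1 z.2 ^ 2 ∂ϑ) := by
  rw [ofReal_integral_eq_lintegral_ofReal]
  · refine lintegral_congr fun z => ?_
    rw [edist_dist, ENNReal.rpow_ofNat, ENNReal.ofReal_pow dist_nonneg]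
  · exact (continuous_dist.pow 2).integrable_of_hasCompactSupport
      (HasCompactSupport.of_compactSpace _)
  · filter_upwards with z; positivity

/-- Weak duality: the integral of the two potentials against a coupling depends only on the
marginals, and there the potential terms cancel. -/
theorem le_lintegral_of_isCoupling (hN : 1 ≤ N) (ht : Monotone t)
    (h01 : ∀ i, t i ∈ Set.Icc (0 : ℝ) 1) {ϑ : Measure (UnitAddCircle × UnitAddCircle)}
    (hϑ : IsCoupling ((N : ℝ≥0∞)⁻¹ • ∑ i ∈ Finset.range N,
      Measure.dirac ((t i : ℝ) : UnitAddCircle)) AddCircle.haarAddCircle ϑ) :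
    ENNReal.ofReal (∫ y in Set.Ioc (transportShift N t) (transportShift N t + 1),
        (t (transportIndex N t y) - y) ^ 2) ≤ ∫⁻ z, edist z.1 z.2 ^ (2 : ℝ) ∂ϑ := by
  obtain ⟨hprob, hfst, hsnd⟩ := hϑ
  rw [lintegral_edist_sq_eq]
  apply ENNReal.ofReal_le_ofReal
  obtain ⟨B, hB⟩ := exists_bound_potential (N := N) (t := t)
  have hmeas := (continuous_bernoulliPotential (N := N) (t := t)).measurable
  have hi1 : Integrable (fun z : UnitAddCircle × UnitAddCircle => bernoulliPotential N t z.1) ϑ :=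
    Integrable.of_bound (hmeas.comp measurable_fst).aestronglyMeasurable B
      (by filter_upwards with z; exact hB _)
  have hi2 : Integrable (fun z : UnitAddCircle × UnitAddCircle => dualPotential N t z.2) ϑ := by
    have := integrable_dualPotential (t := t) hN h01 (ϑ.map Prod.snd)
    exact (integrable_map_measure measurable_dualPotential.aestronglyMeasurable
      measurable_snd.aemeasurable).mp this
  calc _ = ∫ z, (bernoulliPotential N t z.1 + dualPotential N t z.2) ∂ϑ := by
        rw [integral_add hi1 hi2, ← integral_map (φ := Prod.fst) (f := bernoulliPotential N t)
          measurable_fst.aemeasurable hmeas.aestronglyMeasurable,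
          ← integral_map (φ := Prod.snd) (f := dualPotential N t) measurable_snd.aemeasurable
          measurable_dualPotential.aestronglyMeasurable, hfst, hsnd,
          integral_dualPotential hN h01]
        ring
    _ ≤ _ := by
        refine integral_mono (hi1.add hi2) ?_ fun z => potential_add_dual_le hN ht h01 _ _
        exact (continuous_dist.pow 2).integrable_of_hasCompactSupport
          (HasCompactSupport.of_compactSpace _)

/-- An inequality suffices, because the circle distance is at most the distance of the real
representatives; duality supplies the reverse bound. -/
theorem lintegral_optimalPlan_le (hN : 1 ≤ N) (h01 : ∀ i, t i ∈ Set.Icc (0 : ℝ) 1) :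
    ∫⁻ z, edist z.1 z.2 ^ (2 : ℝ) ∂(optimalPlan N t) ≤
      ENNReal.ofReal (∫ y in Set.Ioc (transportShift N t) (transportShift N t + 1),
        (t (transportIndex N t y) - y) ^ 2) := by
  have := (isCoupling_optimalPlan (t := t) hN).1
  rw [lintegral_edist_sq_eq]
  apply ENNReal.ofReal_le_ofReal
  unfold optimalPlan
  rw [integral_map]
  · refine integral_mono ?_ (integrableOn_transport h01 hN) fun y => ?_
    · refine Integrable.of_bound (C := 1) ?_ ?_
      · apply Measurable.aestronglyMeasurable
        have h1 := measurable_comp_transportIndex (N := N) (t := t)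
          (fun i => ((t i : ℝ) : UnitAddCircle))
        exact (continuous_dist.pow 2).measurable.comp (h1.prodMk measurable_coe_unitAddCircle)
      · filter_upwards with y
        rw [Real.norm_of_nonneg (by positivity), dist_eq_norm, ← AddCircle.coe_sub]
        exact pow_le_one₀ (norm_nonneg _) (unitAddCircle_norm_le_one _)
    · simp only
      rw [dist_eq_norm, ← AddCircle.coe_sub, ← sq_abs (_ - y)]
      exact pow_le_pow_left₀ (norm_nonneg _) (unitAddCircle_norm_le_abs _) 2
  · exact ((measurable_comp_transportIndex (fun i => ((t i : ℝ) : UnitAddCircle))).prodMk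
      measurable_coe_unitAddCircle).aemeasurable
  · exact (continuous_dist.pow 2).aestronglyMeasurable

theorem wasserstein_two_sq_sorted (hN : 1 ≤ N) (ht : Monotone t)
    (h01 : ∀ i, t i ∈ Set.Icc (0 : ℝ) 1) :
    wasserstein 2 ((N : ℝ≥0∞)⁻¹ • ∑ i ∈ Finset.range N,
      Measure.dirac ((t i : ℝ) : UnitAddCircle)) AddCircle.haarAddCircle ^ 2 =
    1 / (2 * (N : ℝ) ^ 2) * ∑ i ∈ Finset.range N, ∑ j ∈ Finset.range N,
        circleBernoulli ((t i : UnitAddCircle) - (t j : UnitAddCircle)) := by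
  rw [← integral_transport_eq hN ht h01]
  set A := ∫ y in Set.Ioc (transportShift N t) (transportShift N t + 1),
      (t (transportIndex N t y) - y) ^ 2 with hA
  have hA0 : 0 ≤ A := integral_nonneg fun y => sq_nonneg _
  have hinf : (⨅ (ϑ : Measure (UnitAddCircle × UnitAddCircle)) (_ : IsCoupling
      ((N : ℝ≥0∞)⁻¹ • ∑ i ∈ Finset.range N, Measure.dirac ((t i : ℝ) : UnitAddCircle))
      AddCircle.haarAddCircle ϑ),
      (∫⁻ z, edist z.1 z.2 ^ (2 : ℝ) ∂ϑ) ^ (1 / (2 : ℝ))) =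
      ENNReal.ofReal A ^ (1 / (2 : ℝ)) := by
    apply le_antisymm
    · refine (iInf₂_le (optimalPlan N t) (isCoupling_optimalPlan hN)).trans ?_
      exact ENNReal.rpow_le_rpow (lintegral_optimalPlan_le hN h01) (by norm_num)
    · refine le_iInf₂ fun ϑ hϑ => ?_
      exact ENNReal.rpow_le_rpow (le_lintegral_of_isCoupling hN ht h01 hϑ) (by norm_num)
  unfold wasserstein
  rw [hinf, ← ENNReal.toReal_pow, ← ENNReal.rpow_natCast, ← ENNReal.rpow_mul]
  norm_num
  exact hA0

end Sorted

/-- The squared quadratic Wasserstein distance of the uniform measure on finitely many points of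
the circle from the Haar measure. -/
theorem wasserstein_two_sq_uniform {N : ℕ} (hN : 1 ≤ N) (a : Fin N → UnitAddCircle) :
    wasserstein 2 ((N : ℝ≥0∞)⁻¹ • ∑ i, Measure.dirac (a i)) AddCircle.haarAddCircle ^ 2 =
      1 / (2 * (N : ℝ) ^ 2) * ∑ i, ∑ j, circleBernoulli (a i - a j) := by
  have hrep : ∀ i, ∃ r : ℝ, r ∈ Set.Icc (0 : ℝ) 1 ∧ (r : UnitAddCircle) = a i := fun i => by
    refine ⟨AddCircle.measurableEquivIoc 1 0 (a i), ?_,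
      (AddCircle.equivIoc (1 : ℝ) 0).symm_apply_apply (a i)⟩
    have := (AddCircle.measurableEquivIoc 1 0 (a i)).2
    exact ⟨this.1.le, by simpa using this.2⟩
  choose r hr hra using hrep
  set σ := Tuple.sort r
  -- The value 1 from `N` on keeps `t` monotone and in the unit interval; only the first `N` values
  -- enter the measure.
  set t : ℕ → ℝ := fun i => if h : i < N then r (σ ⟨i, h⟩) else 1 with ht
  have h01 : ∀ i, t i ∈ Set.Icc (0 : ℝ) 1 := fun i => by
    simp only [ht]
    split_ifs
    · exact hr _
    · simp
  have hmono : Monotone t := fun i j hij => by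
    simp only [ht]
    split_ifs with h1 h2 h2
    · exact Tuple.monotone_sort r (show (⟨i, h1⟩ : Fin N) ≤ ⟨j, h2⟩ from hij)
    · exact (hr _).2
    · omega
    · exact le_rfl
  have htσ : ∀ i : Fin N, ((t i : ℝ) : UnitAddCircle) = a (σ i) := fun i => by
    simp only [ht, i.2, dif_pos, hra]
  have key := wasserstein_two_sq_sorted hN hmono h01
  simp only [Finset.sum_range, htσ] at key
  rw [Equiv.sum_comp σ (fun i => Measure.dirac (a i)),
    Equiv.sum_comp σ (fun i => ∑ j, circleBernoulli (a i - a (σ j)))] at key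
  rw [key]
  congr 1
  exact Finset.sum_congr rfl fun i _ => Equiv.sum_comp σ (fun j => circleBernoulli (a i - a j))

/-! ### Characters and the Fourier expansion of the energy. -/

/-- The character `x ↦ e^{2π i m α x}` on `ℤ`. -/
noncomputable def latticeChar (α : ℝ) (m x : ℤ) : ℂ :=
  Complex.exp (((2 * Real.pi * ((m : ℝ) * α) : ℝ) : ℂ) * ((x : ℝ) : ℂ) * Complex.I)

theorem latticeChar_eq (α : ℝ) (m x : ℤ) :
    latticeChar α m x = Complex.exp (((2 * Real.pi * ((m : ℝ) * α) * x : ℝ) : ℂ) * Complex.I) := by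
  unfold latticeChar; push_cast; ring_nf

theorem norm_latticeChar (α : ℝ) (m x : ℤ) : ‖latticeChar α m x‖ = 1 := by
  rw [latticeChar_eq, Complex.norm_exp_ofReal_mul_I]

theorem latticeChar_add_right (α : ℝ) (m x y : ℤ) :
    latticeChar α m (x + y) = latticeChar α m x * latticeChar α m y := by
  unfold latticeChar
  rw [← Complex.exp_add]; push_cast; ring_nf

theorem latticeChar_add_left (α : ℝ) (m l x : ℤ) :
    latticeChar α (m + l) x = latticeChar α m x * latticeChar α l x := by
  unfold latticeChar
  rw [← Complex.exp_add]; push_cast; ring_nf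

theorem conj_latticeChar (α : ℝ) (m x : ℤ) :
    (starRingEnd ℂ) (latticeChar α m x) = latticeChar α (-m) x := by
  rw [latticeChar_eq, latticeChar_eq, ← Complex.exp_conj, map_mul, Complex.conj_ofReal,
    Complex.conj_I]
  push_cast; ring_nf

theorem latticeChar_mul_neg (α : ℝ) (m x : ℤ) :
    latticeChar α m x * latticeChar α (-m) x = 1 := by
  rw [← latticeChar_add_left]; simp [latticeChar]

theorem norm_sq_sum_eq {ι : Type*} (s : Finset ι) (θ : ι → ℝ) :
    ‖∑ i ∈ s, Complex.exp ((θ i : ℂ) * Complex.I)‖ ^ 2 =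
      ∑ i ∈ s, ∑ j ∈ s, Real.cos (θ i - θ j) := by
  have h : ((‖∑ i ∈ s, Complex.exp ((θ i : ℂ) * Complex.I)‖ ^ 2 : ℝ) : ℂ) =
      ∑ i ∈ s, ∑ j ∈ s, Complex.exp (((θ i - θ j : ℝ) : ℂ) * Complex.I) := by
    rw [← Complex.normSq_eq_norm_sq, ← Complex.mul_conj, map_sum, Finset.sum_mul_sum]
    refine Finset.sum_congr rfl fun i _ => Finset.sum_congr rfl fun j _ => ?_
    rw [← Complex.exp_conj, map_mul, Complex.conj_ofReal, Complex.conj_I, ← Complex.exp_add]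
    push_cast; ring_nf
  have h2 := congrArg Complex.re h
  rw [Complex.ofReal_re, Complex.re_sum] at h2
  rw [h2]
  refine Finset.sum_congr rfl fun i _ => ?_
  rw [Complex.re_sum]
  exact Finset.sum_congr rfl fun j _ => Complex.exp_ofReal_mul_I_re _

/-- The index m = 0 contributes nothing, since division by zero gives 0; this agrees with the kernel
having mean zero. -/
theorem hasSum_circleBernoulli (x : ℝ) :
    HasSum (fun m : ℕ => 1 / (Real.pi ^ 2 * (m : ℝ) ^ 2) * Real.cos (2 * Real.pi * m * x))
      (circleBernoulli (x : UnitAddCircle)) := by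
  have h := hasSum_one_div_nat_pow_mul_cos (k := 1) one_ne_zero
    (x := Int.fract x) ⟨Int.fract_nonneg x, (Int.fract_lt_one x).le⟩
  have hpi := Real.pi_pos.ne'
  have hB : Polynomial.eval (Int.fract x) (Polynomial.map (algebraMap ℚ ℝ)
      (Polynomial.bernoulli (2 * 1))) = circleBernoulli (x : UnitAddCircle) := by
    rw [circleBernoulli_coe]
    simp [Polynomial.bernoulli, Finset.sum_range_succ, bernoulli_eq_bernoulli'_of_ne_one,
      bernoulli_one, Polynomial.eval_add]
    ring
  rw [hB] at h
  have h2 := h.mul_left (1 / Real.pi ^ 2)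
  have hval : 1 / Real.pi ^ 2 * ((-1) ^ (1 + 1) * (2 * Real.pi) ^ (2 * 1) / 2 /
      ((2 * 1).factorial : ℝ) * circleBernoulli (x : UnitAddCircle)) =
      circleBernoulli (x : UnitAddCircle) := by
    norm_num [Nat.factorial]
    field_simp
  rw [hval] at h2
  have hf : (fun m : ℕ => 1 / (Real.pi ^ 2 * (m : ℝ) ^ 2) * Real.cos (2 * Real.pi * m * x)) =
      fun m : ℕ => 1 / Real.pi ^ 2 * (1 / (m : ℝ) ^ (2 * 1) *
        Real.cos (2 * Real.pi * m * Int.fract x)) := by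
    funext m
    have : Real.cos (2 * Real.pi * m * Int.fract x) = Real.cos (2 * Real.pi * m * x) := by
      rw [← Int.self_sub_floor, show 2 * Real.pi * m * (x - ⌊x⌋) =
        2 * Real.pi * m * x - ((m * ⌊x⌋ : ℤ) : ℝ) * (2 * Real.pi) by push_cast; ring,
        Real.cos_sub_int_mul_two_pi]
    rw [this]
    field_simp
  rw [hf]
  exact h2

theorem hasSum_energy {N : ℕ} (s : Fin N → ℝ) :
    HasSum (fun m : ℕ => 1 / (2 * Real.pi ^ 2 * (m : ℝ) ^ 2) *
        (‖∑ i, Complex.exp (((2 * Real.pi * m * s i : ℝ) : ℂ) * Complex.I)‖ ^ 2 / (N : ℝ) ^ 2))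
      (1 / (2 * (N : ℝ) ^ 2) * ∑ i, ∑ j,
        circleBernoulli ((s i : UnitAddCircle) - (s j : UnitAddCircle))) := by
  have h : HasSum (fun m : ℕ => 1 / (2 * (N : ℝ) ^ 2) * ∑ i, ∑ j,
      1 / (Real.pi ^ 2 * (m : ℝ) ^ 2) * Real.cos (2 * Real.pi * m * (s i - s j)))
      (1 / (2 * (N : ℝ) ^ 2) * ∑ i, ∑ j,
        circleBernoulli ((s i : UnitAddCircle) - (s j : UnitAddCircle))) := by
    refine HasSum.mul_left _ (hasSum_sum fun i _ => hasSum_sum fun j _ => ?_)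
    rw [← AddCircle.coe_sub]
    exact hasSum_circleBernoulli _
  convert h using 1
  funext m
  rw [norm_sq_sum_eq]
  simp_rw [← Finset.mul_sum, mul_sub]
  by_cases hm : (m : ℝ) = 0
  · simp [hm]
  by_cases hN : (N : ℝ) = 0
  · simp [hN]
  field_simp

/-! ### The characteristic function along the frequencies. -/

section CharFun

variable (α : ℝ) (ν : Measure ℤ)

/-- The characteristic function at `2π m α`. -/
noncomputable def charAt (m : ℤ) : ℂ := ∫ x, latticeChar α m x ∂ν

/-- The variance of the random character. -/
noncomputable def charVar (m : ℤ) : ℝ := 1 - ‖charAt α ν m‖ ^ 2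

/-- The geometric sum `∑_{k < N} |φ(2π m α)|^k`. -/
noncomputable def geomSum (N : ℕ) (m : ℤ) : ℝ := ∑ k ∈ Finset.range N, ‖charAt α ν m‖ ^ k

/-- The centered random character. -/
noncomputable def centeredChar (m x : ℤ) : ℂ := latticeChar α m x - charAt α ν m

theorem latticeCharFun_eq (m : ℤ) :
    latticeCharFun ν (2 * Real.pi * ((m : ℝ) * α)) = charAt α ν m := by
  unfold latticeCharFun charAt
  rw [charFun_apply_real, integral_map (measurable_from_top).aemeasurable]
  · rfl
  · exact (by fun_prop : Continuous fun x : ℝ =>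
      Complex.exp (((2 * Real.pi * ((m : ℝ) * α) : ℝ) : ℂ) * x * Complex.I)).aestronglyMeasurable

theorem charRatio_eq (m : ℤ) :
    charRatio ν ((m : ℝ) * α) = charVar α ν m / ‖1 - charAt α ν m‖ ^ 2 := by
  unfold charRatio charVar
  rw [latticeCharFun_eq]

theorem conj_charAt (m : ℤ) : (starRingEnd ℂ) (charAt α ν m) = charAt α ν (-m) := by
  unfold charAt
  rw [← integral_conj]
  simp_rw [conj_latticeChar]

theorem norm_charAt_neg (m : ℤ) : ‖charAt α ν (-m)‖ = ‖charAt α ν m‖ := by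
  rw [← conj_charAt, Complex.norm_conj]

theorem geomSum_neg (N : ℕ) (m : ℤ) : geomSum α ν N (-m) = geomSum α ν N m := by
  unfold geomSum; rw [norm_charAt_neg]

theorem geomSum_nonneg (N : ℕ) (m : ℤ) : 0 ≤ geomSum α ν N m :=
  Finset.sum_nonneg fun _ _ => by positivity

theorem one_le_geomSum {N : ℕ} (hN : 1 ≤ N) (m : ℤ) : 1 ≤ geomSum α ν N m := by
  unfold geomSum
  have := Finset.single_le_sum (f := fun k => ‖charAt α ν m‖ ^ k)
    (fun _ _ => by positivity) (Finset.mem_range.mpr hN)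
  simpa using this

theorem sum_range_pow_le_geomSum {N j : ℕ} (hj : j ≤ N) (m : ℤ) :
    ∑ k ∈ Finset.range j, ‖charAt α ν m‖ ^ k ≤ geomSum α ν N m :=
  Finset.sum_le_sum_of_subset_of_nonneg (Finset.range_subset_range.mpr hj) fun _ _ _ => by positivity

theorem exists_measure_singleton_ne_zero {s : Set ℤ} (hs : ν s ≠ 0) : ∃ a ∈ s, ν {a} ≠ 0 := by
  by_contra! h
  apply hs
  rw [← Set.biUnion_of_singleton s, measure_biUnion_null_iff (Set.to_countable s)]
  exact h

variable [IsProbabilityMeasure ν]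

theorem integrable_of_bounded_int {f : ℤ → ℂ} {B : ℝ} (h : ∀ x, ‖f x‖ ≤ B) : Integrable f ν :=
  Integrable.of_bound measurable_from_top.aestronglyMeasurable B (by filter_upwards with x; exact h x)

theorem norm_charAt_le_one (m : ℤ) : ‖charAt α ν m‖ ≤ 1 := by
  have := norm_integral_le_of_norm_le_const (μ := ν) (f := latticeChar α m) (C := 1)
    (by filter_upwards with x; rw [norm_latticeChar])
  simpa [charAt] using this

theorem charVar_nonneg (m : ℤ) : 0 ≤ charVar α ν m := by
  unfold charVar
  nlinarith [norm_charAt_le_one α ν m, norm_nonneg (charAt α ν m)]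

theorem norm_centeredChar_le (m x : ℤ) : ‖centeredChar α ν m x‖ ≤ 2 := by
  refine (norm_sub_le _ _).trans ?_
  rw [norm_latticeChar]
  linarith [norm_charAt_le_one α ν m]

theorem integral_centeredChar (m : ℤ) : ∫ x, centeredChar α ν m x ∂ν = 0 := by
  unfold centeredChar
  rw [integral_sub (integrable_of_bounded_int ν (B := 1) fun x => (norm_latticeChar α m x).le)
    (integrable_const _)]
  simp [charAt]

theorem integral_norm_centeredChar_sq (m : ℤ) :
    ∫ x, ‖centeredChar α ν m x‖ ^ 2 ∂ν = charVar α ν m := by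
  set z := charAt α ν m with hz
  have hint := integrable_of_bounded_int ν (f := latticeChar α m) (B := 1)
    fun x => (norm_latticeChar α m x).le
  have h1 : ∀ x, ‖centeredChar α ν m x‖ ^ 2 =
      1 + ‖z‖ ^ 2 - 2 * ((starRingEnd ℂ) z * latticeChar α m x).re := by
    intro x
    unfold centeredChar
    rw [← Complex.normSq_eq_norm_sq, Complex.normSq_sub, Complex.normSq_eq_norm_sq,
      Complex.normSq_eq_norm_sq, norm_latticeChar, ← hz]
    rw [mul_comm (latticeChar α m x)]
    ring
  simp_rw [h1]
  have hre : Integrable (fun x => ((starRingEnd ℂ) z * latticeChar α m x).re) ν :=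
    (hint.const_mul _).re
  rw [integral_sub (integrable_const _) (hre.const_mul 2), integral_const_mul]
  have : ∫ x, ((starRingEnd ℂ) z * latticeChar α m x).re ∂ν = ‖z‖ ^ 2 := by
    have h2 := integral_re (hint.const_mul ((starRingEnd ℂ) z))
    simp only [RCLike.re_to_complex] at h2
    rw [h2, integral_const_mul]
    change ((starRingEnd ℂ) z * z).re = _
    rw [mul_comm, Complex.mul_conj, Complex.ofReal_re, Complex.normSq_eq_norm_sq]
  rw [this]
  simp [charVar, ← hz]
  ring

theorem geomSum_le (N : ℕ) (m : ℤ) : geomSum α ν N m ≤ N := by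
  unfold geomSum
  refine (Finset.sum_le_sum fun k _ => pow_le_one₀ (norm_nonneg _) (norm_charAt_le_one α ν m)).trans ?_
  simp

/-- The factor 1 - |φ| of 1 - |φ|² telescopes the geometric sum. Each factor `charVar` thus absorbs
one factor `geomSum`, without any lower bound on 1 - |φ|. -/
theorem charVar_mul_geomSum_le (N : ℕ) (m : ℤ) : charVar α ν m * geomSum α ν N m ≤ 2 := by
  have h := mul_neg_geom_sum ‖charAt α ν m‖ N
  have h1 := norm_charAt_le_one α ν m
  have h0 := norm_nonneg (charAt α ν m)
  unfold charVar geomSum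
  have hp : 0 ≤ ‖charAt α ν m‖ ^ N := by positivity
  calc (1 - ‖charAt α ν m‖ ^ 2) * ∑ k ∈ Finset.range N, ‖charAt α ν m‖ ^ k
      = (1 + ‖charAt α ν m‖) * (1 - ‖charAt α ν m‖ ^ N) := by rw [← h]; ring
    _ ≤ 2 * 1 := by
        have : ‖charAt α ν m‖ ^ N ≤ 1 := pow_le_one₀ h0 h1
        gcongr <;> linarith
    _ = 2 := by ring

theorem charVar_le_two_mul_norm (m : ℤ) : charVar α ν m ≤ 2 * ‖1 - charAt α ν m‖ := by
  have h1 := norm_charAt_le_one α ν m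
  have h0 := norm_nonneg (charAt α ν m)
  have h2 : 1 - ‖charAt α ν m‖ ≤ ‖1 - charAt α ν m‖ := by
    have := norm_sub_norm_le (1 : ℂ) (charAt α ν m)
    simpa using this
  unfold charVar
  nlinarith

/-- The chord |e(y) - 1| equals 2|sin πy|, and Jordan's inequality |sin πy| ≥ 2|y| applies once `y`
is reduced modulo 1 to |y| ≤ 1/2. -/
theorem four_mul_norm_le_norm_sub (α : ℝ) (m a b : ℤ) :
    4 * ‖(((m : ℝ) * (((a - b : ℤ) : ℝ) * α) : ℝ) : UnitAddCircle)‖ ≤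
      ‖latticeChar α m a - latticeChar α m b‖ := by
  set y : ℝ := (m : ℝ) * (((a - b : ℤ) : ℝ) * α) with hy
  have h1 : latticeChar α m a - latticeChar α m b =
      latticeChar α m b * (Complex.exp (Complex.I * ((2 * Real.pi * y : ℝ) : ℂ)) - 1) := by
    rw [mul_sub, mul_one]
    congr 1
    rw [show a = b + (a - b) by ring, latticeChar_add_right, latticeChar_eq α m (a - b), hy]
    congr 2
    push_cast; ring_nf
  rw [h1, norm_mul, norm_latticeChar, one_mul, Complex.norm_exp_I_mul_ofReal_sub_one,
    UnitAddCircle.norm_eq, norm_mul, show 2 * Real.pi * y / 2 = Real.pi * y by ring]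
  have h2 : |Real.sin (Real.pi * y)| = |Real.sin (Real.pi * (y - round y))| := by
    rw [mul_sub, mul_comm Real.pi (round y : ℝ), Real.sin_sub_int_mul_pi, abs_mul, abs_zpow,
      abs_neg, abs_one, one_zpow, one_mul]
  rw [Real.norm_eq_abs (Real.sin _), h2]
  have h3 := abs_sub_round y
  have h4 := Real.mul_abs_le_abs_sin (x := Real.pi * (y - round y)) (by
    rw [abs_mul, abs_of_pos Real.pi_pos]; nlinarith [Real.pi_pos])
  rw [abs_mul, abs_of_pos Real.pi_pos, ← mul_assoc, div_mul_cancel₀ _ Real.pi_pos.ne'] at h4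
  simp only [Real.norm_ofNat]
  linarith

/-- The characters at two atoms a ≠ b differ by at least 4‖m(a-b)α‖, so they cannot both be close to
their mean φ. This gives d = |a - b|, and (4n)² ≤ 2(A² + B²) is the source of the 8 in κ. The factor
d accommodates laws carried by a coset of a proper subgroup. -/
theorem exists_charVar_lower (hν : NondegenerateLaw ν) :
    ∃ d : ℕ, 1 ≤ d ∧ ∃ κ : ℝ, 0 < κ ∧ ∀ (α : ℝ) (m : ℤ),
      κ * ‖(((m : ℝ) * ((d : ℝ) * α) : ℝ) : UnitAddCircle)‖ ^ 2 ≤ charVar α ν m := by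
  obtain ⟨a, -, ha⟩ := exists_measure_singleton_ne_zero ν (s := Set.univ) (by simp)
  have hne : ν {k | k ≠ a} ≠ 0 := fun h => hν ⟨a, by rw [ae_iff]; exact h⟩
  obtain ⟨b, hb, hbν⟩ := exists_measure_singleton_ne_zero ν hne
  have hba : b ≠ a := hb
  have hpa : 0 < ν.real {a} := (ENNReal.toReal_pos ha (measure_ne_top _ _))
  have hpb : 0 < ν.real {b} := (ENNReal.toReal_pos hbν (measure_ne_top _ _))
  refine ⟨(a - b).natAbs, by omega, 8 * min (ν.real {a}) (ν.real {b}),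
    by have := lt_min hpa hpb; positivity, fun α m => ?_⟩
  set p := min (ν.real {a}) (ν.real {b}) with hp
  have hp0 : 0 < p := lt_min hpa hpb
  have hn : ‖(((m : ℝ) * (((a - b).natAbs : ℝ) * α) : ℝ) : UnitAddCircle)‖ =
      ‖(((m : ℝ) * (((a - b : ℤ) : ℝ) * α) : ℝ) : UnitAddCircle)‖ := by
    rw [Nat.cast_natAbs]
    rcases abs_choice (a - b) with h | h <;> rw [h]
    rw [← norm_neg, ← AddCircle.coe_neg]
    congr 2; push_cast; ring
  rw [hn]
  have h4 := four_mul_norm_le_norm_sub α m a b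
  set n := ‖(((m : ℝ) * (((a - b : ℤ) : ℝ) * α) : ℝ) : UnitAddCircle)‖
  have hn0 : 0 ≤ n := norm_nonneg _
  have hint : Integrable (fun x => ‖centeredChar α ν m x‖ ^ 2) ν :=
    Integrable.of_bound measurable_from_top.aestronglyMeasurable 4 (by
      filter_upwards with x
      rw [Real.norm_of_nonneg (by positivity)]
      nlinarith [norm_centeredChar_le α ν m x, norm_nonneg (centeredChar α ν m x)])
  have h5 : ∑ x ∈ ({a, b} : Finset ℤ), ν.real {x} * ‖centeredChar α ν m x‖ ^ 2 ≤ charVar α ν m := by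
    rw [← integral_norm_centeredChar_sq]
    have h6 := setIntegral_finset ({a, b} : Finset ℤ) (f := fun x => ‖centeredChar α ν m x‖ ^ 2)
      (μ := ν) hint.integrableOn
    simp only [smul_eq_mul] at h6
    rw [← h6]
    exact setIntegral_le_integral hint (by filter_upwards with x; exact sq_nonneg _)
  rw [Finset.sum_pair hba.symm] at h5
  have h7 : 4 * n ≤ ‖centeredChar α ν m a‖ + ‖centeredChar α ν m b‖ := by
    refine h4.trans ?_
    have : latticeChar α m a - latticeChar α m b =
      centeredChar α ν m a - centeredChar α ν m b := by unfold centeredChar; ring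
    rw [this]
    exact norm_sub_le _ _
  have h8 : p * ‖centeredChar α ν m a‖ ^ 2 ≤ ν.real {a} * ‖centeredChar α ν m a‖ ^ 2 := by
    gcongr; exact min_le_left _ _
  have h9 : p * ‖centeredChar α ν m b‖ ^ 2 ≤ ν.real {b} * ‖centeredChar α ν m b‖ ^ 2 := by
    gcongr; exact min_le_right _ _
  have h10 : 8 * n ^ 2 ≤ ‖centeredChar α ν m a‖ ^ 2 + ‖centeredChar α ν m b‖ ^ 2 := by
    nlinarith [sq_nonneg (‖centeredChar α ν m a‖ - ‖centeredChar α ν m b‖),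
      norm_nonneg (centeredChar α ν m a), norm_nonneg (centeredChar α ν m b)]
  nlinarith

end CharFun

/-! ### Functions of the past and one new independent step. -/

/-- A bounded function of the first `n` steps. -/
def IsPastFun {Ω : Type*} (X : ℕ → Ω → ℤ) (n : ℕ) (f : Ω → ℂ) : Prop :=
  ∃ F : (Finset.range n → ℤ) → ℂ, (∃ B, ∀ y, ‖F y‖ ≤ B) ∧ f = fun ω => F (fun i => X i ω)

section Past

variable {Ω : Type*} {X : ℕ → Ω → ℤ} {n : ℕ} {f g : Ω → ℂ}

theorem IsPastFun.const (c : ℂ) : IsPastFun X n (fun _ => c) :=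
  ⟨fun _ => c, ⟨‖c‖, fun _ => le_rfl⟩, rfl⟩

theorem IsPastFun.add (hf : IsPastFun X n f) (hg : IsPastFun X n g) :
    IsPastFun X n (fun ω => f ω + g ω) := by
  obtain ⟨F, ⟨B, hB⟩, rfl⟩ := hf
  obtain ⟨G, ⟨B', hB'⟩, rfl⟩ := hg
  exact ⟨fun y => F y + G y, ⟨B + B', fun y => (norm_add_le _ _).trans (add_le_add (hB y) (hB' y))⟩,
    rfl⟩

theorem IsPastFun.mul (hf : IsPastFun X n f) (hg : IsPastFun X n g) :
    IsPastFun X n (fun ω => f ω * g ω) := by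
  obtain ⟨F, ⟨B, hB⟩, rfl⟩ := hf
  obtain ⟨G, ⟨B', hB'⟩, rfl⟩ := hg
  refine ⟨fun y => F y * G y, ⟨B * B', fun y => ?_⟩, rfl⟩
  rw [norm_mul]
  exact mul_le_mul (hB y) (hB' y) (norm_nonneg _) ((norm_nonneg _).trans (hB y))

theorem IsPastFun.conj (hf : IsPastFun X n f) :
    IsPastFun X n (fun ω => (starRingEnd ℂ) (f ω)) := by
  obtain ⟨F, ⟨B, hB⟩, rfl⟩ := hf
  exact ⟨fun y => (starRingEnd ℂ) (F y), ⟨B, fun y => by rw [Complex.norm_conj]; exact hB y⟩, rfl⟩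

theorem IsPastFun.succ (hf : IsPastFun X n f) : IsPastFun X (n + 1) f := by
  obtain ⟨F, ⟨B, hB⟩, rfl⟩ := hf
  exact ⟨fun y => F fun i => y ⟨i, Finset.range_subset_range.mpr n.le_succ i.2⟩,
    ⟨B, fun y => hB _⟩, rfl⟩

theorem IsPastFun.step {q : ℤ → ℂ} {B : ℝ} (hq : ∀ x, ‖q x‖ ≤ B) :
    IsPastFun X (n + 1) (fun ω => q (X n ω)) :=
  ⟨fun y => q (y ⟨n, Finset.self_mem_range_succ n⟩), ⟨B, fun _ => hq _⟩, rfl⟩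

variable [MeasurableSpace Ω] {P : Measure Ω} {ν : Measure ℤ}

theorem IsPastFun.measurable (hX : ∀ k, Measurable (X k)) (hf : IsPastFun X n f) :
    Measurable f := by
  obtain ⟨F, -, rfl⟩ := hf
  exact (Measurable.of_discrete (f := F)).comp (measurable_pi_lambda _ fun i => hX i)

theorem IsPastFun.integrable [IsFiniteMeasure P] (hX : ∀ k, Measurable (X k)) (hf : IsPastFun X n f) :
    Integrable f P := by
  have hm := hf.measurable hX
  obtain ⟨F, ⟨B, hB⟩, rfl⟩ := hf
  exact Integrable.of_bound hm.aestronglyMeasurable B (by filter_upwards with ω; exact hB _)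

/-- The past is coded as a function on finite tuples of integers, a discrete space, so measurability
is automatic and independence of disjoint blocks of steps applies. -/
theorem IsPastFun.integral_mul_step (hX : ∀ k, Measurable (X k)) (hlaw : ∀ k, P.map (X k) = ν)
    (hind : iIndepFun X P) (hf : IsPastFun X n f) (q : ℤ → ℂ) :
    ∫ ω, f ω * q (X n ω) ∂P = (∫ ω, f ω ∂P) * ∫ x, q x ∂ν := by
  have hm := hf.measurable hX
  obtain ⟨F, -, rfl⟩ := hf
  have h1 := hind.indepFun_finset (Finset.range n) {n} (by simp) hX
  have h2 : IndepFun (fun ω => F (fun i => X i ω)) (fun ω => q (X n ω)) P :=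
    h1.comp (φ := F) (ψ := fun y : ({n} : Finset ℕ) → ℤ => q (y ⟨n, Finset.mem_singleton_self n⟩))
      Measurable.of_discrete Measurable.of_discrete
  have hq : Measurable (fun ω => q (X n ω)) := measurable_from_top.comp (hX n)
  rw [h2.integral_fun_mul_eq_mul_integral hm.aestronglyMeasurable hq.aestronglyMeasurable,
    ← hlaw n, integral_map (hX n).aemeasurable measurable_from_top.aestronglyMeasurable]

variable [IsProbabilityMeasure P]

theorem integral_sum_step {ι : Type*} [Fintype ι] (hX : ∀ k, Measurable (X k))
    (hlaw : ∀ k, P.map (X k) = ν) (hind : iIndepFun X P) {A : ι → Ω → ℂ}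
    (hA : ∀ i, IsPastFun X n (A i)) {q : ι → ℤ → ℂ} {B : ℝ} (hq : ∀ i x, ‖q i x‖ ≤ B) :
    ∫ ω, ∑ i, A i ω * q i (X n ω) ∂P = ∑ i, (∫ ω, A i ω ∂P) * ∫ x, q i x ∂ν := by
  rw [integral_finsetSum]
  · exact Finset.sum_congr rfl fun i _ => (hA i).integral_mul_step hX hlaw hind (q i)
  · exact fun i _ => ((hA i).succ.mul (IsPastFun.step (hq i))).integrable hX

theorem integral_sum_mul_sum_step {ι : Type*} [Fintype ι] (hX : ∀ k, Measurable (X k))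
    (hlaw : ∀ k, P.map (X k) = ν) (hind : iIndepFun X P) {A A' : ι → Ω → ℂ}
    (hA : ∀ i, IsPastFun X n (A i)) (hA' : ∀ i, IsPastFun X n (A' i)) {q q' : ι → ℤ → ℂ} {B : ℝ}
    (hq : ∀ i x, ‖q i x‖ ≤ B) (hq' : ∀ i x, ‖q' i x‖ ≤ B) :
    ∫ ω, (∑ i, A i ω * q i (X n ω)) * (∑ i, A' i ω * q' i (X n ω)) ∂P =
      ∑ i, ∑ j, (∫ ω, A i ω * A' j ω ∂P) * ∫ x, q i x * q' j x ∂ν := by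
  have h := integral_sum_step (ι := ι × ι) hX hlaw hind (A := fun p ω => A p.1 ω * A' p.2 ω)
    (fun p => (hA p.1).mul (hA' p.2)) (q := fun p x => q p.1 x * q' p.2 x) (B := B * B)
    (fun p x => by
      rw [norm_mul]
      exact mul_le_mul (hq _ _) (hq' _ _) (norm_nonneg _) ((norm_nonneg _).trans (hq p.1 x)))
  rw [Fintype.sum_prod_type] at h
  rw [← h]
  refine integral_congr_ae (Filter.Eventually.of_forall fun ω => ?_)
  simp only
  rw [Fintype.sum_prod_type, Finset.sum_mul_sum]
  exact Finset.sum_congr rfl fun i _ => Finset.sum_congr rfl fun j _ => by ring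

/-- One step of the covariance recursion. -/
theorem covariance_step {ι : Type*} [Fintype ι] (hX : ∀ k, Measurable (X k))
    (hlaw : ∀ k, P.map (X k) = ν) (hind : iIndepFun X P) [IsProbabilityMeasure ν]
    (hf : IsPastFun X n f) (hg : IsPastFun X n g) {A A' : ι → Ω → ℂ}
    (hA : ∀ i, IsPastFun X n (A i)) (hA' : ∀ i, IsPastFun X n (A' i)) {q q' : ι → ℤ → ℂ} {B : ℝ}
    (hq : ∀ i x, ‖q i x‖ ≤ B) (hq' : ∀ i x, ‖q' i x‖ ≤ B)
    (hq0 : ∀ i, ∫ x, q i x ∂ν = 0) (hq0' : ∀ i, ∫ x, q' i x ∂ν = 0) :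
    ∫ ω, (f ω + ∑ i, A i ω * q i (X n ω)) * (g ω + ∑ i, A' i ω * q' i (X n ω)) ∂P -
      (∫ ω, (f ω + ∑ i, A i ω * q i (X n ω)) ∂P) * (∫ ω, (g ω + ∑ i, A' i ω * q' i (X n ω)) ∂P) =
    (∫ ω, f ω * g ω ∂P - (∫ ω, f ω ∂P) * ∫ ω, g ω ∂P) +
      ∑ i, ∑ j, (∫ ω, A i ω * A' j ω ∂P) * ∫ x, q i x * q' j x ∂ν := by
  -- The extra index `none` carries the past part with the constant step function 1. Since the `q`
  -- have mean zero, only the none-none and some-some products survive.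
  set E : Option ι → Ω → ℂ := fun o => o.elim f A with hE
  set E' : Option ι → Ω → ℂ := fun o => o.elim g A' with hE'
  set r : Option ι → ℤ → ℂ := fun o => o.elim (fun _ => 1) q with hr
  set r' : Option ι → ℤ → ℂ := fun o => o.elim (fun _ => 1) q' with hr'
  have hEp : ∀ o, IsPastFun X n (E o) := fun o => by cases o <;> simp [hE, hf, hA]
  have hEp' : ∀ o, IsPastFun X n (E' o) := fun o => by cases o <;> simp [hE', hg, hA']
  have hrb : ∀ o x, ‖r o x‖ ≤ max 1 B := fun o x => by
    cases o
    · simp [hr]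
    · exact (hq _ _).trans (le_max_right _ _)
  have hrb' : ∀ o x, ‖r' o x‖ ≤ max 1 B := fun o x => by
    cases o
    · simp [hr']
    · exact (hq' _ _).trans (le_max_right _ _)
  have h1 := integral_sum_mul_sum_step hX hlaw hind hEp hEp' hrb hrb'
  have h2 := integral_sum_step hX hlaw hind hEp hrb
  have h3 := integral_sum_step hX hlaw hind hEp' hrb'
  simp only [Fintype.sum_option, hE, hE', hr, hr', Option.elim_none, Option.elim_some, mul_one,
    one_mul, hq0, hq0', mul_zero, Finset.sum_const_zero, add_zero, integral_const, probReal_univ,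
    one_smul] at h1 h2 h3
  rw [h1, h2, h3]
  ring_nf

end Past

theorem norm_integral_mul_le_of_sq {ν : Measure ℤ} [IsProbabilityMeasure ν] {f g : ℤ → ℂ} {B s t : ℝ}
    (hf : ∀ x, ‖f x‖ ≤ B) (hg : ∀ x, ‖g x‖ ≤ B) (hs : 0 ≤ s) (ht : 0 ≤ t)
    (hfs : ∫ x, ‖f x‖ ^ 2 ∂ν ≤ s ^ 2) (hgt : ∫ x, ‖g x‖ ^ 2 ∂ν ≤ t ^ 2) :
    ‖∫ x, f x * g x ∂ν‖ ≤ s * t := by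
  have hm : ∀ {f : ℤ → ℂ}, (∀ x, ‖f x‖ ≤ B) → MemLp (fun x => ‖f x‖) (ENNReal.ofReal 2) ν :=
    fun {f} hf => MemLp.of_bound measurable_from_top.aestronglyMeasurable B
      (by filter_upwards with x; simpa using hf x)
  have h := integral_mul_le_Lp_mul_Lq_of_nonneg (μ := ν) (p := 2) (q := 2)
    (f := fun x => ‖f x‖) (g := fun x => ‖g x‖) Real.HolderConjugate.two_two
    (by filter_upwards with x; positivity) (by filter_upwards with x; positivity) (hm hf) (hm hg)
  simp only [Real.rpow_ofNat] at h
  rw [← Real.sqrt_eq_rpow, ← Real.sqrt_eq_rpow] at h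
  calc ‖∫ x, f x * g x ∂ν‖ ≤ ∫ x, ‖f x * g x‖ ∂ν := norm_integral_le_integral_norm _
    _ = ∫ x, ‖f x‖ * ‖g x‖ ∂ν := by simp_rw [norm_mul]
    _ ≤ _ := h
    _ ≤ s * t := by
        gcongr
        · exact Real.sqrt_le_iff.mpr ⟨hs, hfs⟩
        · exact Real.sqrt_le_iff.mpr ⟨ht, hgt⟩

/-! ### The exponential sum of the walk and its low moments. -/

/-- The exponential sum of the walk, seen from its last point. -/
noncomputable def walkSum (α : ℝ) (m : ℤ) (x : ℕ → ℤ) : ℕ → ℂ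
  | 0 => 0
  | n + 1 => 1 + latticeChar α m (x n) * walkSum α m x n

theorem norm_walkSum_le (α : ℝ) (m : ℤ) (x : ℕ → ℤ) (n : ℕ) : ‖walkSum α m x n‖ ≤ n := by
  induction n with
  | zero => simp [walkSum]
  | succ n ih =>
    rw [walkSum]
    refine (norm_add_le _ _).trans ?_
    rw [norm_mul, norm_latticeChar]
    push_cast
    simp only [norm_one, one_mul]
    linarith

theorem conj_walkSum (α : ℝ) (m : ℤ) (x : ℕ → ℤ) (n : ℕ) :
    (starRingEnd ℂ) (walkSum α m x n) = walkSum α (-m) x n := by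
  induction n with
  | zero => simp [walkSum]
  | succ n ih => rw [walkSum, walkSum, map_add, map_mul, map_one, ih, conj_latticeChar]

/-- Rotation by the last character leaves the modulus unchanged and makes the forcing term of the
recursion constant, so moments satisfy linear recursions. -/
theorem walkSum_eq (α : ℝ) (m : ℤ) (x : ℕ → ℤ) (n : ℕ) :
    walkSum α m x n = latticeChar α m (∑ k ∈ Finset.range n, x k) *
      ∑ k ∈ Finset.Icc 1 n, latticeChar α (-m) (∑ i ∈ Finset.range k, x i) := by
  induction n with
  | zero => simp [walkSum]
  | succ n ih =>
    rw [walkSum, ih, Finset.sum_Icc_succ_top (by omega), mul_add, latticeChar_mul_neg,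
      Finset.sum_range_succ, latticeChar_add_right]
    ring

theorem norm_walkSum (α : ℝ) (m : ℤ) (x : ℕ → ℤ) (n : ℕ) :
    ‖walkSum α m x n‖ = ‖∑ k ∈ Finset.Icc 1 n, latticeChar α m (∑ i ∈ Finset.range k, x i)‖ := by
  rw [walkSum_eq, norm_mul, norm_latticeChar, one_mul, ← Complex.norm_conj, map_sum]
  simp_rw [conj_latticeChar, neg_neg]

section Recursion

variable {Ω : Type*} {X : ℕ → Ω → ℤ}

theorem isPastFun_walkSum (α : ℝ) (m : ℤ) (n : ℕ) :
    IsPastFun X n (fun ω => walkSum α m (fun k => X k ω) n) := by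
  induction n with
  | zero => exact IsPastFun.const 0
  | succ n ih =>
    exact (IsPastFun.const 1).add ((IsPastFun.step fun x => (norm_latticeChar α m x).le).mul ih.succ)

variable [MeasurableSpace Ω] {P : Measure Ω} [IsProbabilityMeasure P]
  {ν : Measure ℤ} {α : ℝ} {N : ℕ}

theorem geom_recursion_bound {a : ℕ → ℂ} {z : ℂ} {c : ℝ} (h0 : a 0 = 0) {M : ℕ}
    (h : ∀ n < M, ‖a (n + 1) - z * a n‖ ≤ c) :
    ∀ n ≤ M, ‖a n‖ ≤ c * ∑ k ∈ Finset.range n, ‖z‖ ^ k := by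
  intro n
  induction n with
  | zero => simp [h0]
  | succ n ih =>
    intro hn
    have h1 := ih (by omega)
    have h2 := h n (by omega)
    have h3 : ‖a (n + 1)‖ ≤ ‖a (n + 1) - z * a n‖ + ‖z‖ * ‖a n‖ := by
      rw [← norm_mul]
      simpa using norm_add_le (a (n + 1) - z * a n) (z * a n)
    rw [Finset.sum_range_succ', mul_add, pow_zero, mul_one]
    have h4 : ∑ k ∈ Finset.range n, ‖z‖ ^ (k + 1) = ‖z‖ * ∑ k ∈ Finset.range n, ‖z‖ ^ k := by
      rw [Finset.mul_sum]; exact Finset.sum_congr rfl fun k _ => pow_succ' _ _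
    rw [h4]
    nlinarith [mul_le_mul_of_nonneg_left h1 (norm_nonneg z)]

theorem norm_integral_walkSum_le (hX : ∀ k, Measurable (X k)) (hlaw : ∀ k, P.map (X k) = ν)
    (hind : iIndepFun X P) (m : ℤ) {n : ℕ} (hn : n ≤ N) :
    ‖∫ ω, walkSum α m (fun k => X k ω) n ∂P‖ ≤ geomSum α ν N m := by
  have h := geom_recursion_bound (a := fun n => ∫ ω, walkSum α m (fun k => X k ω) n ∂P)
    (z := charAt α ν m) (c := 1) (M := N) (by simp [walkSum]) (fun n _ => by
      have hp := isPastFun_walkSum (X := X) α m n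
      have hs := IsPastFun.step (X := X) (n := n) fun x => (norm_latticeChar α m x).le
      have : ∫ ω, walkSum α m (fun k => X k ω) (n + 1) ∂P =
          1 + charAt α ν m * ∫ ω, walkSum α m (fun k => X k ω) n ∂P := by
        have h1 := hp.integral_mul_step hX hlaw hind (latticeChar α m)
        simp only [walkSum]
        rw [integral_add (integrable_const _) ((hs.mul hp.succ).integrable hX)]
        simp_rw [mul_comm (latticeChar α m _)]
        rw [h1]
        simp [charAt, mul_comm]
      rw [this]
      simp) n hn
  rw [one_mul] at h
  exact h.trans (sum_range_pow_le_geomSum α ν hn m)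

variable [IsProbabilityMeasure ν]

/-- The product moment a satisfies a ↦ φ(m+l)a plus a forcing term 1 + φ(m)E U_m + φ(l)E U_l,
already bounded by the first moments. This is how the geometric sum at m + l arises, and at m - l
after conjugating one factor. -/
theorem norm_integral_walkSum_mul_le (hX : ∀ k, Measurable (X k)) (hlaw : ∀ k, P.map (X k) = ν)
    (hind : iIndepFun X P) (m l : ℤ) {n : ℕ} (hn : n ≤ N) :
    ‖∫ ω, walkSum α m (fun k => X k ω) n * walkSum α l (fun k => X k ω) n ∂P‖ ≤
      (1 + geomSum α ν N m + geomSum α ν N l) * geomSum α ν N (m + l) := by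
  have h := geom_recursion_bound
    (a := fun n => ∫ ω, walkSum α m (fun k => X k ω) n * walkSum α l (fun k => X k ω) n ∂P)
    (z := charAt α ν (m + l)) (c := 1 + geomSum α ν N m + geomSum α ν N l) (M := N)
    (by simp [walkSum]) (fun n hn => by
      have hp := isPastFun_walkSum (X := X) α m n
      have hp' := isPastFun_walkSum (X := X) α l n
      have hs := fun m => IsPastFun.step (X := X) (n := n) fun x => (norm_latticeChar α m x).le
      have : ∫ ω, walkSum α m (fun k => X k ω) (n + 1) * walkSum α l (fun k => X k ω) (n + 1) ∂P =
          1 + (∫ ω, walkSum α m (fun k => X k ω) n ∂P) * charAt α ν m +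
            (∫ ω, walkSum α l (fun k => X k ω) n ∂P) * charAt α ν l +
            (∫ ω, walkSum α m (fun k => X k ω) n * walkSum α l (fun k => X k ω) n ∂P) *
              charAt α ν (m + l) := by
        have h1 := hp.integral_mul_step hX hlaw hind (latticeChar α m)
        have h2 := hp'.integral_mul_step hX hlaw hind (latticeChar α l)
        have h3 := (hp.mul hp').integral_mul_step hX hlaw hind (latticeChar α (m + l))
        unfold charAt
        rw [← h1, ← h2, ← h3]
        have e : ∀ ω, walkSum α m (fun k => X k ω) (n + 1) * walkSum α l (fun k => X k ω) (n + 1) =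
            1 + walkSum α m (fun k => X k ω) n * latticeChar α m (X n ω) +
            walkSum α l (fun k => X k ω) n * latticeChar α l (X n ω) +
            walkSum α m (fun k => X k ω) n * walkSum α l (fun k => X k ω) n *
              latticeChar α (m + l) (X n ω) := fun ω => by
          rw [walkSum, walkSum, latticeChar_add_left]; ring
        simp_rw [e]
        have i1 := (hp.succ.mul (hs m)).integrable (P := P) hX
        have i2 := (hp'.succ.mul (hs l)).integrable (P := P) hX
        have i3 := ((hp.mul hp').succ.mul (hs (m + l))).integrable (P := P) hX
        have j1 : Integrable (fun ω => 1 + walkSum α m (fun k => X k ω) n *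
            latticeChar α m (X n ω)) P := (integrable_const _).add i1
        have j2 : Integrable (fun ω => 1 + walkSum α m (fun k => X k ω) n *
            latticeChar α m (X n ω) + walkSum α l (fun k => X k ω) n *
            latticeChar α l (X n ω)) P := j1.add i2
        rw [integral_add j2 i3, integral_add j1 i2, integral_add (integrable_const _) i1]
        simp
      rw [this, mul_comm (charAt α ν (m + l)), add_sub_cancel_right]
      refine (norm_add₃_le).trans ?_
      rw [norm_mul, norm_mul, norm_one]
      have b1 := norm_integral_walkSum_le (α := α) hX hlaw hind m hn.le
      have b2 := norm_integral_walkSum_le (α := α) hX hlaw hind l hn.le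
      have c1 := norm_charAt_le_one α ν m
      have c2 := norm_charAt_le_one α ν l
      have := mul_le_mul b1 c1 (norm_nonneg _) (geomSum_nonneg α ν N m)
      have := mul_le_mul b2 c2 (norm_nonneg _) (geomSum_nonneg α ν N l)
      linarith) n hn
  refine h.trans (mul_le_mul_of_nonneg_left (sum_range_pow_le_geomSum α ν hn _) ?_)
  have := geomSum_nonneg α ν N m
  have := geomSum_nonneg α ν N l
  linarith

end Recursion

/-! ### The compensated sum and its one-step expansion. -/

section Compensated

variable (α : ℝ) (ν : Measure ℤ) (m : ℤ)

/-- The conditional expectation of the last `j` summands, seen from the present point. -/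
noncomputable def geomTail (j : ℕ) : ℂ := ∑ i ∈ Finset.range j, charAt α ν (-m) ^ (i + 1)

/-- The martingale weight with which the step preceding the last `j` steps enters. -/
noncomputable def geomWeight (j : ℕ) : ℂ := 1 + geomTail α ν m j

/-- The walk sum together with the conditional expectation of the remaining summands. -/
noncomputable def compSum (N : ℕ) (x : ℕ → ℤ) (n : ℕ) : ℂ :=
  walkSum α m x n + geomTail α ν m (N - n)

/-- The coefficients of the increment of the squared modulus of `compSum`. -/
noncomputable def incCoef (N : ℕ) (x : ℕ → ℤ) (n : ℕ) : Fin 3 → ℂ :=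
  ![geomWeight α ν m (N - (n + 1)) * (starRingEnd ℂ) (geomWeight α ν m (N - (n + 1))),
    compSum α ν m N x n * (starRingEnd ℂ) (geomWeight α ν m (N - (n + 1))),
    (starRingEnd ℂ) (compSum α ν m N x n) * geomWeight α ν m (N - (n + 1))]

/-- The centered functions of the new step in the increment of the squared modulus of
`compSum`. -/
noncomputable def incChar (y : ℤ) : Fin 3 → ℂ :=
  ![centeredChar α ν m y * (starRingEnd ℂ) (centeredChar α ν m y) - charVar α ν m,
    centeredChar α ν m y, (starRingEnd ℂ) (centeredChar α ν m y)]

theorem geomTail_succ (j : ℕ) :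
    geomTail α ν m (j + 1) = charAt α ν (-m) * geomWeight α ν m j := by
  unfold geomWeight geomTail
  rw [Finset.sum_range_succ', mul_add, Finset.mul_sum]
  simp only [zero_add, pow_one, mul_one]
  rw [add_comm]
  congr 1
  exact Finset.sum_congr rfl fun i _ => by ring

theorem geomWeight_eq (j : ℕ) :
    geomWeight α ν m j = ∑ i ∈ Finset.range (j + 1), charAt α ν (-m) ^ i := by
  unfold geomWeight geomTail
  rw [Finset.sum_range_succ']
  simp [add_comm]

theorem conj_geomTail (j : ℕ) : (starRingEnd ℂ) (geomTail α ν m j) = geomTail α ν (-m) j := by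
  unfold geomTail
  rw [map_sum]
  simp_rw [map_pow, conj_charAt]

theorem conj_compSum (N : ℕ) (x : ℕ → ℤ) (n : ℕ) :
    (starRingEnd ℂ) (compSum α ν m N x n) = compSum α ν (-m) N x n := by
  unfold compSum
  rw [map_add, conj_walkSum, conj_geomTail]

/-- Let g be the weight of this step and Y the centred character. The tail at N - n is φ(-m)g, so
V_{n+1} rotated back by χ(-m) is V_n + g·conj(Y). Expanding the squared modulus and moving the mean
σ²|g|² of |g|²|Y|² to the drift leaves three centred terms. -/
theorem compSum_step {N n : ℕ} (hn : n < N) (x : ℕ → ℤ) :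
    compSum α ν m N x (n + 1) * (starRingEnd ℂ) (compSum α ν m N x (n + 1)) =
      (compSum α ν m N x n * (starRingEnd ℂ) (compSum α ν m N x n) +
        charVar α ν m * (geomWeight α ν m (N - (n + 1)) *
          (starRingEnd ℂ) (geomWeight α ν m (N - (n + 1))))) +
      ∑ i, incCoef α ν m N x n i * incChar α ν m (x n) i := by
  have hT : geomTail α ν m (N - n) = charAt α ν (-m) * geomWeight α ν m (N - (n + 1)) := by
    rw [← geomTail_succ]; congr 1; omega
  have hU : walkSum α m x n = compSum α ν m N x n -
      charAt α ν (-m) * geomWeight α ν m (N - (n + 1)) := by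
    unfold compSum; rw [hT]; ring
  have hU' : compSum α ν m N x (n + 1) = latticeChar α m (x n) * (compSum α ν m N x n -
      charAt α ν (-m) * geomWeight α ν m (N - (n + 1))) + geomWeight α ν m (N - (n + 1)) := by
    rw [← hU]; unfold compSum geomWeight; rw [walkSum]; ring
  have hz : (starRingEnd ℂ) (charAt α ν (-m)) = charAt α ν m := by rw [conj_charAt, neg_neg]
  have hχ := latticeChar_mul_neg α m (x n)
  simp only [Fin.sum_univ_three, incCoef, incChar, Matrix.cons_val_zero, Matrix.cons_val_one,
    Matrix.cons_val, centeredChar, hU']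
  simp only [map_add, map_sub, map_mul, hz, conj_charAt, conj_latticeChar]
  set g := geomWeight α ν m (N - (n + 1))
  set U := compSum α ν m N x n
  -- The only relation used is that χ times its conjugate is 1; it occurs with |V - φ(-m)g|² on the
  -- left and with |g|² from |gY|² on the right.
  linear_combination ((U - charAt α ν (-m) * g) *
    ((starRingEnd ℂ) U - charAt α ν m * (starRingEnd ℂ) g) - g * (starRingEnd ℂ) g) * hχ

theorem compSum_last (N : ℕ) (x : ℕ → ℤ) : compSum α ν m N x N = walkSum α m x N := by
  simp [compSum, geomTail]

theorem compSum_zero (N : ℕ) (x : ℕ → ℤ) : compSum α ν m N x 0 = geomTail α ν m N := by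
  simp [compSum, walkSum]

theorem norm_geomWeight_le {N j : ℕ} (hj : j < N) : ‖geomWeight α ν m j‖ ≤ geomSum α ν N m := by
  rw [geomWeight_eq]
  refine (norm_sum_le _ _).trans ?_
  simp_rw [norm_pow, norm_charAt_neg]
  exact sum_range_pow_le_geomSum α ν hj m

theorem charVar_le_one : charVar α ν m ≤ 1 := by
  unfold charVar; nlinarith [sq_nonneg ‖charAt α ν m‖]

theorem norm_sq_incChar_zero (y : ℤ) :
    ‖incChar α ν m y 0‖ = |‖centeredChar α ν m y‖ ^ 2 - charVar α ν m| := by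
  simp only [incChar, Matrix.cons_val_zero, Complex.mul_conj, Complex.normSq_eq_norm_sq]
  rw [← Complex.ofReal_sub, Complex.norm_real, Real.norm_eq_abs]

variable [IsProbabilityMeasure ν]

theorem norm_geomTail_le {N j : ℕ} (hj : j ≤ N) : ‖geomTail α ν m j‖ ≤ geomSum α ν N m := by
  unfold geomTail
  refine (norm_sum_le _ _).trans (le_trans (Finset.sum_le_sum fun i _ => ?_)
    (sum_range_pow_le_geomSum α ν hj m))
  rw [norm_pow, norm_charAt_neg]
  exact pow_le_pow_of_le_one (norm_nonneg _) (norm_charAt_le_one α ν m) (Nat.le_succ i)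

theorem norm_incChar_le (i : Fin 3) (y : ℤ) : ‖incChar α ν m y i‖ ≤ 5 := by
  have h := norm_centeredChar_le α ν m y
  have h0 := norm_nonneg (centeredChar α ν m y)
  fin_cases i
  · change ‖incChar α ν m y 0‖ ≤ 5
    rw [norm_sq_incChar_zero, abs_le]
    have := charVar_nonneg α ν m
    have := charVar_le_one α ν m
    constructor <;> nlinarith
  · change ‖centeredChar α ν m y‖ ≤ 5; linarith
  · change ‖(starRingEnd ℂ) (centeredChar α ν m y)‖ ≤ 5
    rw [Complex.norm_conj]; linarith

theorem integrable_norm_centeredChar_pow (k : ℕ) :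
    Integrable (fun y => ‖centeredChar α ν m y‖ ^ k) ν :=
  Integrable.of_bound measurable_from_top.aestronglyMeasurable (2 ^ k) (by
    filter_upwards with x
    rw [Real.norm_of_nonneg (by positivity)]
    exact pow_le_pow_left₀ (norm_nonneg _) (norm_centeredChar_le α ν m x) k)

/-- Since |Y| ≤ 2, also |Y|⁴ ≤ 4|Y|², so all three centred functions have second moment O(σ²). By
Cauchy-Schwarz each step then contributes a factor σ from either frequency. -/
theorem integral_norm_incChar_sq_le (i : Fin 3) :
    ∫ y, ‖incChar α ν m y i‖ ^ 2 ∂ν ≤ (2 * √(charVar α ν m)) ^ 2 := by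
  have hs := charVar_nonneg α ν m
  rw [mul_pow, Real.sq_sqrt hs]
  have h1 := integral_norm_centeredChar_sq α ν m
  fin_cases i
  · change ∫ y, ‖incChar α ν m y 0‖ ^ 2 ∂ν ≤ _
    simp_rw [norm_sq_incChar_zero, sq_abs]
    calc ∫ y, (‖centeredChar α ν m y‖ ^ 2 - charVar α ν m) ^ 2 ∂ν
        ≤ ∫ y, ((4 - 2 * charVar α ν m) * ‖centeredChar α ν m y‖ ^ 2 + charVar α ν m ^ 2) ∂ν := by
          apply integral_mono
          · refine Integrable.of_bound measurable_from_top.aestronglyMeasurable 25 ?_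
            filter_upwards with x
            rw [← sq_abs, ← norm_sq_incChar_zero, Real.norm_of_nonneg (by positivity)]
            nlinarith [norm_incChar_le α ν m 0 x, norm_nonneg (incChar α ν m x 0)]
          · exact ((integrable_norm_centeredChar_pow α ν m 2).const_mul _).add (integrable_const _)
          · intro y
            simp only
            have h := norm_centeredChar_le α ν m y
            have h0 := norm_nonneg (centeredChar α ν m y)
            have : ‖centeredChar α ν m y‖ ^ 2 ≤ 4 := by nlinarith
            nlinarith [sq_nonneg ‖centeredChar α ν m y‖]
      _ = (4 - 2 * charVar α ν m) * charVar α ν m + charVar α ν m ^ 2 := by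
          rw [integral_add ((integrable_norm_centeredChar_pow α ν m 2).const_mul _)
            (integrable_const _), integral_const_mul, h1]
          simp
      _ ≤ 2 ^ 2 * charVar α ν m := by nlinarith [sq_nonneg (charVar α ν m)]
  · change ∫ y, ‖centeredChar α ν m y‖ ^ 2 ∂ν ≤ _
    rw [h1]; linarith
  · change ∫ y, ‖(starRingEnd ℂ) (centeredChar α ν m y)‖ ^ 2 ∂ν ≤ _
    simp_rw [Complex.norm_conj]
    rw [h1]; linarith

theorem norm_integral_incChar_mul_le (l : ℤ) (i j : Fin 3) :
    ‖∫ y, incChar α ν m y i * incChar α ν l y j ∂ν‖ ≤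
      4 * (√(charVar α ν m) * √(charVar α ν l)) := by
  have := norm_integral_mul_le_of_sq (ν := ν) (f := fun y => incChar α ν m y i)
    (g := fun y => incChar α ν l y j) (fun y => norm_incChar_le α ν m i y)
    (fun y => norm_incChar_le α ν l j y) (by positivity) (by positivity)
    (integral_norm_incChar_sq_le α ν m i) (integral_norm_incChar_sq_le α ν l j)
  linarith

theorem integral_incChar (i : Fin 3) : ∫ y, incChar α ν m y i ∂ν = 0 := by
  fin_cases i
  · change ∫ y, (centeredChar α ν m y * (starRingEnd ℂ) (centeredChar α ν m y) -
      (charVar α ν m : ℂ)) ∂ν = 0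
    simp_rw [Complex.mul_conj, Complex.normSq_eq_norm_sq, ← Complex.ofReal_sub]
    rw [integral_complex_ofReal, integral_sub (integrable_norm_centeredChar_pow α ν m 2)
      (integrable_const _), integral_norm_centeredChar_sq]
    simp
  · exact integral_centeredChar α ν m
  · change ∫ y, (starRingEnd ℂ) (centeredChar α ν m y) ∂ν = 0
    rw [integral_conj, integral_centeredChar, map_zero]

end Compensated

/-! ### Mean and covariance of the squared moduli. -/

section Covariance

variable {Ω : Type*} {X : ℕ → Ω → ℤ}

theorem isPastFun_compSum (α : ℝ) (ν : Measure ℤ) (m : ℤ) (N n : ℕ) :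
    IsPastFun X n (fun ω => compSum α ν m N (fun k => X k ω) n) :=
  (isPastFun_walkSum α m n).add (IsPastFun.const _)

theorem isPastFun_incCoef (α : ℝ) (ν : Measure ℤ) (m : ℤ) (N n : ℕ) (i : Fin 3) :
    IsPastFun X n (fun ω => incCoef α ν m N (fun k => X k ω) n i) := by
  fin_cases i
  · exact IsPastFun.const _
  · exact (isPastFun_compSum α ν m N n).mul (IsPastFun.const _)
  · exact (isPastFun_compSum α ν m N n).conj.mul (IsPastFun.const _)

/-- The squared modulus of `compSum`. -/
noncomputable def compSq (α : ℝ) (ν : Measure ℤ) (m : ℤ) (N : ℕ) (x : ℕ → ℤ) (n : ℕ) : ℂ :=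
  compSum α ν m N x n * (starRingEnd ℂ) (compSum α ν m N x n)

theorem isPastFun_compSq (α : ℝ) (ν : Measure ℤ) (m : ℤ) (N n : ℕ) :
    IsPastFun X n (fun ω => compSq α ν m N (fun k => X k ω) n) :=
  (isPastFun_compSum α ν m N n).mul (isPastFun_compSum α ν m N n).conj

theorem compSq_step {α : ℝ} {ν : Measure ℤ} {N : ℕ} (m : ℤ) {n : ℕ} (hn : n < N) (x : ℕ → ℤ) :
    compSq α ν m N x (n + 1) = (compSq α ν m N x n +
        charVar α ν m * (geomWeight α ν m (N - (n + 1)) *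
          (starRingEnd ℂ) (geomWeight α ν m (N - (n + 1))))) +
      ∑ i, incCoef α ν m N x n i * incChar α ν m (x n) i :=
  compSum_step α ν m hn x

variable [MeasurableSpace Ω] {P : Measure Ω} [IsProbabilityMeasure P]
  {ν : Measure ℤ} [IsProbabilityMeasure ν] {α : ℝ} {N : ℕ}

theorem norm_integral_compSum_le (hX : ∀ k, Measurable (X k)) (hlaw : ∀ k, P.map (X k) = ν)
    (hind : iIndepFun X P) (m : ℤ) {n : ℕ} (hn : n ≤ N) :
    ‖∫ ω, compSum α ν m N (fun k => X k ω) n ∂P‖ ≤ 2 * geomSum α ν N m := by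
  unfold compSum
  rw [integral_add ((isPastFun_walkSum α m n).integrable hX) (integrable_const _)]
  refine (norm_add_le _ _).trans ?_
  have h1 := norm_integral_walkSum_le (α := α) hX hlaw hind m hn
  have h2 := norm_geomTail_le α ν m (Nat.sub_le N n)
  simp only [integral_const, probReal_univ, one_smul]
  linarith

theorem norm_integral_compSum_mul_le (hX : ∀ k, Measurable (X k)) (hlaw : ∀ k, P.map (X k) = ν)
    (hind : iIndepFun X P) (m l : ℤ) {n : ℕ} (hn : n ≤ N) :
    ‖∫ ω, compSum α ν m N (fun k => X k ω) n * compSum α ν l N (fun k => X k ω) n ∂P‖ ≤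
      (1 + geomSum α ν N m + geomSum α ν N l) * geomSum α ν N (m + l) +
        3 * (geomSum α ν N m * geomSum α ν N l) := by
  have hm := isPastFun_walkSum (X := X) α m n
  have hl := isPastFun_walkSum (X := X) α l n
  set a := geomTail α ν m (N - n)
  set b := geomTail α ν l (N - n)
  have e : ∀ ω, compSum α ν m N (fun k => X k ω) n * compSum α ν l N (fun k => X k ω) n =
      walkSum α m (fun k => X k ω) n * walkSum α l (fun k => X k ω) n +
      walkSum α m (fun k => X k ω) n * b + walkSum α l (fun k => X k ω) n * a + a * b := fun ω => by
    unfold compSum; ring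
  simp_rw [e]
  have i1 := (hm.mul hl).integrable (P := P) hX
  have i2 := (hm.mul (IsPastFun.const b)).integrable (P := P) hX
  have i3 := (hl.mul (IsPastFun.const a)).integrable (P := P) hX
  have i12 := ((hm.mul hl).add (hm.mul (IsPastFun.const b))).integrable (P := P) hX
  have i123 := (((hm.mul hl).add (hm.mul (IsPastFun.const b))).add
    (hl.mul (IsPastFun.const a))).integrable (P := P) hX
  rw [integral_add i123 (integrable_const _), integral_add i12 i3, integral_add i1 i2,
    integral_mul_const, integral_mul_const]
  simp only [integral_const, probReal_univ, one_smul]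
  have h1 := norm_integral_walkSum_mul_le (α := α) hX hlaw hind m l hn
  have h2 := norm_integral_walkSum_le (α := α) hX hlaw hind m hn
  have h3 := norm_integral_walkSum_le (α := α) hX hlaw hind l hn
  have ha : ‖a‖ ≤ geomSum α ν N m := norm_geomTail_le α ν m (Nat.sub_le N n)
  have hb : ‖b‖ ≤ geomSum α ν N l := norm_geomTail_le α ν l (Nat.sub_le N n)
  have hm0 := geomSum_nonneg α ν N m
  have hl0 := geomSum_nonneg α ν N l
  refine (norm_add_le _ _).trans ?_
  have h4 := norm_add₃_le (a := ∫ ω, walkSum α m (fun k => X k ω) n *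
    walkSum α l (fun k => X k ω) n ∂P) (b := (∫ ω, walkSum α m (fun k => X k ω) n ∂P) * b)
    (c := (∫ ω, walkSum α l (fun k => X k ω) n ∂P) * a)
  rw [norm_mul, norm_mul] at h4
  rw [norm_mul a b]
  have h5 := mul_le_mul h2 hb (norm_nonneg _) hm0
  have h6 := mul_le_mul h3 ha (norm_nonneg _) hl0
  have h7 := mul_le_mul ha hb (norm_nonneg _) hm0
  linarith

/-- The three step terms are centred, so only the drift σ²|g|² accumulates on the deterministic
starting value. -/
theorem integral_compSq (hX : ∀ k, Measurable (X k)) (hlaw : ∀ k, P.map (X k) = ν)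
    (hind : iIndepFun X P) (m : ℤ) {n : ℕ} (hn : n ≤ N) :
    ∫ ω, compSq α ν m N (fun k => X k ω) n ∂P =
      ((‖geomTail α ν m N‖ ^ 2 + charVar α ν m *
        ∑ k ∈ Finset.range n, ‖geomWeight α ν m (N - (k + 1))‖ ^ 2 : ℝ) : ℂ) := by
  induction n with
  | zero =>
    simp [compSq, compSum_zero, Complex.mul_conj, Complex.normSq_eq_norm_sq]
  | succ n ih =>
    have ih := ih (by omega)
    have hp := isPastFun_compSq (X := X) α ν m N n
    have h1 := integral_sum_step hX hlaw hind (isPastFun_incCoef (X := X) α ν m N n)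
      (q := fun i y => incChar α ν m y i) (norm_incChar_le α ν m)
    simp only [integral_incChar, mul_zero, Finset.sum_const_zero] at h1
    simp_rw [compSq_step m (show n < N by omega)]
    rw [integral_add, h1, integral_add (hp.integrable hX) (integrable_const _), ih,
      Finset.sum_range_succ]
    · simp only [integral_const, probReal_univ, one_smul, Complex.mul_conj,
        Complex.normSq_eq_norm_sq]
      push_cast; ring
    · exact (hp.add (IsPastFun.const _)).integrable hX
    · exact integrable_finsetSum _ fun i _ => ((isPastFun_incCoef α ν m N n i).succ.mul
        (IsPastFun.step (q := fun y => incChar α ν m y i)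
          (norm_incChar_le α ν m i))).integrable hX

theorem covariance_add_const (f g : Ω → ℂ) (hf : Integrable f P) (hg : Integrable g P)
    (hfg : Integrable (fun ω => f ω * g ω) P) (c d : ℂ) :
    ∫ ω, (f ω + c) * (g ω + d) ∂P - (∫ ω, (f ω + c) ∂P) * ∫ ω, (g ω + d) ∂P =
      ∫ ω, f ω * g ω ∂P - (∫ ω, f ω ∂P) * ∫ ω, g ω ∂P := by
  have e : ∀ ω, (f ω + c) * (g ω + d) = (f ω * g ω + f ω * d) + (g ω * c + c * d) := fun ω => by
    ring
  simp_rw [e]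
  have j1 : Integrable (fun ω => f ω * g ω + f ω * d) P := hfg.add (hf.mul_const d)
  have j2 : Integrable (fun ω => g ω * c + c * d) P := (hg.mul_const c).add (integrable_const _)
  rw [integral_add j1 j2, integral_add hfg (hf.mul_const d),
    integral_add (hg.mul_const c) (integrable_const _), integral_add hf (integrable_const _),
    integral_add hg (integrable_const _), integral_mul_const, integral_mul_const]
  simp only [integral_const, probReal_univ, one_smul]
  ring

/-- The contribution of the `n`-th step to the covariance. -/
noncomputable def covIncrement (P : Measure Ω) (X : ℕ → Ω → ℤ) (α : ℝ) (ν : Measure ℤ) (m l : ℤ)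
    (N n : ℕ) : ℂ :=
  ∑ i, ∑ j, (∫ ω, incCoef α ν m N (fun k => X k ω) n i * incCoef α ν l N (fun k => X k ω) n j ∂P) *
    ∫ y, incChar α ν m y i * incChar α ν l y j ∂ν

/-- Orthogonality of martingale increments for |V|²: the starting value is deterministic, and the
drift is a constant that drops out of covariances. -/
theorem covariance_compSq (hX : ∀ k, Measurable (X k)) (hlaw : ∀ k, P.map (X k) = ν)
    (hind : iIndepFun X P) (m l : ℤ) {n : ℕ} (hn : n ≤ N) :
    ∫ ω, compSq α ν m N (fun k => X k ω) n * compSq α ν l N (fun k => X k ω) n ∂P -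
      (∫ ω, compSq α ν m N (fun k => X k ω) n ∂P) * ∫ ω, compSq α ν l N (fun k => X k ω) n ∂P =
    ∑ k ∈ Finset.range n, covIncrement P X α ν m l N k := by
  induction n with
  | zero => simp [compSq, compSum_zero]
  | succ n ih =>
    have hm := isPastFun_compSq (X := X) α ν m N n
    have hl := isPastFun_compSq (X := X) α ν l N n
    rw [Finset.sum_range_succ, ← ih (by omega)]
    simp_rw [compSq_step m (show n < N by omega), compSq_step l (show n < N by omega)]
    rw [covariance_step hX hlaw hind (hm.add (IsPastFun.const _)) (hl.add (IsPastFun.const _))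
      (isPastFun_incCoef α ν m N n) (isPastFun_incCoef α ν l N n)
      (q := fun i y => incChar α ν m y i) (q' := fun i y => incChar α ν l y i)
      (norm_incChar_le α ν m) (norm_incChar_le α ν l) (integral_incChar α ν m)
      (integral_incChar α ν l),
      covariance_add_const _ _ (hm.integrable hX) (hl.integrable hX) ((hm.mul hl).integrable hX)]
    rfl

end Covariance

/-! ### Asymptotics of the summed squared weights. -/

section Weights

variable (α : ℝ) (ν : Measure ℤ) (m : ℤ) (N : ℕ)

/-- The sum of the squared martingale weights. -/
noncomputable def weightSum : ℝ := ∑ k ∈ Finset.range N, ‖geomWeight α ν m (N - (k + 1))‖ ^ 2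

theorem weightSum_nonneg : 0 ≤ weightSum α ν m N := Finset.sum_nonneg fun _ _ => by positivity

variable [IsProbabilityMeasure ν]

theorem charVar_mul_weightSum_le : charVar α ν m * weightSum α ν m N ≤ 2 * N * geomSum α ν N m := by
  have h1 : weightSum α ν m N ≤ N * geomSum α ν N m ^ 2 := by
    unfold weightSum
    calc _ ≤ ∑ _k ∈ Finset.range N, geomSum α ν N m ^ 2 := by
          refine Finset.sum_le_sum fun k hk => ?_
          have := Finset.mem_range.mp hk
          exact pow_le_pow_left₀ (norm_nonneg _) (norm_geomWeight_le α ν m (by omega)) 2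
      _ = _ := by simp
  calc charVar α ν m * weightSum α ν m N ≤ charVar α ν m * (N * geomSum α ν N m ^ 2) :=
        mul_le_mul_of_nonneg_left h1 (charVar_nonneg α ν m)
    _ = (charVar α ν m * geomSum α ν N m) * (N * geomSum α ν N m) := by ring
    _ ≤ 2 * (N * geomSum α ν N m) := by
        have := geomSum_nonneg α ν N m
        have := charVar_mul_geomSum_le α ν N m
        gcongr
    _ = _ := by ring

/-- Summing the geometric series, |1-φ|·|g| is |1 - conj(φ)^(j+1)|, whose square differs from 1 by
at most 3|φ|^j. The sum over steps is 3G, and σ²G ≤ 2 yields the constant 6, free of N. -/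
theorem abs_charVar_mul_weightSum_sub_le (hr : 0 < ‖1 - charAt α ν m‖) :
    |charVar α ν m * weightSum α ν m N - N * (charVar α ν m / ‖1 - charAt α ν m‖ ^ 2)| ≤
      6 / ‖1 - charAt α ν m‖ ^ 2 := by
  set z := charAt α ν m with hz
  have hz1 := norm_charAt_le_one α ν m
  have hterm : ∀ k ∈ Finset.range N,
      |‖1 - z‖ ^ 2 * ‖geomWeight α ν m (N - (k + 1))‖ ^ 2 - 1| ≤ 3 * ‖z‖ ^ (N - 1 - k) := by
    intro k hk
    have hk := Finset.mem_range.mp hk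
    have h1 : ‖1 - z‖ * ‖geomWeight α ν m (N - (k + 1))‖ =
        ‖1 - charAt α ν (-m) ^ (N - 1 - k + 1)‖ := by
      have : ‖1 - z‖ = ‖1 - charAt α ν (-m)‖ := by
        rw [← Complex.norm_conj, map_sub, map_one, hz, conj_charAt]
      rw [this, ← norm_mul, geomWeight_eq, mul_neg_geom_sum, show N - (k + 1) = N - 1 - k by omega]
    rw [← mul_pow, h1]
    set u := charAt α ν (-m) ^ (N - 1 - k + 1) with hu
    have hun : ‖u‖ ≤ ‖z‖ ^ (N - 1 - k) := by
      rw [hu, norm_pow, norm_charAt_neg]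
      exact pow_le_pow_of_le_one (norm_nonneg _) hz1 (Nat.le_succ _)
    have hu1 : ‖u‖ ≤ 1 := hun.trans (pow_le_one₀ (norm_nonneg _) hz1)
    have e1 : ‖1 - u‖ ≤ 1 + ‖u‖ := by simpa using norm_sub_le (1 : ℂ) u
    have e2 : 1 - ‖u‖ ≤ ‖1 - u‖ := by simpa using norm_sub_norm_le (1 : ℂ) u
    have e3 := norm_nonneg (1 - u)
    have e4 := norm_nonneg u
    rw [abs_le]
    constructor <;> nlinarith
  have h2 : |‖1 - z‖ ^ 2 * weightSum α ν m N - N| ≤ 3 * geomSum α ν N m := by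
    calc |‖1 - z‖ ^ 2 * weightSum α ν m N - N| = |∑ k ∈ Finset.range N,
          (‖1 - z‖ ^ 2 * ‖geomWeight α ν m (N - (k + 1))‖ ^ 2 - 1)| := by
          rw [Finset.sum_sub_distrib, ← Finset.mul_sum]; simp [weightSum]
      _ ≤ ∑ k ∈ Finset.range N, 3 * ‖z‖ ^ (N - 1 - k) :=
          (Finset.abs_sum_le_sum_abs _ _).trans (Finset.sum_le_sum hterm)
      _ = 3 * geomSum α ν N m := by
          rw [← Finset.mul_sum, Finset.sum_range_reflect (fun k => ‖z‖ ^ k) N]; rfl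
  have h3 := charVar_nonneg α ν m
  rw [le_div_iff₀ (by positivity), ← abs_of_pos (show 0 < ‖1 - z‖ ^ 2 by positivity), ← abs_mul,
    abs_of_pos (show 0 < ‖1 - z‖ ^ 2 by positivity)]
  have h4 : (charVar α ν m * weightSum α ν m N - N * (charVar α ν m / ‖1 - z‖ ^ 2)) *
      ‖1 - z‖ ^ 2 = charVar α ν m * (‖1 - z‖ ^ 2 * weightSum α ν m N - N) := by
    field_simp
  rw [h4, abs_mul, abs_of_nonneg h3]
  have h5 := charVar_mul_geomSum_le α ν N m
  nlinarith [mul_le_mul_of_nonneg_left h2 h3]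

end Weights

theorem compSq_last (α : ℝ) (ν : Measure ℤ) (N : ℕ) (m : ℤ) (x : ℕ → ℤ) :
    compSq α ν m N x N = ((‖walkSum α m x N‖ ^ 2 : ℝ) : ℂ) := by
  rw [compSq, compSum_last, Complex.mul_conj, Complex.normSq_eq_norm_sq]

/-! ### Bounds for the covariance contributed by one step. -/

section Bounds

variable {Ω : Type*} [MeasurableSpace Ω] {P : Measure Ω} [IsProbabilityMeasure P]
  {X : ℕ → Ω → ℤ} {ν : Measure ℤ} [IsProbabilityMeasure ν] {α : ℝ} {N : ℕ}

theorem norm_integral_compSum_mul_const_le (hX : ∀ k, Measurable (X k))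
    (hlaw : ∀ k, P.map (X k) = ν) (hind : iIndepFun X P) (m l : ℤ) {n : ℕ} (hn : n ≤ N) (a b : ℂ)
    {G H : ℝ} (ha : ‖a‖ ≤ G) (hb : ‖b‖ ≤ H) :
    ‖∫ ω, (compSum α ν m N (fun k => X k ω) n * a) * (compSum α ν l N (fun k => X k ω) n * b) ∂P‖ ≤
      G * H * ((1 + geomSum α ν N m + geomSum α ν N l) * geomSum α ν N (m + l) +
        3 * (geomSum α ν N m * geomSum α ν N l)) := by
  simp_rw [mul_mul_mul_comm _ a _ b]
  rw [integral_mul_const, norm_mul, norm_mul, mul_comm]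
  have h := norm_integral_compSum_mul_le (α := α) hX hlaw hind m l hn
  have hG : 0 ≤ G := (norm_nonneg a).trans ha
  have hH : 0 ≤ H := (norm_nonneg b).trans hb
  gcongr

theorem norm_integral_const_mul_compSum_le (hX : ∀ k, Measurable (X k))
    (hlaw : ∀ k, P.map (X k) = ν) (hind : iIndepFun X P) (m : ℤ) {n : ℕ} (hn : n ≤ N) (a b : ℂ)
    {G H : ℝ} (ha : ‖a‖ ≤ G) (hb : ‖b‖ ≤ H) :
    ‖∫ ω, a * (compSum α ν m N (fun k => X k ω) n * b) ∂P‖ ≤ G * H * (2 * geomSum α ν N m) := by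
  have e : ∀ ω, a * (compSum α ν m N (fun k => X k ω) n * b) =
      compSum α ν m N (fun k => X k ω) n * (a * b) := fun ω => by ring
  simp_rw [e]
  rw [integral_mul_const, norm_mul, norm_mul, mul_comm]
  have h := norm_integral_compSum_le (α := α) hX hlaw hind m hn
  have hG : 0 ≤ G := (norm_nonneg a).trans ha
  have hH : 0 ≤ H := (norm_nonneg b).trans hb
  gcongr

/-- Bound for the mixed moments of `compSum` at two frequencies. -/
noncomputable def mixedBound (α : ℝ) (ν : Measure ℤ) (N : ℕ) (m l k : ℤ) : ℝ :=
  (1 + geomSum α ν N m + geomSum α ν N l) * geomSum α ν N k +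
    3 * (geomSum α ν N m * geomSum α ν N l)

/-- Index 0 is the deterministic |g|²; indices 1 and 2 carry V and its conjugate. Conjugation
changes the sign of the frequency, so equal indices resonate at m + l and opposite ones at m - l,
the geometric sum being even. -/
theorem norm_integral_incCoef_mul_le (hX : ∀ k, Measurable (X k)) (hlaw : ∀ k, P.map (X k) = ν)
    (hind : iIndepFun X P) (m l : ℤ) {n : ℕ} (hn : n < N) (i j : Fin 3) :
    ‖∫ ω, incCoef α ν m N (fun k => X k ω) n i * incCoef α ν l N (fun k => X k ω) n j ∂P‖ ≤
      geomSum α ν N m * geomSum α ν N l *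
        (![![geomSum α ν N m * geomSum α ν N l, 2 * (geomSum α ν N m * geomSum α ν N l),
              2 * (geomSum α ν N m * geomSum α ν N l)],
          ![2 * (geomSum α ν N m * geomSum α ν N l), mixedBound α ν N m l (m + l),
              mixedBound α ν N m l (m - l)],
          ![2 * (geomSum α ν N m * geomSum α ν N l), mixedBound α ν N m l (m - l),
              mixedBound α ν N m l (m + l)]] i j) := by
  set G := geomSum α ν N m with hG
  set H := geomSum α ν N l with hH
  have hg : ‖geomWeight α ν m (N - (n + 1))‖ ≤ G := norm_geomWeight_le α ν m (by omega)
  have hh : ‖geomWeight α ν l (N - (n + 1))‖ ≤ H := norm_geomWeight_le α ν l (by omega)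
  have hg' : ‖(starRingEnd ℂ) (geomWeight α ν m (N - (n + 1)))‖ ≤ G := by rwa [Complex.norm_conj]
  have hh' : ‖(starRingEnd ℂ) (geomWeight α ν l (N - (n + 1)))‖ ≤ H := by rwa [Complex.norm_conj]
  have hG0 : 0 ≤ G := geomSum_nonneg α ν N m
  have hH0 : 0 ≤ H := geomSum_nonneg α ν N l
  have hgg : ‖geomWeight α ν m (N - (n + 1)) *
      (starRingEnd ℂ) (geomWeight α ν m (N - (n + 1)))‖ ≤ G * G := by
    rw [norm_mul]; exact mul_le_mul hg hg' (norm_nonneg _) hG0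
  have hhh : ‖geomWeight α ν l (N - (n + 1)) *
      (starRingEnd ℂ) (geomWeight α ν l (N - (n + 1)))‖ ≤ H * H := by
    rw [norm_mul]; exact mul_le_mul hh hh' (norm_nonneg _) hH0
  have key := fun m l => norm_integral_compSum_mul_const_le (α := α) hX hlaw hind m l hn.le
  have key1 := fun m => norm_integral_const_mul_compSum_le (α := α) hX hlaw hind m hn.le
  have hpl : geomSum α ν N (-m + -l) = geomSum α ν N (m + l) := by
    rw [← geomSum_neg, neg_add, neg_neg, neg_neg]
  have hmi : geomSum α ν N (-m + l) = geomSum α ν N (m - l) := by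
    rw [← geomSum_neg]; congr 1; ring
  unfold mixedBound
  fin_cases i <;> fin_cases j <;>
    simp only [incCoef, conj_compSum, Fin.zero_eta, Fin.mk_one, Fin.reduceFinMk,
      Matrix.cons_val_zero, Matrix.cons_val_one, Matrix.cons_val]
  · simp only [integral_const, probReal_univ, one_smul]
    rw [norm_mul]
    calc _ ≤ (G * G) * (H * H) := mul_le_mul hgg hhh (norm_nonneg _) (by positivity)
      _ = _ := by ring
  · exact (key1 l _ _ hgg hh').trans (le_of_eq (by rw [← hH]; ring))
  · exact (key1 (-l) _ _ hgg hh).trans (le_of_eq (by rw [geomSum_neg, ← hH]; ring))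
  · simp_rw [mul_comm (compSum α ν m N _ n * _)]
    exact (key1 m _ _ hhh hg').trans (le_of_eq (by rw [← hG]; ring))
  · exact key m l _ _ hg' hh'
  · exact (key m (-l) _ _ hg' hh).trans (le_of_eq (by
      rw [geomSum_neg α ν N l, ← sub_eq_add_neg]))
  · simp_rw [mul_comm (compSum α ν (-m) N _ n * _)]
    exact (key1 (-m) _ _ hhh hg).trans (le_of_eq (by rw [geomSum_neg, ← hG]; ring))
  · exact (key (-m) l _ _ hg hh').trans (le_of_eq (by rw [geomSum_neg α ν N m, hmi]))
  · exact (key (-m) (-l) _ _ hg hh).trans (le_of_eq (by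
      rw [geomSum_neg α ν N m, geomSum_neg α ν N l, hpl]))

/-- Bound for the contribution of one step to the covariance. -/
noncomputable def stepBound (α : ℝ) (ν : Measure ℤ) (N : ℕ) (m l : ℤ) : ℝ :=
  4 * (√(charVar α ν m) * √(charVar α ν l)) * (geomSum α ν N m * geomSum α ν N l) *
    (21 * (geomSum α ν N m * geomSum α ν N l) +
      2 * (1 + geomSum α ν N m + geomSum α ν N l) *
        (geomSum α ν N (m + l) + geomSum α ν N (m - l)))

theorem norm_covIncrement_le (hX : ∀ k, Measurable (X k)) (hlaw : ∀ k, P.map (X k) = ν)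
    (hind : iIndepFun X P) (m l : ℤ) {n : ℕ} (hn : n < N) :
    ‖covIncrement P X α ν m l N n‖ ≤ stepBound α ν N m l := by
  have hterm := fun i j => mul_le_mul (norm_integral_incCoef_mul_le (α := α) hX hlaw hind m l hn i j)
    (norm_integral_incChar_mul_le α ν m l i j) (norm_nonneg _)
    ((norm_nonneg _).trans (norm_integral_incCoef_mul_le (α := α) hX hlaw hind m l hn i j))
  unfold covIncrement
  refine (norm_sum_le_of_le _ fun i _ => norm_sum_le_of_le _ fun j _ =>
    (norm_mul_le _ _).trans (hterm i j)).trans (le_of_eq ?_)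
  -- The 21 in `stepBound` is 1 + 4·2 + 4·3 over the nine entries; each of m + l and m - l occurs in
  -- two of them.
  simp only [Fin.sum_univ_three, Matrix.cons_val_zero, Matrix.cons_val_one, Matrix.cons_val,
    stepBound, mixedBound]
  ring

theorem integral_norm_walkSum_sq (hX : ∀ k, Measurable (X k)) (hlaw : ∀ k, P.map (X k) = ν)
    (hind : iIndepFun X P) (m : ℤ) :
    ∫ ω, ‖walkSum α m (fun k => X k ω) N‖ ^ 2 ∂P =
      ‖geomTail α ν m N‖ ^ 2 + charVar α ν m * weightSum α ν m N := by
  have h := integral_compSq (α := α) hX hlaw hind m (le_refl N)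
  simp_rw [compSq_last] at h
  rw [integral_complex_ofReal] at h
  exact Complex.ofReal_injective h

theorem ofReal_covariance (hX : ∀ k, Measurable (X k)) (hlaw : ∀ k, P.map (X k) = ν)
    (hind : iIndepFun X P) (m l : ℤ) :
    ((∫ ω, ‖walkSum α m (fun k => X k ω) N‖ ^ 2 * ‖walkSum α l (fun k => X k ω) N‖ ^ 2 ∂P -
      (∫ ω, ‖walkSum α m (fun k => X k ω) N‖ ^ 2 ∂P) *
        ∫ ω, ‖walkSum α l (fun k => X k ω) N‖ ^ 2 ∂P : ℝ) : ℂ) =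
    ∑ k ∈ Finset.range N, covIncrement P X α ν m l N k := by
  rw [← covariance_compSq hX hlaw hind m l le_rfl]
  simp_rw [compSq_last, ← Complex.ofReal_mul]
  rw [integral_complex_ofReal, integral_complex_ofReal, integral_complex_ofReal]
  push_cast
  rfl

theorem abs_covariance_le (hX : ∀ k, Measurable (X k)) (hlaw : ∀ k, P.map (X k) = ν)
    (hind : iIndepFun X P) (m l : ℤ) :
    |∫ ω, ‖walkSum α m (fun k => X k ω) N‖ ^ 2 * ‖walkSum α l (fun k => X k ω) N‖ ^ 2 ∂P -
      (∫ ω, ‖walkSum α m (fun k => X k ω) N‖ ^ 2 ∂P) *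
        ∫ ω, ‖walkSum α l (fun k => X k ω) N‖ ^ 2 ∂P| ≤ N * stepBound α ν N m l := by
  rw [← Real.norm_eq_abs, ← Complex.norm_real, ofReal_covariance hX hlaw hind]
  refine (norm_sum_le_of_le _ fun n hn =>
    norm_covIncrement_le hX hlaw hind m l (Finset.mem_range.mp hn)).trans ?_
  simp

/-- With a k = |g|² at step k, this turns the iterated sum of variance increments into the square of
`weightSum`. -/
theorem two_mul_sum_sum_lt (a : ℕ → ℝ) (N : ℕ) :
    2 * ∑ k ∈ Finset.range N, a k * ∑ i ∈ Finset.range k, a i =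
      (∑ k ∈ Finset.range N, a k) ^ 2 - ∑ k ∈ Finset.range N, a k ^ 2 := by
  induction N with
  | zero => simp
  | succ N ih => rw [Finset.sum_range_succ, Finset.sum_range_succ, Finset.sum_range_succ,
      mul_add, ih]; ring

/-- Error bound for the contribution of one step to the variance. -/
noncomputable def diagBound (α : ℝ) (ν : Measure ℤ) (N : ℕ) (m : ℤ) : ℝ :=
  charVar α ν m * geomSum α ν N m ^ 2 * (63 * geomSum α ν N m ^ 2 +
    8 * (1 + 2 * geomSum α ν N m) * geomSum α ν N (m + m))

/-- The index pairs (1,2) and (2,1) resonate at frequency m - m = 0, where `geomSum` equals N;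
together they give 2σ²|g|²E|V|², which `integral_compSq` evaluates exactly. The other seven pairs
involve at most the frequency m + m and are errors, as is the initial |T|². Here 62 = 4·(1 + 4·2 +
2·3) + 2. -/
theorem norm_covIncrement_self_sub_le (hX : ∀ k, Measurable (X k)) (hlaw : ∀ k, P.map (X k) = ν)
    (hind : iIndepFun X P) (m : ℤ) {n : ℕ} (hn : n < N) :
    ‖covIncrement P X α ν m m N n - ((2 * charVar α ν m ^ 2 *
      (‖geomWeight α ν m (N - (n + 1))‖ ^ 2 *
        ∑ k ∈ Finset.range n, ‖geomWeight α ν m (N - (k + 1))‖ ^ 2) : ℝ) : ℂ)‖ ≤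
      charVar α ν m * geomSum α ν N m ^ 2 * (62 * geomSum α ν N m ^ 2 +
        8 * (1 + 2 * geomSum α ν N m) * geomSum α ν N (m + m)) := by
  set G := geomSum α ν N m with hG
  set s := charVar α ν m with hs
  have hs0 : 0 ≤ s := charVar_nonneg α ν m
  have hG0 : 0 ≤ G := geomSum_nonneg α ν N m
  set g := geomWeight α ν m (N - (n + 1)) with hgdef
  have hg : ‖g‖ ≤ G := norm_geomWeight_le α ν m (by omega)
  have hh : ‖geomTail α ν m N‖ ≤ G := norm_geomTail_le α ν m le_rfl
  set I : Fin 3 → Fin 3 → ℂ := fun i j =>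
    ∫ ω, incCoef α ν m N (fun k => X k ω) n i * incCoef α ν m N (fun k => X k ω) n j ∂P with hI
  set J : Fin 3 → Fin 3 → ℂ := fun i j => ∫ y, incChar α ν m y i * incChar α ν m y j ∂ν with hJ
  have hterm : ∀ i j, ‖I i j * J i j‖ ≤ _ := fun i j => (norm_mul_le _ _).trans
    (mul_le_mul (norm_integral_incCoef_mul_le (α := α) hX hlaw hind m m hn i j)
    (norm_integral_incChar_mul_le α ν m m i j) (norm_nonneg _)
    ((norm_nonneg _).trans (norm_integral_incCoef_mul_le (α := α) hX hlaw hind m m hn i j)))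
  have hE := integral_compSq (α := α) hX hlaw hind m hn.le
  have hJ12 : J 1 2 = (s : ℂ) := by
    change ∫ y, centeredChar α ν m y * (starRingEnd ℂ) (centeredChar α ν m y) ∂ν = _
    simp_rw [Complex.mul_conj, Complex.normSq_eq_norm_sq]
    rw [integral_complex_ofReal, integral_norm_centeredChar_sq]
  have hJ21 : J 2 1 = (s : ℂ) := by
    rw [← hJ12]; simp only [hJ]; simp_rw [mul_comm]
  have hI12 : I 1 2 = ((‖g‖ ^ 2 : ℝ) : ℂ) * ∫ ω, compSq α ν m N (fun k => X k ω) n ∂P := by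
    rw [← integral_const_mul]
    refine integral_congr_ae (Filter.Eventually.of_forall fun ω => ?_)
    simp only [incCoef, Matrix.cons_val_one, Matrix.cons_val, compSq]
    rw [← Complex.normSq_eq_norm_sq, ← Complex.mul_conj]
    ring
  have hI21 : I 2 1 = I 1 2 := by
    simp only [hI]; simp_rw [mul_comm]
  have hsplit : covIncrement P X α ν m m N n - ((2 * s ^ 2 * (‖g‖ ^ 2 *
        ∑ k ∈ Finset.range n, ‖geomWeight α ν m (N - (k + 1))‖ ^ 2) : ℝ) : ℂ) =
      I 0 0 * J 0 0 + I 0 1 * J 0 1 + I 0 2 * J 0 2 + I 1 0 * J 1 0 + I 1 1 * J 1 1 +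
        I 2 0 * J 2 0 + I 2 2 * J 2 2 +
        ((2 * s * ‖g‖ ^ 2 * ‖geomTail α ν m N‖ ^ 2 : ℝ) : ℂ) := by
    have : covIncrement P X α ν m m N n = ∑ i, ∑ j, I i j * J i j := rfl
    rw [this]
    simp only [Fin.sum_univ_three]
    rw [hI21, hJ12, hJ21, hI12, hE]
    push_cast
    ring
  have hlast : ‖((2 * s * ‖g‖ ^ 2 * ‖geomTail α ν m N‖ ^ 2 : ℝ) : ℂ)‖ ≤ 2 * s * G ^ 2 * G ^ 2 := by
    rw [Complex.norm_real, Real.norm_of_nonneg (by positivity)]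
    gcongr
  have hss : √s * √s = s := Real.mul_self_sqrt hs0
  rw [hsplit]
  refine (norm_add_le_of_le (norm_add_le_of_le (norm_add_le_of_le (norm_add_le_of_le
    (norm_add_le_of_le (norm_add_le_of_le (norm_add_le_of_le (hterm 0 0) (hterm 0 1)) (hterm 0 2))
    (hterm 1 0)) (hterm 1 1)) (hterm 2 0)) (hterm 2 2)) hlast).trans (le_of_eq ?_)
  simp only [Matrix.cons_val_zero, Matrix.cons_val_one, Matrix.cons_val, mixedBound, ← hG,
    ← hs, hss]
  ring

theorem abs_variance_sub_le (hX : ∀ k, Measurable (X k)) (hlaw : ∀ k, P.map (X k) = ν)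
    (hind : iIndepFun X P) (m : ℤ) :
    |(∫ ω, ‖walkSum α m (fun k => X k ω) N‖ ^ 2 * ‖walkSum α m (fun k => X k ω) N‖ ^ 2 ∂P -
      (∫ ω, ‖walkSum α m (fun k => X k ω) N‖ ^ 2 ∂P) *
        ∫ ω, ‖walkSum α m (fun k => X k ω) N‖ ^ 2 ∂P) -
      (charVar α ν m * weightSum α ν m N) ^ 2| ≤ N * diagBound α ν N m := by
  set G := geomSum α ν N m with hG
  set s := charVar α ν m with hs
  have hs0 : 0 ≤ s := charVar_nonneg α ν m
  have hs1 : s ≤ 1 := charVar_le_one α ν m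
  have hG0 : 0 ≤ G := geomSum_nonneg α ν N m
  set a : ℕ → ℝ := fun k => ‖geomWeight α ν m (N - (k + 1))‖ ^ 2 with ha
  have hak : ∀ k ∈ Finset.range N, a k ≤ G ^ 2 := fun k hk => by
    have := Finset.mem_range.mp hk
    exact pow_le_pow_left₀ (norm_nonneg _) (norm_geomWeight_le α ν m (by omega)) 2
  have hmain : (s * weightSum α ν m N) ^ 2 =
      ∑ n ∈ Finset.range N, 2 * s ^ 2 * (a n * ∑ k ∈ Finset.range n, a k) +
        s ^ 2 * ∑ k ∈ Finset.range N, a k ^ 2 := by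
    have h := two_mul_sum_sum_lt a N
    rw [← Finset.mul_sum, show weightSum α ν m N = ∑ k ∈ Finset.range N, a k from rfl]
    linear_combination (-s ^ 2) * h
  rw [← Real.norm_eq_abs, ← Complex.norm_real, Complex.ofReal_sub, ofReal_covariance hX hlaw hind,
    hmain, Complex.ofReal_add, ← sub_sub, Complex.ofReal_sum, ← Finset.sum_sub_distrib]
  -- The diagonal ∑|g|⁴ missing from the square costs one more unit, which turns 62 into the 63 of
  -- `diagBound`.
  have hsq : ‖((s ^ 2 * ∑ k ∈ Finset.range N, a k ^ 2 : ℝ) : ℂ)‖ ≤ N * (s * G ^ 2 * G ^ 2) := by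
    rw [Complex.norm_real, Real.norm_of_nonneg
      (mul_nonneg (by positivity) (Finset.sum_nonneg fun _ _ => by positivity))]
    have h1 : ∑ k ∈ Finset.range N, a k ^ 2 ≤ N * (G ^ 2) ^ 2 := by
      calc _ ≤ ∑ _k ∈ Finset.range N, (G ^ 2) ^ 2 :=
            Finset.sum_le_sum fun k hk => pow_le_pow_left₀ (by positivity) (hak k hk) 2
        _ = _ := by simp
    calc s ^ 2 * ∑ k ∈ Finset.range N, a k ^ 2 ≤ s * (N * (G ^ 2) ^ 2) := by
          apply mul_le_mul _ h1 (Finset.sum_nonneg fun _ _ => by positivity) hs0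
          nlinarith
      _ = _ := by ring
  refine (norm_sub_le_of_le (norm_sum_le_of_le _ fun n hn =>
    norm_covIncrement_self_sub_le hX hlaw hind m (Finset.mem_range.mp hn)) hsq).trans (le_of_eq ?_)
  simp only [Finset.sum_const, Finset.card_range, nsmul_eq_mul, diagBound, ← hG, ← hs]
  ring

end Bounds

/-! ### Summation of weights over pairs of frequencies. -/

/-- The weight `k⁻² x_k⁻³`. -/
noncomputable def cubicWeight (β : ℝ) (K : ℕ) (k : ℤ) : ℝ :=
  1 / (k : ℝ) ^ 2 * (1 / cappedDist β K k ^ 3)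

theorem cubicWeight_neg (β : ℝ) (K : ℕ) (k : ℤ) : cubicWeight β K (-k) = cubicWeight β K k := by
  unfold cubicWeight
  rw [cappedDist_neg]; push_cast; rw [neg_sq]

theorem cubicWeight_nonneg (β : ℝ) {K : ℕ} (hK : 1 ≤ K) (k : ℤ) : 0 ≤ cubicWeight β K k := by
  have := cappedDist_pos β hK k
  unfold cubicWeight; positivity

/-- The elementary inequality behind the summation over pairs of frequencies: `m`, `l`, `k` stand
for the frequencies and `p`, `q`, `r` for the reciprocals of their capped distances. -/
theorem triple_weight_le {m l k x y w : ℝ} (hm : 0 < m) (hl : 0 < l) (hk : 0 < k ^ 2)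
    (hkm : l ≤ m → k ^ 2 ≤ 4 * m ^ 2) (hkl : m ≤ l → k ^ 2 ≤ 4 * l ^ 2)
    (hx : 0 < x) (hy : 0 < y) (hw : 0 < w) (h1 : y ≤ x + w) :
    1 / m ^ 2 * (1 / l ^ 2) * ((1 / x) ^ 3 * (1 / y) * (1 / w) ^ 2) ≤
      32 * ((1 / m ^ 2 * (1 / x ^ 3)) * (1 / l ^ 2 * (1 / y ^ 3)) +
        (1 / m ^ 2 * (1 / x ^ 3)) * (1 / k ^ 2 * (1 / w ^ 3)) +
        (1 / l ^ 2 * (1 / y ^ 3)) * (1 / k ^ 2 * (1 / w ^ 3))) := by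
  have a1 : 0 ≤ (1 / m ^ 2 * (1 / x ^ 3)) * (1 / l ^ 2 * (1 / y ^ 3)) := by positivity
  have a2 : 0 ≤ (1 / m ^ 2 * (1 / x ^ 3)) * (1 / k ^ 2 * (1 / w ^ 3)) := by positivity
  have a3 : 0 ≤ (1 / l ^ 2 * (1 / y ^ 3)) * (1 / k ^ 2 * (1 / w ^ 3)) := by positivity
  -- If w ≥ y/2, the factors 1/w are exchanged for 1/y and the third frequency disappears. Otherwise
  -- x ≥ y - w > y/2 and 1/y ≤ 1/w, and `k` can take the place of the larger of `m` and `l`.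
  rcases le_or_gt y (2 * w) with h | h
  · have hr : 1 / w ≤ 2 * (1 / y) := by
      rw [mul_one_div, div_le_div_iff₀ hw hy]; linarith
    have : 1 / m ^ 2 * (1 / l ^ 2) * ((1 / x) ^ 3 * (1 / y) * (1 / w) ^ 2) ≤
        4 * ((1 / m ^ 2 * (1 / x ^ 3)) * (1 / l ^ 2 * (1 / y ^ 3))) := by
      calc _ ≤ 1 / m ^ 2 * (1 / l ^ 2) * ((1 / x) ^ 3 * (1 / y) * (2 * (1 / y)) ^ 2) := by gcongr
        _ = _ := by field_simp; ring
    linarith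
  · have hq : 1 / y ≤ 1 / w := one_div_le_one_div_of_le hw (by linarith)
    have hp : 1 / x ≤ 2 * (1 / y) := by
      rw [mul_one_div, div_le_div_iff₀ hx hy]; linarith
    rcases le_total m l with hml | hml
    · have hkl' : 1 / l ^ 2 ≤ 4 * (1 / k ^ 2) := by
        rw [mul_one_div, div_le_div_iff₀ (by positivity) hk]
        linarith [hkl hml]
      have : 1 / m ^ 2 * (1 / l ^ 2) * ((1 / x) ^ 3 * (1 / y) * (1 / w) ^ 2) ≤
          4 * ((1 / m ^ 2 * (1 / x ^ 3)) * (1 / k ^ 2 * (1 / w ^ 3))) := by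
        calc _ ≤ 1 / m ^ 2 * (4 * (1 / k ^ 2)) * ((1 / x) ^ 3 * (1 / w) * (1 / w) ^ 2) := by gcongr
          _ = _ := by ring
      linarith
    · have hkm' : 1 / m ^ 2 ≤ 4 * (1 / k ^ 2) := by
        rw [mul_one_div, div_le_div_iff₀ (by positivity) hk]
        linarith [hkm hml]
      have : 1 / m ^ 2 * (1 / l ^ 2) * ((1 / x) ^ 3 * (1 / y) * (1 / w) ^ 2) ≤
          32 * ((1 / l ^ 2 * (1 / y ^ 3)) * (1 / k ^ 2 * (1 / w ^ 3))) := by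
        calc _ ≤ 4 * (1 / k ^ 2) * (1 / l ^ 2) *
              ((2 * (1 / y)) ^ 3 * (1 / w) * (1 / w) ^ 2) := by gcongr
          _ = _ := by ring
      linarith

/-- To be used with k = m ± l, where both triangle inequalities hold; it adds the two instances of
`triple_weight_le` with the frequencies interchanged. -/
theorem triple_cubicWeight_le (β : ℝ) {K : ℕ} (hK : 1 ≤ K) {m l : ℕ} (hm : 1 ≤ m) (hl : 1 ≤ l)
    {k : ℤ} (hk : k ≠ 0) (hk2 : |k| ≤ 2 * max (m : ℤ) l)
    (h1 : cappedDist β K l ≤ cappedDist β K m + cappedDist β K k)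
    (h2 : cappedDist β K m ≤ cappedDist β K l + cappedDist β K k) :
    1 / (m : ℝ) ^ 2 * (1 / (l : ℝ) ^ 2) * ((1 / cappedDist β K m) * (1 / cappedDist β K l) *
      ((1 / cappedDist β K m) ^ 2 + (1 / cappedDist β K l) ^ 2) * (1 / cappedDist β K k) ^ 2) ≤
    64 * (cubicWeight β K m * cubicWeight β K l +
      (cubicWeight β K m + cubicWeight β K l) * cubicWeight β K k) := by
  have hm' : (0 : ℝ) < m := by exact_mod_cast hm
  have hl' : (0 : ℝ) < l := by exact_mod_cast hl
  have hk' : 0 < (k : ℝ) ^ 2 := by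
    have : (k : ℝ) ≠ 0 := by exact_mod_cast hk
    positivity
  have hkmax : |(k : ℝ)| ≤ 2 * max (m : ℝ) l := by exact_mod_cast hk2
  have hkm : (l : ℝ) ≤ m → (k : ℝ) ^ 2 ≤ 4 * (m : ℝ) ^ 2 := fun h => by
    rw [max_eq_left h] at hkmax
    rw [← sq_abs]; nlinarith [abs_nonneg (k : ℝ)]
  have hkl : (m : ℝ) ≤ l → (k : ℝ) ^ 2 ≤ 4 * (l : ℝ) ^ 2 := fun h => by
    rw [max_eq_right h] at hkmax
    rw [← sq_abs]; nlinarith [abs_nonneg (k : ℝ)]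
  have e1 := triple_weight_le hm' hl' hk' hkm hkl (cappedDist_pos β hK m) (cappedDist_pos β hK l)
    (cappedDist_pos β hK k) h1
  have e2 := triple_weight_le hl' hm' hk' hkl hkm (cappedDist_pos β hK l) (cappedDist_pos β hK m)
    (cappedDist_pos β hK k) h2
  have e3 := add_le_add e1 e2
  unfold cubicWeight
  push_cast
  refine le_trans (le_of_eq ?_) (e3.trans (le_of_eq ?_)) <;> ring

theorem sum_comp_le_sum {ι κ : Type*} {s : Finset ι} {t : Finset κ} {e : ι → κ}
    {f : κ → ℝ} (he : Set.InjOn e s) (hst : ∀ i ∈ s, e i ∈ t) (hf : ∀ k, 0 ≤ f k) :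
    ∑ i ∈ s, f (e i) ≤ ∑ k ∈ t, f k := by
  classical
  rw [← Finset.sum_image he]
  exact Finset.sum_le_sum_of_subset_of_nonneg (Finset.image_subset_iff.mpr hst) fun k _ _ => hf k

section Sums

variable {β : ℝ} {K : ℕ}

/-- The sum of the weights `cubicWeight` up to `M`. -/
noncomputable def cubicSum (β : ℝ) (K M : ℕ) : ℝ :=
  ∑ k ∈ Finset.Icc 1 M, cubicWeight β K ((k : ℕ) : ℤ)

theorem cubicSum_le {c : ℝ} (hc : 0 < c) (hβ : BadlyApproximableWith c β) (hK : 1 ≤ K) (M : ℕ) :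
    cubicSum β K M ≤ 608 / c ^ 5 * K := by
  have := sum_inv_sq_inv_cube_le hc hβ hK M
  unfold cubicSum cubicWeight
  push_cast
  exact this

theorem cubicSum_nonneg (hK : 1 ≤ K) (M : ℕ) : 0 ≤ cubicSum β K M :=
  Finset.sum_nonneg fun _ _ => cubicWeight_nonneg β hK _

theorem cubicSum_mono (hK : 1 ≤ K) {M M' : ℕ} (h : M ≤ M') : cubicSum β K M ≤ cubicSum β K M' :=
  Finset.sum_le_sum_of_subset_of_nonneg (Finset.Icc_subset_Icc_right h)
    fun _ _ _ => cubicWeight_nonneg β hK _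

theorem sum_cubicWeight_add_le (hK : 1 ≤ K) (M m : ℕ) (hm : m ≤ M) :
    ∑ l ∈ Finset.Icc 1 M, cubicWeight β K ((m : ℤ) + (l : ℤ)) ≤ cubicSum β K (2 * M) := by
  have := sum_comp_le_sum (s := Finset.Icc 1 M) (t := Finset.Icc 1 (2 * M)) (e := fun l => m + l)
    (f := fun k : ℕ => cubicWeight β K (k : ℤ)) (fun a _ b _ h => by simpa using h)
    (fun l hl => by simp only [Finset.mem_Icc] at hl ⊢; omega)
    (fun k => cubicWeight_nonneg β hK _)
  push_cast at this
  exact this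

/-- The factor 2 comes from the two signs of m - l, each of which gives an injection into the
positive integers. -/
theorem sum_cubicWeight_sub_le (hK : 1 ≤ K) (M m : ℕ) (hm : m ∈ Finset.Icc 1 M) :
    ∑ l ∈ (Finset.Icc 1 M).erase m, cubicWeight β K ((m : ℤ) - (l : ℤ)) ≤
      2 * cubicSum β K (2 * M) := by
  simp only [Finset.mem_Icc] at hm
  have hsplit : (Finset.Icc 1 M).erase m = Finset.Ico 1 m ∪ Finset.Icc (m + 1) M := by
    ext l; simp only [Finset.mem_erase, Finset.mem_Icc, Finset.mem_union, Finset.mem_Ico]; omega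
  have hdisj : Disjoint (Finset.Ico 1 m) (Finset.Icc (m + 1) M) := by
    rw [Finset.disjoint_left]; intro l; simp only [Finset.mem_Icc, Finset.mem_Ico]; omega
  rw [hsplit, Finset.sum_union hdisj, two_mul]
  refine add_le_add ?_ ?_
  · have := sum_comp_le_sum (s := Finset.Ico 1 m) (t := Finset.Icc 1 (2 * M)) (e := fun l => m - l)
      (f := fun k : ℕ => cubicWeight β K (k : ℤ))
      (fun a ha b hb h => by simp only [Finset.coe_Ico, Set.mem_Ico] at ha hb h; omega)
      (fun l hl => by simp only [Finset.mem_Ico, Finset.mem_Icc] at hl ⊢; omega)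
      (fun k => cubicWeight_nonneg β hK _)
    refine le_trans (le_of_eq (Finset.sum_congr rfl fun l hl => ?_)) this
    rw [Nat.cast_sub (Finset.mem_Ico.mp hl).2.le]
  · have := sum_comp_le_sum (s := Finset.Icc (m + 1) M) (t := Finset.Icc 1 (2 * M))
      (e := fun l => l - m) (f := fun k : ℕ => cubicWeight β K (k : ℤ))
      (fun a ha b hb h => by simp only [Finset.coe_Icc, Set.mem_Icc] at ha hb h; omega)
      (fun l hl => by simp only [Finset.mem_Icc] at hl ⊢; omega)
      (fun k => cubicWeight_nonneg β hK _)
    refine le_trans (le_of_eq (Finset.sum_congr rfl fun l hl => ?_)) this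
    have := (Finset.mem_Icc.mp hl).1
    rw [Nat.cast_sub (by omega), ← cubicWeight_neg, neg_sub]

/-- The pair weight dominating the covariances. -/
noncomputable def pairWeight (β : ℝ) (K m l : ℕ) : ℝ :=
  cubicWeight β K m * cubicWeight β K l + (cubicWeight β K m + cubicWeight β K l) *
    (cubicWeight β K ((m : ℤ) + (l : ℤ)) + cubicWeight β K ((m : ℤ) - (l : ℤ)))

theorem sum_mul_offdiag_le (hK : 1 ≤ K) (M : ℕ) :
    ∑ m ∈ Finset.Icc 1 M, ∑ l ∈ (Finset.Icc 1 M).erase m, cubicWeight β K m *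
      (cubicWeight β K ((m : ℤ) + (l : ℤ)) + cubicWeight β K ((m : ℤ) - (l : ℤ))) ≤
      3 * cubicSum β K (2 * M) ^ 2 := by
  have hS := cubicSum_nonneg (β := β) hK (2 * M)
  calc _ ≤ ∑ m ∈ Finset.Icc 1 M, cubicWeight β K ((m : ℕ) : ℤ) * (3 * cubicSum β K (2 * M)) := by
        refine Finset.sum_le_sum fun m hm => ?_
        rw [← Finset.mul_sum, Finset.sum_add_distrib]
        apply mul_le_mul_of_nonneg_left _ (cubicWeight_nonneg β hK _)
        have h1 := sum_cubicWeight_sub_le (β := β) hK M m hm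
        have h2 := sum_cubicWeight_add_le (β := β) hK M m (Finset.mem_Icc.mp hm).2
        have h3 : ∑ l ∈ (Finset.Icc 1 M).erase m, cubicWeight β K ((m : ℤ) + (l : ℤ)) ≤
            ∑ l ∈ Finset.Icc 1 M, cubicWeight β K ((m : ℤ) + (l : ℤ)) :=
          Finset.sum_le_sum_of_subset_of_nonneg (Finset.erase_subset _ _)
            fun _ _ _ => cubicWeight_nonneg β hK _
        linarith
    _ = cubicSum β K M * (3 * cubicSum β K (2 * M)) := by rw [← Finset.sum_mul]; rfl
    _ ≤ cubicSum β K (2 * M) * (3 * cubicSum β K (2 * M)) := by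
        gcongr
        exact cubicSum_mono hK (by omega)
    _ = _ := by ring

theorem sum_pairWeight_le (hK : 1 ≤ K) (M : ℕ) :
    ∑ m ∈ Finset.Icc 1 M, ∑ l ∈ (Finset.Icc 1 M).erase m, pairWeight β K m l ≤
      7 * cubicSum β K (2 * M) ^ 2 := by
  have h1 := sum_mul_offdiag_le (β := β) hK M
  have h2 : ∑ m ∈ Finset.Icc 1 M, ∑ l ∈ (Finset.Icc 1 M).erase m, cubicWeight β K l *
      (cubicWeight β K ((m : ℤ) + (l : ℤ)) + cubicWeight β K ((m : ℤ) - (l : ℤ))) ≤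
      3 * cubicSum β K (2 * M) ^ 2 := by
    rw [Finset.sum_comm' (t' := Finset.Icc 1 M) (s' := fun l => (Finset.Icc 1 M).erase l)]
    · refine le_trans (le_of_eq ?_) h1
      refine Finset.sum_congr rfl fun l _ => Finset.sum_congr rfl fun m _ => ?_
      rw [add_comm (m : ℤ), ← cubicWeight_neg β K ((m : ℤ) - l), neg_sub]
    · intro x y; simp only [Finset.mem_erase, Finset.mem_Icc]; tauto
  have h3 : ∑ m ∈ Finset.Icc 1 M, ∑ l ∈ (Finset.Icc 1 M).erase m,
      cubicWeight β K m * cubicWeight β K l ≤ cubicSum β K (2 * M) ^ 2 := by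
    calc _ ≤ ∑ m ∈ Finset.Icc 1 M, ∑ l ∈ Finset.Icc 1 M,
          cubicWeight β K ((m : ℕ) : ℤ) * cubicWeight β K ((l : ℕ) : ℤ) :=
          Finset.sum_le_sum fun m _ => Finset.sum_le_sum_of_subset_of_nonneg
            (Finset.erase_subset _ _) fun _ _ _ => mul_nonneg (cubicWeight_nonneg β hK _)
              (cubicWeight_nonneg β hK _)
      _ = cubicSum β K M ^ 2 := by rw [← Finset.sum_mul_sum, sq]; rfl
      _ ≤ _ := pow_le_pow_left₀ (cubicSum_nonneg hK M) (cubicSum_mono hK (by omega)) 2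
  unfold pairWeight
  simp_rw [add_mul, Finset.sum_add_distrib]
  linarith

theorem sum_sq_cubicWeight_le (hK : 1 ≤ K) (M : ℕ) :
    ∑ m ∈ Finset.Icc 1 M, cubicWeight β K ((m : ℕ) : ℤ) ^ 2 ≤ cubicSum β K M ^ 2 :=
  Finset.sum_sq_le_sq_sum_of_nonneg fun _ _ => cubicWeight_nonneg β hK _

theorem sum_sq_cubicWeight_double_le (hK : 1 ≤ K) (M : ℕ) :
    ∑ m ∈ Finset.Icc 1 M, cubicWeight β K ((m : ℤ) + (m : ℤ)) ^ 2 ≤ cubicSum β K (2 * M) ^ 2 := by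
  refine le_trans ?_ (sum_sq_cubicWeight_le hK (2 * M))
  have := sum_comp_le_sum (s := Finset.Icc 1 M) (t := Finset.Icc 1 (2 * M)) (e := fun l => l + l)
    (f := fun k : ℕ => cubicWeight β K (k : ℤ) ^ 2)
    (fun a _ b _ h => by simp only at h; omega)
    (fun l hl => by simp only [Finset.mem_Icc] at hl ⊢; omega) (fun k => sq_nonneg _)
  push_cast at this
  exact this

end Sums

/-! ### From geometric sums to Diophantine weights. -/

section Frequencies

variable {α β c κ : ℝ} {ν : Measure ℤ} [IsProbabilityMeasure ν] {N K : ℕ}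

/-- Two bounds are merged: G‖mβ‖² ≤ 2/κ, from σ²G ≤ 2, and the trivial G/K² ≤ 4. The constant is
2·(2/κ) + 2·4, because the square of the capped distance is at most twice the sum of the two
squares. -/
theorem geomSum_le_inv_sq (hκ : 0 < κ) (hK : 1 ≤ K) (hNK : (N : ℝ) ≤ 4 * (K : ℝ) ^ 2)
    (hlow : ∀ m : ℤ, κ * ‖(((m : ℝ) * β : ℝ) : UnitAddCircle)‖ ^ 2 ≤ charVar α ν m) (m : ℤ) :
    geomSum α ν N m ≤ (4 / κ + 8) * (1 / cappedDist β K m) ^ 2 := by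
  have hK' : (0 : ℝ) < K := by exact_mod_cast hK
  have hx := cappedDist_pos β hK m
  have hG := geomSum_nonneg α ν N m
  have h1 : geomSum α ν N m * (κ * ‖(((m : ℝ) * β : ℝ) : UnitAddCircle)‖ ^ 2) ≤ 2 := by
    have := charVar_mul_geomSum_le α ν N m
    have := mul_le_mul_of_nonneg_left (hlow m) hG
    linarith
  have h2 : geomSum α ν N m * (1 / (K : ℝ)) ^ 2 ≤ 4 := by
    rw [one_div_pow, mul_one_div, div_le_iff₀ (by positivity)]
    exact (geomSum_le α ν N m).trans hNK
  rw [one_div_pow, mul_one_div, le_div_iff₀ (by positivity)]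
  have h3 : cappedDist β K m ^ 2 ≤
      2 * ‖(((m : ℝ) * β : ℝ) : UnitAddCircle)‖ ^ 2 + 2 * (1 / (K : ℝ)) ^ 2 := by
    unfold cappedDist
    nlinarith [sq_nonneg (‖(((m : ℝ) * β : ℝ) : UnitAddCircle)‖ - 1 / (K : ℝ))]
  have h4 : geomSum α ν N m * ‖(((m : ℝ) * β : ℝ) : UnitAddCircle)‖ ^ 2 ≤ 2 / κ := by
    rw [le_div_iff₀ hκ]; linarith
  calc _ ≤ geomSum α ν N m *
        (2 * ‖(((m : ℝ) * β : ℝ) : UnitAddCircle)‖ ^ 2 + 2 * (1 / (K : ℝ)) ^ 2) := by gcongr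
    _ ≤ 2 * (2 / κ) + 2 * 4 := by linarith
    _ = _ := by ring

/-- For m ≤ K the cap 1/K is itself O(‖mβ‖), so |1-φ| ≥ σ²/2 is bounded below by a multiple of x_m².
Beyond K this can fail, which is why the main term is cut there. -/
theorem one_div_norm_le (hc : 0 < c) (hκ : 0 < κ) (hβ : BadlyApproximableWith c β)
    (hlow : ∀ m : ℤ, κ * ‖(((m : ℝ) * β : ℝ) : UnitAddCircle)‖ ^ 2 ≤ charVar α ν m)
    {m : ℕ} (hm : 1 ≤ m) (hmK : m ≤ K) :
    0 < ‖1 - charAt α ν m‖ ∧ 0 < charVar α ν m ∧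
    1 / ‖1 - charAt α ν m‖ ≤ 2 / κ * (1 + 1 / c) ^ 2 * (1 / cappedDist β K m) ^ 2 := by
  have hK : 1 ≤ K := hm.trans hmK
  have hm' : (0 : ℝ) < m := by exact_mod_cast hm
  have hK' : (0 : ℝ) < K := by exact_mod_cast hK
  have hx := cappedDist_pos β hK m
  have hn := hβ m hm
  have h1 := hlow m
  have h2 := charVar_le_two_mul_norm α ν m
  have hxn : cappedDist β K m ≤ (1 + 1 / c) * ‖(((m : ℝ) * β : ℝ) : UnitAddCircle)‖ := by
    unfold cappedDist
    rw [Int.cast_natCast]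
    have : 1 / (K : ℝ) ≤ 1 / c * ‖(((m : ℝ) * β : ℝ) : UnitAddCircle)‖ := by
      calc 1 / (K : ℝ) ≤ 1 / m := one_div_le_one_div_of_le hm' (by exact_mod_cast hmK)
        _ = 1 / c * (c / m) := by field_simp
        _ ≤ _ := by gcongr
    linarith
  rw [Int.cast_natCast] at h1
  set n := ‖(((m : ℝ) * β : ℝ) : UnitAddCircle)‖
  have hn0 : 0 < n := lt_of_lt_of_le (by positivity) hn
  have hr : κ / 2 * n ^ 2 ≤ ‖1 - charAt α ν m‖ := by linarith
  refine ⟨lt_of_lt_of_le (by positivity) hr, lt_of_lt_of_le (by positivity) h1, ?_⟩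
  calc 1 / ‖1 - charAt α ν m‖ ≤ 1 / (κ / 2 * n ^ 2) :=
        one_div_le_one_div_of_le (by positivity) hr
    _ = 2 / κ * (1 / n) ^ 2 := by field_simp
    _ ≤ 2 / κ * ((1 + 1 / c) * (1 / cappedDist β K m)) ^ 2 := by
        gcongr
        rw [mul_one_div, div_le_div_iff₀ hn0 hx]
        linarith
    _ = _ := by ring

/-- Since σ²G² = (σ²G)G ≤ 2G, a factor σ saves half a power of G. -/
theorem sqrt_charVar_mul_geomSum_le {D : ℝ} {p : ℝ} (hp : 0 ≤ p) (m : ℤ)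
    (hD : geomSum α ν N m ≤ D * p ^ 2) (hD0 : 0 ≤ D) :
    √(charVar α ν m) * geomSum α ν N m ≤ √(2 * D) * p := by
  have hG := geomSum_nonneg α ν N m
  refine abs_le_of_sq_le_sq' ?_ (by positivity) |>.2
  rw [mul_pow, mul_pow, Real.sq_sqrt (charVar_nonneg α ν m), Real.sq_sqrt (by positivity)]
  have := charVar_mul_geomSum_le α ν N m
  calc charVar α ν m * geomSum α ν N m ^ 2 = (charVar α ν m * geomSum α ν N m) * geomSum α ν N m := by
        ring
    _ ≤ 2 * (D * p ^ 2) := by gcongr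
    _ = _ := by ring

theorem stepBound_weighted_le (hκ : 0 < κ) (hK : 1 ≤ K) (hN : 1 ≤ N)
    (hNK : (N : ℝ) ≤ 4 * (K : ℝ) ^ 2)
    (hlow : ∀ m : ℤ, κ * ‖(((m : ℝ) * β : ℝ) : UnitAddCircle)‖ ^ 2 ≤ charVar α ν m)
    {m l : ℕ} (hm : 1 ≤ m) (hl : 1 ≤ l) (hml : l ≠ m) :
    1 / (m : ℝ) ^ 2 * (1 / (l : ℝ) ^ 2) * stepBound α ν N m l ≤
      4264 * (4 / κ + 8) ^ 3 * pairWeight β K m l := by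
  set D := 4 / κ + 8 with hD
  have hD0 : 0 < D := by positivity
  have hΓ := geomSum_le_inv_sq (N := N) hκ hK hNK hlow
  have hxm := cappedDist_pos β hK m
  have hxl := cappedDist_pos β hK l
  have t1 := triple_cubicWeight_le β hK hm hl (k := (m : ℤ) + (l : ℤ)) (by omega)
    (by rw [abs_le]; constructor <;> omega)
    (by
      have := cappedDist_add_le β K (-(m : ℤ)) ((m : ℤ) + l)
      rwa [neg_add_cancel_left, cappedDist_neg] at this)
    (by
      have := cappedDist_add_le β K (-(l : ℤ)) ((m : ℤ) + l)
      rwa [neg_add_eq_sub, add_sub_cancel_right, cappedDist_neg] at this)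
  have t2 := triple_cubicWeight_le β hK hm hl (k := (m : ℤ) - (l : ℤ)) (by omega)
    (by rw [abs_le]; constructor <;> omega)
    (by
      have := cappedDist_add_le β K (m : ℤ) (-((m : ℤ) - l))
      rwa [neg_sub, add_sub_cancel, ← neg_sub, cappedDist_neg] at this)
    (by
      have := cappedDist_add_le β K (l : ℤ) ((m : ℤ) - l)
      rwa [add_sub_cancel] at this)
  set p := 1 / cappedDist β K m with hp
  set q := 1 / cappedDist β K l with hq
  have hp0 : 0 ≤ p := by positivity
  have hq0 : 0 ≤ q := by positivity
  set a := 1 / cappedDist β K ((m : ℤ) + (l : ℤ)) with ha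
  set b := 1 / cappedDist β K ((m : ℤ) - (l : ℤ)) with hb
  have hm0 := geomSum_nonneg α ν N m
  have hl0 := geomSum_nonneg α ν N l
  have hGm1 := one_le_geomSum α ν hN m
  have hs : (√(charVar α ν m) * geomSum α ν N m) * (√(charVar α ν l) * geomSum α ν N l) ≤
      2 * D * (p * q) := by
    calc _ ≤ (√(2 * D) * p) * (√(2 * D) * q) :=
          mul_le_mul (sqrt_charVar_mul_geomSum_le hp0 m (hΓ m) hD0.le)
            (sqrt_charVar_mul_geomSum_le hq0 l (hΓ l) hD0.le) (by positivity) (by positivity)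
      _ = (√(2 * D) * √(2 * D)) * (p * q) := by ring
      _ = _ := by rw [Real.mul_self_sqrt (by positivity)]
  have hpp : 0 ≤ geomSum α ν N ((m : ℤ) + l) := geomSum_nonneg α ν N _
  have hpm : 0 ≤ geomSum α ν N ((m : ℤ) - l) := geomSum_nonneg α ν N _
  -- The summand 1 is absorbed because G ≥ 1, at the price of the factor 2.
  have hsum : 1 + geomSum α ν N m + geomSum α ν N l ≤ 2 * D * (p ^ 2 + q ^ 2) := by
    have := hΓ m
    have := hΓ l
    nlinarith
  have hstep : stepBound α ν N m l ≤ 4 * (2 * D * (p * q)) *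
      (21 * ((D * p ^ 2) * (D * q ^ 2)) +
        2 * (2 * D * (p ^ 2 + q ^ 2)) * (D * a ^ 2 + D * b ^ 2)) := by
    have e : stepBound α ν N m l = 4 * ((√(charVar α ν m) * geomSum α ν N m) *
        (√(charVar α ν l) * geomSum α ν N l)) *
        (21 * (geomSum α ν N m * geomSum α ν N l) +
        2 * (1 + geomSum α ν N m + geomSum α ν N l) *
          (geomSum α ν N (m + l) + geomSum α ν N (m - l))) := by unfold stepBound; ring
    rw [e]
    gcongr
    · exact hΓ m
    · exact hΓ l
    · exact hΓ _
    · exact hΓ _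
  have hcw : cubicWeight β K m * cubicWeight β K l =
      1 / (m : ℝ) ^ 2 * (1 / (l : ℝ) ^ 2) * (p ^ 3 * q ^ 3) := by
    unfold cubicWeight
    rw [hp, hq]; push_cast; ring
  have n1 := mul_nonneg (cubicWeight_nonneg β hK m) (cubicWeight_nonneg β hK l)
  have n2 := mul_nonneg (add_nonneg (cubicWeight_nonneg β hK m) (cubicWeight_nonneg β hK l))
    (add_nonneg (cubicWeight_nonneg β hK ((m : ℤ) + (l : ℤ)))
      (cubicWeight_nonneg β hK ((m : ℤ) - (l : ℤ))))
  calc _ ≤ 1 / (m : ℝ) ^ 2 * (1 / (l : ℝ) ^ 2) * (4 * (2 * D * (p * q)) *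
      (21 * ((D * p ^ 2) * (D * q ^ 2)) +
        2 * (2 * D * (p ^ 2 + q ^ 2)) * (D * a ^ 2 + D * b ^ 2))) := by gcongr
    _ = 8 * D ^ 3 * (21 * (1 / (m : ℝ) ^ 2 * (1 / (l : ℝ) ^ 2) * (p ^ 3 * q ^ 3)) +
        4 * (1 / (m : ℝ) ^ 2 * (1 / (l : ℝ) ^ 2) * (p * q * (p ^ 2 + q ^ 2) * a ^ 2) +
          1 / (m : ℝ) ^ 2 * (1 / (l : ℝ) ^ 2) * (p * q * (p ^ 2 + q ^ 2) * b ^ 2))) := by ring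
    -- The product of the weights at m and l is counted 21 times directly and 4·64 times for each of
    -- m + l and m - l: 533 = 21 + 2·256.
    _ ≤ 8 * D ^ 3 * (533 * pairWeight β K m l) := by
        apply mul_le_mul_of_nonneg_left _ (by positivity)
        rw [← hcw]
        unfold pairWeight
        nlinarith
    _ = _ := by ring

/-- The off-diagonal covariances sum up to `O(N)`. -/
theorem sum_stepBound_le (hc : 0 < c) (hκ : 0 < κ) (hβ : BadlyApproximableWith c β) (hK : 1 ≤ K)
    (hKN : (K : ℝ) ^ 2 ≤ N) (hNK : (N : ℝ) ≤ 4 * (K : ℝ) ^ 2)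
    (hlow : ∀ m : ℤ, κ * ‖(((m : ℝ) * β : ℝ) : UnitAddCircle)‖ ^ 2 ≤ charVar α ν m) (M : ℕ) :
    ∑ m ∈ Finset.Icc 1 M, ∑ l ∈ (Finset.Icc 1 M).erase m,
      1 / (m : ℝ) ^ 2 * (1 / (l : ℝ) ^ 2) * stepBound α ν N m l ≤
      29848 * (4 / κ + 8) ^ 3 * (608 / c ^ 5) ^ 2 * N := by
  have hN : 1 ≤ N := by
    have : (1 : ℝ) ≤ K := by exact_mod_cast hK
    have : (1 : ℝ) ≤ N := by nlinarith
    exact_mod_cast this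
  calc _ ≤ ∑ m ∈ Finset.Icc 1 M, ∑ l ∈ (Finset.Icc 1 M).erase m,
        4264 * (4 / κ + 8) ^ 3 * pairWeight β K m l := by
        refine Finset.sum_le_sum fun m hm => Finset.sum_le_sum fun l hl => ?_
        rw [Finset.mem_erase, Finset.mem_Icc] at hl
        exact stepBound_weighted_le hκ hK hN hNK hlow (Finset.mem_Icc.mp hm).1 hl.2.1 hl.1
    _ = 4264 * (4 / κ + 8) ^ 3 *
        ∑ m ∈ Finset.Icc 1 M, ∑ l ∈ (Finset.Icc 1 M).erase m, pairWeight β K m l := by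
        simp_rw [Finset.mul_sum]
    _ ≤ 4264 * (4 / κ + 8) ^ 3 * (7 * (608 / c ^ 5 * K) ^ 2) := by
        gcongr
        refine (sum_pairWeight_le hK M).trans ?_
        gcongr
        · exact cubicSum_nonneg hK _
        · exact cubicSum_le hc hβ hK _
    _ = 29848 * (4 / κ + 8) ^ 3 * (608 / c ^ 5) ^ 2 * (K : ℝ) ^ 2 := by ring
    _ ≤ _ := by gcongr

end Frequencies

/-! ### Sums of the mean and variance errors. -/

section DiagonalSums

variable {α β c κ : ℝ} {ν : Measure ℤ} [IsProbabilityMeasure ν] {N K : ℕ}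

/-- The main term at frequency `m`, cut off at `K`. -/
noncomputable def cutRatio (α : ℝ) (ν : Measure ℤ) (K m : ℕ) : ℝ :=
  if m ≤ K then charVar α ν m / ‖1 - charAt α ν m‖ ^ 2 else 0

theorem cutRatio_nonneg (m : ℕ) : 0 ≤ cutRatio α ν K m := by
  unfold cutRatio
  have := charVar_nonneg α ν m
  split_ifs <;> positivity

theorem sum_le_of_le_add_ite {F a b : ℕ → ℝ} {M : ℕ} (hb : ∀ m, 0 ≤ b m)
    (h : ∀ m ∈ Finset.Icc 1 M, F m ≤ a m + if K ≤ m then b m else 0) :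
    ∑ m ∈ Finset.Icc 1 M, F m ≤ ∑ m ∈ Finset.Icc 1 M, a m + ∑ m ∈ Finset.Ico K (M + 1), b m := by
  refine (Finset.sum_le_sum h).trans ?_
  rw [Finset.sum_add_distrib, ← Finset.sum_filter]
  gcongr
  · exact fun m _ _ => hb m
  · intro m hm
    simp only [Finset.mem_filter, Finset.mem_Icc, Finset.mem_Ico] at hm ⊢
    omega

theorem one_div_pow_four_mul_le {D : ℝ} {n : ℕ} {G : ℝ} (hG : 0 ≤ G)
    (hD : G ≤ D * (1 / cappedDist β K n) ^ 2) :
    1 / (n : ℝ) ^ 4 * G ^ 3 ≤ D ^ 3 * cubicWeight β K n ^ 2 := by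
  calc 1 / (n : ℝ) ^ 4 * G ^ 3 ≤ 1 / (n : ℝ) ^ 4 * (D * (1 / cappedDist β K n) ^ 2) ^ 3 := by gcongr
    _ = _ := by unfold cubicWeight; push_cast; ring

theorem sum_diagBound_le (hc : 0 < c) (hκ : 0 < κ) (hβ : BadlyApproximableWith c β) (hK : 1 ≤ K)
    (hKN : (K : ℝ) ^ 2 ≤ N) (hNK : (N : ℝ) ≤ 4 * (K : ℝ) ^ 2)
    (hlow : ∀ m : ℤ, κ * ‖(((m : ℝ) * β : ℝ) : UnitAddCircle)‖ ^ 2 ≤ charVar α ν m) (M : ℕ) :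
    ∑ m ∈ Finset.Icc 1 M, 1 / (m : ℝ) ^ 4 * diagBound α ν N m ≤
      942 * (4 / κ + 8) ^ 3 * (608 / c ^ 5) ^ 2 * N := by
  have hN : 1 ≤ N := by
    have : (1 : ℝ) ≤ K := by exact_mod_cast hK
    have : (1 : ℝ) ≤ N := by nlinarith
    exact_mod_cast this
  set D := 4 / κ + 8 with hD
  have hD0 : 0 < D := by positivity
  have hΓ := geomSum_le_inv_sq (N := N) hκ hK hNK hlow
  have hterm : ∀ m ∈ Finset.Icc 1 M, 1 / (m : ℝ) ^ 4 * diagBound α ν N m ≤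
      174 * D ^ 3 * cubicWeight β K ((m : ℕ) : ℤ) ^ 2 +
        768 * D ^ 3 * cubicWeight β K ((m : ℤ) + (m : ℤ)) ^ 2 := by
    intro m hm
    have hG0 := geomSum_nonneg α ν N m
    have hG1 := one_le_geomSum α ν hN m
    have hH0 := geomSum_nonneg α ν N ((m : ℤ) + m)
    have hs := charVar_mul_geomSum_le α ν N m
    have h1 := one_div_pow_four_mul_le hG0 (hΓ m)
    have h2 := one_div_pow_four_mul_le (n := m + m) hH0 (by have := hΓ (m + m); exact_mod_cast this)
    have h2' : 1 / (m : ℝ) ^ 4 * geomSum α ν N ((m : ℤ) + m) ^ 3 ≤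
        16 * (D ^ 3 * cubicWeight β K ((m : ℤ) + (m : ℤ)) ^ 2) := by
      push_cast at h2
      calc _ = 16 * (1 / ((m : ℝ) + m) ^ 4 * geomSum α ν N ((m : ℤ) + m) ^ 3) := by
            rw [show (m : ℝ) + m = 2 * m by ring, mul_pow]
            ring
        _ ≤ _ := by gcongr
    -- One factor G is spent on σ²G ≤ 2, leaving cubic terms in G at m and at 2m. Divided by m⁴,
    -- these are squares of cubic weights; at 2m this costs 16 = 2⁴.
    have h3 : diagBound α ν N m ≤
        174 * geomSum α ν N m ^ 3 + 48 * geomSum α ν N ((m : ℤ) + m) ^ 3 := by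
      unfold diagBound
      set G := geomSum α ν N m
      set H := geomSum α ν N ((m : ℤ) + m)
      have e1 : G ^ 2 * H ≤ G ^ 3 + H ^ 3 := by
        rcases le_total G H with h | h
        · have : G ^ 2 * H ≤ H ^ 2 * H := by gcongr
          nlinarith [pow_nonneg hG0 3]
        · have : G ^ 2 * H ≤ G ^ 2 * G := by gcongr
          nlinarith [pow_nonneg hH0 3]
      calc charVar α ν m * G ^ 2 * (63 * G ^ 2 + 8 * (1 + 2 * G) * H)
          = (charVar α ν m * G) * (G * (63 * G ^ 2 + 8 * (1 + 2 * G) * H)) := by ring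
        _ ≤ 2 * (G * (63 * G ^ 2 + 8 * (G + 2 * G) * H)) := by gcongr
        _ = 126 * G ^ 3 + 48 * (G ^ 2 * H) := by ring
        _ ≤ _ := by linarith
    calc _ ≤ 1 / (m : ℝ) ^ 4 *
          (174 * geomSum α ν N m ^ 3 + 48 * geomSum α ν N ((m : ℤ) + m) ^ 3) := by gcongr
      _ = 174 * (1 / (m : ℝ) ^ 4 * geomSum α ν N m ^ 3) +
          48 * (1 / (m : ℝ) ^ 4 * geomSum α ν N ((m : ℤ) + m) ^ 3) := by ring
      _ ≤ _ := by linarith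
  have hS := cubicSum_le hc hβ hK (2 * M)
  have hS0 := cubicSum_nonneg (β := β) hK (2 * M)
  calc _ ≤ _ := Finset.sum_le_sum hterm
    _ = 174 * D ^ 3 * ∑ m ∈ Finset.Icc 1 M, cubicWeight β K ((m : ℕ) : ℤ) ^ 2 +
        768 * D ^ 3 * ∑ m ∈ Finset.Icc 1 M, cubicWeight β K ((m : ℤ) + (m : ℤ)) ^ 2 := by
        rw [Finset.sum_add_distrib, Finset.mul_sum, Finset.mul_sum]
    _ ≤ 174 * D ^ 3 * cubicSum β K (2 * M) ^ 2 + 768 * D ^ 3 * cubicSum β K (2 * M) ^ 2 := by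
        gcongr
        · refine (sum_sq_cubicWeight_le hK M).trans ?_
          exact pow_le_pow_left₀ (cubicSum_nonneg hK M) (cubicSum_mono hK (by omega)) 2
        · exact sum_sq_cubicWeight_double_le hK M
    _ = 942 * D ^ 3 * cubicSum β K (2 * M) ^ 2 := by ring
    _ ≤ 942 * D ^ 3 * (608 / c ^ 5 * K) ^ 2 := by gcongr
    _ = 942 * D ^ 3 * (608 / c ^ 5) ^ 2 * (K : ℝ) ^ 2 := by ring
    _ ≤ _ := by gcongr

theorem abs_weight_sub_le (hc : 0 < c) (hκ : 0 < κ) (hβ : BadlyApproximableWith c β)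
    (hlow : ∀ m : ℤ, κ * ‖(((m : ℝ) * β : ℝ) : UnitAddCircle)‖ ^ 2 ≤ charVar α ν m)
    {m : ℕ} (hm : 1 ≤ m) (hmK : m ≤ K) :
    |charVar α ν m * weightSum α ν m N - N * cutRatio α ν K m| ≤
        6 * (2 / κ * (1 + 1 / c) ^ 2) ^ 2 * (1 / cappedDist β K m) ^ 4 ∧
      cutRatio α ν K m ≤ 2 * (2 / κ * (1 + 1 / c) ^ 2) * (1 / cappedDist β K m) ^ 2 := by
  obtain ⟨hr, -, hinv⟩ := one_div_norm_le (α := α) (ν := ν) hc hκ hβ hlow hm hmK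
  have h1 := abs_charVar_mul_weightSum_sub_le α ν m N hr
  have h2 := charVar_le_two_mul_norm α ν m
  unfold cutRatio
  rw [if_pos hmK]
  constructor
  · refine h1.trans ?_
    calc 6 / ‖1 - charAt α ν m‖ ^ 2 = 6 * (1 / ‖1 - charAt α ν m‖) ^ 2 := by
          rw [one_div_pow, mul_one_div]
      _ ≤ 6 * (2 / κ * (1 + 1 / c) ^ 2 * (1 / cappedDist β K m) ^ 2) ^ 2 := by gcongr
      _ = _ := by ring
  · calc charVar α ν m / ‖1 - charAt α ν m‖ ^ 2
        ≤ 2 * ‖1 - charAt α ν m‖ / ‖1 - charAt α ν m‖ ^ 2 := by gcongr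
      _ = 2 * (1 / ‖1 - charAt α ν m‖) := by field_simp
      _ ≤ 2 * (2 / κ * (1 + 1 / c) ^ 2 * (1 / cappedDist β K m) ^ 2) := by gcongr
      _ = _ := by ring

/-- Up to K the error is O(x⁻⁴); bounding one factor 1/x by K leaves the cubic sum, O(K²) in total.
Beyond K nothing is subtracted, and σ²∑|g|² ≤ 2NG = O(Nx⁻²) is handled by the tail sum. The term
|T|² is O(x⁻⁴) in both ranges. -/
theorem exists_sum_mean_error_le (hc : 0 < c) (hκ : 0 < κ) (hβ : BadlyApproximableWith c β)
    (hlow : ∀ m : ℤ, κ * ‖(((m : ℝ) * β : ℝ) : UnitAddCircle)‖ ^ 2 ≤ charVar α ν m) :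
    ∃ C : ℝ, ∀ N K M : ℕ, 1 ≤ K → (K : ℝ) ^ 2 ≤ N → (N : ℝ) ≤ 4 * (K : ℝ) ^ 2 →
      ∑ m ∈ Finset.Icc 1 M, 1 / (m : ℝ) ^ 2 *
        |‖geomTail α ν m N‖ ^ 2 + charVar α ν m * weightSum α ν m N - N * cutRatio α ν K m| ≤
      C * N := by
  set D := 4 / κ + 8 with hD
  set E := 2 / κ * (1 + 1 / c) ^ 2 with hE
  have hD0 : 0 < D := by positivity
  refine ⟨(D ^ 2 + 6 * E ^ 2) * (608 / c ^ 5) + 2 * D * (32 / c ^ 2), fun N K M hK hKN hNK => ?_⟩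
  have hΓ := geomSum_le_inv_sq (N := N) hκ hK hNK hlow
  have hterm : ∀ m ∈ Finset.Icc 1 M, 1 / (m : ℝ) ^ 2 *
      |‖geomTail α ν m N‖ ^ 2 + charVar α ν m * weightSum α ν m N - N * cutRatio α ν K m| ≤
      (D ^ 2 + 6 * E ^ 2) * K * cubicWeight β K ((m : ℕ) : ℤ) +
        if K ≤ m then 2 * D * N * (1 / (m : ℝ) ^ 2 * (1 / cappedDist β K ((m : ℕ) : ℤ) ^ 2)) else 0 := by
    intro m hm
    have hm1 := (Finset.mem_Icc.mp hm).1
    have hx := cappedDist_pos β hK m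
    have hp := one_div_cappedDist_le β hK m
    set p := 1 / cappedDist β K m with hpdef
    have hp0 : 0 ≤ p := by positivity
    have hT : ‖geomTail α ν m N‖ ^ 2 ≤ D ^ 2 * p ^ 4 := by
      calc ‖geomTail α ν m N‖ ^ 2 ≤ (D * p ^ 2) ^ 2 :=
            pow_le_pow_left₀ (norm_nonneg _) ((norm_geomTail_le α ν m le_rfl).trans (hΓ m)) 2
        _ = _ := by ring
    have hp4 : 1 / (m : ℝ) ^ 2 * p ^ 4 ≤ K * cubicWeight β K ((m : ℕ) : ℤ) := by
      calc 1 / (m : ℝ) ^ 2 * p ^ 4 = p * (1 / (m : ℝ) ^ 2 * p ^ 3) := by ring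
        _ ≤ K * (1 / (m : ℝ) ^ 2 * p ^ 3) := by gcongr
        _ = _ := by unfold cubicWeight; rw [hpdef, one_div_pow]; push_cast; ring
    have hcw := cubicWeight_nonneg β hK m
    rcases le_or_gt m K with hmK | hmK
    · have h1 := (abs_weight_sub_le (N := N) hc hκ hβ hlow hm1 hmK).1
      rw [← hE, ← hpdef] at h1
      have h2 : |‖geomTail α ν m N‖ ^ 2 + charVar α ν m * weightSum α ν m N -
          N * cutRatio α ν K m| ≤ (D ^ 2 + 6 * E ^ 2) * p ^ 4 := by
        rw [add_sub_assoc]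
        refine (abs_add_le _ _).trans ?_
        rw [abs_of_nonneg (sq_nonneg ‖geomTail α ν m N‖)]
        linarith
      have h3 : (0 : ℝ) ≤ if K ≤ m then 2 * D * N *
          (1 / (m : ℝ) ^ 2 * (1 / cappedDist β K ((m : ℕ) : ℤ) ^ 2)) else 0 := by
        split_ifs <;> positivity
      calc _ ≤ 1 / (m : ℝ) ^ 2 * ((D ^ 2 + 6 * E ^ 2) * p ^ 4) := by gcongr
        _ = (D ^ 2 + 6 * E ^ 2) * (1 / (m : ℝ) ^ 2 * p ^ 4) := by ring
        _ ≤ (D ^ 2 + 6 * E ^ 2) * (K * cubicWeight β K ((m : ℕ) : ℤ)) := by gcongr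
        _ ≤ _ := by linarith
    · rw [if_pos hmK.le]
      have hcut : cutRatio α ν K m = 0 := if_neg (by omega)
      rw [hcut, mul_zero, sub_zero]
      have h1 := charVar_mul_weightSum_le α ν m N
      have h0 : 0 ≤ charVar α ν m * weightSum α ν m N :=
        mul_nonneg (charVar_nonneg α ν m) (weightSum_nonneg α ν m N)
      have h2 : charVar α ν m * weightSum α ν m N ≤ 2 * N * (D * p ^ 2) := by
        refine h1.trans ?_
        gcongr
        exact hΓ m
      rw [abs_of_nonneg (by positivity)]
      calc _ ≤ 1 / (m : ℝ) ^ 2 * (D ^ 2 * p ^ 4 + 2 * N * (D * p ^ 2)) := by gcongr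
        _ = D ^ 2 * (1 / (m : ℝ) ^ 2 * p ^ 4) + 2 * D * N * (1 / (m : ℝ) ^ 2 * p ^ 2) := by ring
        _ ≤ (D ^ 2 + 6 * E ^ 2) * (K * cubicWeight β K ((m : ℕ) : ℤ)) +
            2 * D * N * (1 / (m : ℝ) ^ 2 * p ^ 2) := by
            gcongr
            nlinarith [sq_nonneg E]
        _ = _ := by rw [hpdef, one_div_pow]; ring
  refine (sum_le_of_le_add_ite (fun m => by positivity) hterm).trans ?_
  rw [← Finset.mul_sum, ← Finset.mul_sum]
  have hS := cubicSum_le hc hβ hK M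
  have hT := sum_tail_inv_sq_le hc hβ hK (M + 1)
  calc _ ≤ (D ^ 2 + 6 * E ^ 2) * K * (608 / c ^ 5 * K) + 2 * D * N * (32 / c ^ 2) := by
        gcongr
        exact hS
    _ = (D ^ 2 + 6 * E ^ 2) * (608 / c ^ 5) * (K : ℝ) ^ 2 + 2 * D * (32 / c ^ 2) * N := by ring
    _ ≤ (D ^ 2 + 6 * E ^ 2) * (608 / c ^ 5) * N + 2 * D * (32 / c ^ 2) * N := by gcongr
    _ = _ := by ring

/-- Up to K, a² - b² = (a - b)(a + b) with a - b = O(x⁻⁴) and a + b = O(Nx⁻²), which is N times a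
squared cubic weight after division by m⁴. Sums of squares are bounded by squares of sums in both
ranges. -/
theorem exists_sum_diag_error_le (hc : 0 < c) (hκ : 0 < κ) (hβ : BadlyApproximableWith c β)
    (hlow : ∀ m : ℤ, κ * ‖(((m : ℝ) * β : ℝ) : UnitAddCircle)‖ ^ 2 ≤ charVar α ν m) :
    ∃ C : ℝ, ∀ N K M : ℕ, 1 ≤ K → (K : ℝ) ^ 2 ≤ N → (N : ℝ) ≤ 4 * (K : ℝ) ^ 2 →
      ∑ m ∈ Finset.Icc 1 M, 1 / (m : ℝ) ^ 4 *
        |(charVar α ν m * weightSum α ν m N) ^ 2 - (N * cutRatio α ν K m) ^ 2| ≤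
      C * (N : ℝ) ^ 2 := by
  set D := 4 / κ + 8 with hD
  set E := 2 / κ * (1 + 1 / c) ^ 2 with hE
  have hD0 : 0 < D := by positivity
  have hE0 : 0 < E := by positivity
  refine ⟨12 * E ^ 2 * (D + E) * (608 / c ^ 5) ^ 2 + 4 * D ^ 2 * (32 / c ^ 2) ^ 2,
    fun N K M hK hKN hNK => ?_⟩
  have hΓ := geomSum_le_inv_sq (N := N) hκ hK hNK hlow
  have hterm : ∀ m ∈ Finset.Icc 1 M, 1 / (m : ℝ) ^ 4 *
      |(charVar α ν m * weightSum α ν m N) ^ 2 - (N * cutRatio α ν K m) ^ 2| ≤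
      12 * E ^ 2 * (D + E) * N * cubicWeight β K ((m : ℕ) : ℤ) ^ 2 +
        if K ≤ m then 4 * D ^ 2 * (N : ℝ) ^ 2 *
          (1 / (m : ℝ) ^ 2 * (1 / cappedDist β K ((m : ℕ) : ℤ) ^ 2)) ^ 2 else 0 := by
    intro m hm
    have hm1 := (Finset.mem_Icc.mp hm).1
    have hx := cappedDist_pos β hK m
    set p := 1 / cappedDist β K m with hpdef
    have hp0 : 0 ≤ p := by positivity
    set a := charVar α ν m * weightSum α ν m N with ha
    have ha0 : 0 ≤ a := mul_nonneg (charVar_nonneg α ν m) (weightSum_nonneg α ν m N)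
    have ha1 : a ≤ 2 * N * (D * p ^ 2) := by
      refine (charVar_mul_weightSum_le α ν m N).trans ?_
      gcongr
      exact hΓ m
    have hcw := cubicWeight_nonneg β hK m
    rcases le_or_gt m K with hmK | hmK
    · obtain ⟨h1, h2⟩ := abs_weight_sub_le (N := N) hc hκ hβ hlow hm1 hmK
      rw [← hE, ← hpdef] at h1 h2
      have hr0 := cutRatio_nonneg (α := α) (ν := ν) (K := K) m
      set b := N * cutRatio α ν K m with hb
      have hb0 : 0 ≤ b := by positivity
      have hb1 : b ≤ N * (2 * E * p ^ 2) := by rw [hb]; gcongr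
      have h3 : |a ^ 2 - b ^ 2| ≤ (6 * E ^ 2 * p ^ 4) * (2 * N * (D * p ^ 2) + N * (2 * E * p ^ 2)) := by
        rw [sq_sub_sq, mul_comm, abs_mul, abs_of_nonneg (add_nonneg ha0 hb0)]
        gcongr
      have h4 : (0 : ℝ) ≤ if K ≤ m then 4 * D ^ 2 * (N : ℝ) ^ 2 *
          (1 / (m : ℝ) ^ 2 * (1 / cappedDist β K ((m : ℕ) : ℤ) ^ 2)) ^ 2 else 0 := by
        split_ifs <;> positivity
      calc _ ≤ 1 / (m : ℝ) ^ 4 *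
            ((6 * E ^ 2 * p ^ 4) * (2 * N * (D * p ^ 2) + N * (2 * E * p ^ 2))) := by gcongr
        _ = 12 * E ^ 2 * (D + E) * N * (1 / (m : ℝ) ^ 2 * p ^ 3) ^ 2 := by ring
        _ = 12 * E ^ 2 * (D + E) * N * cubicWeight β K ((m : ℕ) : ℤ) ^ 2 := by
            unfold cubicWeight; rw [hpdef, one_div_pow]; push_cast; ring
        _ ≤ _ := by linarith
    · rw [if_pos hmK.le]
      have hcut : cutRatio α ν K m = 0 := if_neg (by omega)
      rw [hcut, mul_zero, zero_pow two_ne_zero, sub_zero, abs_of_nonneg (by positivity)]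
      have h0 : 0 ≤ 12 * E ^ 2 * (D + E) * N * cubicWeight β K ((m : ℕ) : ℤ) ^ 2 := by positivity
      calc _ ≤ 1 / (m : ℝ) ^ 4 * (2 * N * (D * p ^ 2)) ^ 2 := by gcongr
        _ = 4 * D ^ 2 * (N : ℝ) ^ 2 * (1 / (m : ℝ) ^ 2 * p ^ 2) ^ 2 := by ring
        _ = 4 * D ^ 2 * (N : ℝ) ^ 2 *
            (1 / (m : ℝ) ^ 2 * (1 / cappedDist β K ((m : ℕ) : ℤ) ^ 2)) ^ 2 := by
            rw [hpdef, one_div_pow]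
        _ ≤ _ := by linarith
  refine (sum_le_of_le_add_ite (fun m => by positivity) hterm).trans ?_
  rw [← Finset.mul_sum, ← Finset.mul_sum]
  have hS : ∑ m ∈ Finset.Icc 1 M, cubicWeight β K ((m : ℕ) : ℤ) ^ 2 ≤ (608 / c ^ 5 * K) ^ 2 :=
    (sum_sq_cubicWeight_le hK M).trans
      (pow_le_pow_left₀ (cubicSum_nonneg hK M) (cubicSum_le hc hβ hK M) 2)
  have hT : ∑ m ∈ Finset.Ico K (M + 1),
      (1 / (m : ℝ) ^ 2 * (1 / cappedDist β K ((m : ℕ) : ℤ) ^ 2)) ^ 2 ≤ (32 / c ^ 2) ^ 2 := by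
    have hnn : ∀ m ∈ Finset.Ico K (M + 1),
        0 ≤ 1 / (m : ℝ) ^ 2 * (1 / cappedDist β K ((m : ℕ) : ℤ) ^ 2) := fun m _ => by positivity
    exact (Finset.sum_sq_le_sq_sum_of_nonneg hnn).trans
      (pow_le_pow_left₀ (Finset.sum_nonneg hnn) (sum_tail_inv_sq_le hc hβ hK (M + 1)) 2)
  calc _ ≤ 12 * E ^ 2 * (D + E) * N * (608 / c ^ 5 * K) ^ 2 +
        4 * D ^ 2 * (N : ℝ) ^ 2 * (32 / c ^ 2) ^ 2 := by gcongr
    _ = 12 * E ^ 2 * (D + E) * (608 / c ^ 5) ^ 2 * (N * (K : ℝ) ^ 2) +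
        4 * D ^ 2 * (32 / c ^ 2) ^ 2 * (N : ℝ) ^ 2 := by ring
    _ ≤ 12 * E ^ 2 * (D + E) * (608 / c ^ 5) ^ 2 * (N * (N : ℝ)) +
        4 * D ^ 2 * (32 / c ^ 2) ^ 2 * (N : ℝ) ^ 2 := by gcongr
    _ = _ := by ring

end DiagonalSums

/-! ### Truncated energies, passage to the limit and the theorem. -/

section Assembly

/-- The contribution of the frequencies `1 ≤ m ≤ M` to the squared Wasserstein distance. -/
noncomputable def truncEnergy (α : ℝ) (N : ℕ) (x : ℕ → ℤ) (M : ℕ) : ℝ :=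
  ∑ m ∈ Finset.Icc 1 M, 1 / (2 * Real.pi ^ 2 * (m : ℝ) ^ 2) * (‖walkSum α m x N‖ ^ 2 / (N : ℝ) ^ 2)

theorem hasSum_wassersteinSq {Ω : Type*} (X : ℕ → Ω → ℤ) (α : ℝ) {N : ℕ} (hN : 1 ≤ N) (ω : Ω) :
    HasSum (fun m : ℕ => 1 / (2 * Real.pi ^ 2 * (m : ℝ) ^ 2) *
      (‖walkSum α m (fun k => X k ω) N‖ ^ 2 / (N : ℝ) ^ 2)) (wassersteinSq X α N ω) := by
  set s : ℕ → ℝ := fun n => ((partialSum X n ω : ℤ) : ℝ) * α with hs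
  have h1 : empiricalMeasure X α N ω = (N : ℝ≥0∞)⁻¹ •
      ∑ i : Fin N, Measure.dirac ((s (i + 1) : ℝ) : UnitAddCircle) := by
    unfold empiricalMeasure
    rw [Fin.sum_univ_eq_sum_range (fun n => Measure.dirac ((s (n + 1) : ℝ) : UnitAddCircle)),
      Finset.range_eq_Ico, Finset.sum_Ico_add' (fun n => Measure.dirac ((s n : ℝ) : UnitAddCircle))]
    rfl
  unfold wassersteinSq
  rw [h1, wasserstein_two_sq_uniform hN fun i : Fin N => ((s (i + 1) : ℝ) : UnitAddCircle)]
  convert hasSum_energy (fun i : Fin N => s (i + 1)) using 4 with m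
  rw [norm_walkSum, Fin.sum_univ_eq_sum_range
    (fun n => Complex.exp (((2 * Real.pi * m * s (n + 1) : ℝ) : ℂ) * Complex.I)),
    Finset.range_eq_Ico, Finset.sum_Ico_add'
      (fun n => Complex.exp (((2 * Real.pi * m * s n : ℝ) : ℂ) * Complex.I))]
  congr 2
  refine Finset.sum_congr rfl fun n _ => ?_
  rw [latticeChar_eq]
  congr 3
  simp only [hs, partialSum, Int.cast_natCast]
  ring

theorem truncEnergy_nonneg (α : ℝ) (N : ℕ) (x : ℕ → ℤ) (M : ℕ) : 0 ≤ truncEnergy α N x M :=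
  Finset.sum_nonneg fun _ _ => by positivity

theorem sum_Icc_inv_sq_le (M : ℕ) : ∑ m ∈ Finset.Icc 1 M, 1 / (m : ℝ) ^ 2 ≤ 2 := by
  have h := sum_range_inv_sq_le M
  rw [Finset.range_eq_Ico] at h
  have := Finset.sum_Ico_add' (fun n : ℕ => 1 / (n : ℝ) ^ 2) 0 M 1
  push_cast at this
  rw [this] at h
  exact h

/-- A bound uniform in the walk and in the cutoff, serving as the dominating function in the limits
below. -/
theorem truncEnergy_le (α : ℝ) {N : ℕ} (x : ℕ → ℤ) (M : ℕ) : truncEnergy α N x M ≤ 2 := by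
  refine (Finset.sum_le_sum fun m hm => ?_).trans (sum_Icc_inv_sq_le M)
  have hm1 : (0 : ℝ) < m := by exact_mod_cast (Finset.mem_Icc.mp hm).1
  have h1 : ‖walkSum α m x N‖ ^ 2 / (N : ℝ) ^ 2 ≤ 1 :=
    div_le_one_of_le₀ (by gcongr; exact norm_walkSum_le α m x N) (by positivity)
  have hpi := Real.pi_gt_three
  calc _ ≤ 1 / (2 * Real.pi ^ 2 * (m : ℝ) ^ 2) * 1 := by gcongr
    _ ≤ 1 / (m : ℝ) ^ 2 := by
      rw [mul_one]
      gcongr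
      refine le_mul_of_one_le_left (by positivity) ?_
      nlinarith

theorem tendsto_truncEnergy {Ω : Type*} (X : ℕ → Ω → ℤ) (α : ℝ) {N : ℕ} (hN : 1 ≤ N) (ω : Ω) :
    Filter.Tendsto (truncEnergy α N (fun k => X k ω)) Filter.atTop
      (nhds (wassersteinSq X α N ω)) := by
  have h := (hasSum_wassersteinSq X α hN ω).tendsto_sum_nat.comp (Filter.tendsto_add_atTop_nat 1)
  refine h.congr fun M => ?_
  simp only [Function.comp, truncEnergy]
  rw [Finset.sum_range_succ', Finset.range_eq_Ico, Finset.sum_Ico_add' (fun m : ℕ =>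
    1 / (2 * Real.pi ^ 2 * (m : ℝ) ^ 2) * (‖walkSum α m (fun k => X k ω) N‖ ^ 2 / (N : ℝ) ^ 2))]
  simp only [Nat.cast_zero, ne_eq, OfNat.ofNat_ne_zero, not_false_eq_true, zero_pow, mul_zero,
    div_zero, zero_mul, add_zero, zero_add]
  rfl

theorem wassersteinSq_nonneg {Ω : Type*} (X : ℕ → Ω → ℤ) (α : ℝ) (N : ℕ) (ω : Ω) : 0 ≤ wassersteinSq X α N ω :=
  sq_nonneg _

theorem wassersteinSq_le_two {Ω : Type*} (X : ℕ → Ω → ℤ) (α : ℝ) {N : ℕ} (hN : 1 ≤ N) (ω : Ω) :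
    wassersteinSq X α N ω ≤ 2 :=
  le_of_tendsto' (tendsto_truncEnergy X α hN ω) fun M => truncEnergy_le α _ M

theorem sum_cutRatio_eq (ν : Measure ℤ) [IsProbabilityMeasure ν] (α : ℝ) (w : ℕ → ℝ) (p : ℕ) (hp : p ≠ 0) {K M : ℕ} (hKM : K ≤ M) :
    ∑ m ∈ Finset.Icc 1 M, w m * cutRatio α ν K m ^ p =
      ∑ m ∈ Finset.Icc 1 K, w m * charRatio ν ((m : ℝ) * α) ^ p := by
  rw [← Finset.sum_subset (Finset.Icc_subset_Icc_right hKM)]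
  · refine Finset.sum_congr rfl fun m hm => ?_
    have h := charRatio_eq (ν := ν) (α := α) (m : ℤ)
    rw [Int.cast_natCast] at h
    rw [cutRatio, if_pos (Finset.mem_Icc.mp hm).2, h]
  · intro m hm hm'
    simp only [Finset.mem_Icc] at hm hm'
    rw [cutRatio, if_neg (by omega), zero_pow hp, mul_zero]

theorem abs_double_sum_sub_le (s : Finset ℕ) (F : ℕ → ℕ → ℝ) (d : ℕ → ℝ) :
    |∑ m ∈ s, ∑ l ∈ s, F m l - ∑ m ∈ s, d m| ≤
      ∑ m ∈ s, ∑ l ∈ s.erase m, |F m l| + ∑ m ∈ s, |F m m - d m| := by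
  rw [← Finset.sum_sub_distrib, ← Finset.sum_add_distrib]
  refine (Finset.abs_sum_le_sum_abs _ _).trans (Finset.sum_le_sum fun m hm => ?_)
  rw [← Finset.add_sum_erase s _ hm]
  calc |F m m + ∑ l ∈ s.erase m, F m l - d m|
      = |∑ l ∈ s.erase m, F m l + (F m m - d m)| := by ring_nf
    _ ≤ |∑ l ∈ s.erase m, F m l| + |F m m - d m| := abs_add_le _ _
    _ ≤ _ := by gcongr; exact Finset.abs_sum_le_sum_abs _ _

theorem one_div_two_mul_pi_sq_le {N : ℕ} (hN : 1 ≤ N) :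
    1 / (2 * Real.pi ^ 2 * (N : ℝ) ^ 2) ≤ 1 / (N : ℝ) ^ 2 := by
  have hN0 : (0 : ℝ) < N := by exact_mod_cast hN
  have hpi := Real.pi_gt_three
  gcongr
  refine le_mul_of_one_le_left (by positivity) ?_
  nlinarith

theorem BadlyApproximable.exists_badlyApproximableWith {α : ℝ} (hα : BadlyApproximable α) {d : ℕ}
    (hd : 1 ≤ d) : ∃ c : ℝ, 0 < c ∧ BadlyApproximableWith c (d * α) := by
  obtain ⟨C, hC, h⟩ := hα
  have hd0 : (0 : ℝ) < d := by exact_mod_cast hd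
  refine ⟨C / d, by positivity, fun q hq => ?_⟩
  have := h (q * d) (Nat.mul_pos hq hd)
  rw [UnitAddCircle.norm_eq]
  unfold distNearestInt at this
  push_cast at this
  rw [mul_assoc] at this
  refine le_trans (le_of_eq ?_) this
  rw [div_div, mul_comm]

section Moments

variable {Ω : Type*} [MeasurableSpace Ω] {P : Measure Ω} [IsProbabilityMeasure P]
  {ν : Measure ℤ} [IsProbabilityMeasure ν] {X : ℕ → Ω → ℤ} {α : ℝ} {N : ℕ}

theorem measurable_truncEnergy (hX : ∀ k, Measurable (X k)) (α : ℝ) (N M : ℕ) :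
    Measurable fun ω => truncEnergy α N (fun k => X k ω) M := by
  unfold truncEnergy
  refine Finset.measurable_sum _ fun m _ => ?_
  have := (isPastFun_walkSum (X := X) α m N).measurable hX
  exact (((this.norm).pow_const 2).div_const _).const_mul _

theorem measurable_wassersteinSq (hX : ∀ k, Measurable (X k)) (α : ℝ) (hN : 1 ≤ N) :
    Measurable (wassersteinSq X α N) :=
  measurable_of_tendsto_metrizable (fun M => measurable_truncEnergy hX α N M)
    (tendsto_pi_nhds.mpr fun ω => tendsto_truncEnergy X α hN ω)

theorem memLp_wassersteinSq (hX : ∀ k, Measurable (X k)) (α : ℝ) (hN : 1 ≤ N) :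
    MemLp (wassersteinSq X α N) 2 P :=
  MemLp.of_bound (measurable_wassersteinSq hX α hN).aestronglyMeasurable 2
    (ae_of_all _ fun ω => by
      rw [Real.norm_of_nonneg (wassersteinSq_nonneg X α N ω)]
      exact wassersteinSq_le_two X α hN ω)

theorem tendsto_integral_truncEnergy (hX : ∀ k, Measurable (X k)) (α : ℝ) (hN : 1 ≤ N) :
    Filter.Tendsto (fun M => ∫ ω, truncEnergy α N (fun k => X k ω) M ∂P) Filter.atTop
      (nhds (∫ ω, wassersteinSq X α N ω ∂P)) :=
  tendsto_integral_of_dominated_convergence (fun _ => 2)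
    (fun M => (measurable_truncEnergy hX α N M).aestronglyMeasurable) (integrable_const _)
    (fun M => ae_of_all _ fun ω => by
      rw [Real.norm_of_nonneg (truncEnergy_nonneg _ _ _ _)]; exact truncEnergy_le _ _ _)
    (ae_of_all _ fun ω => tendsto_truncEnergy X α hN ω)

theorem tendsto_integral_sq_truncEnergy (hX : ∀ k, Measurable (X k)) (α : ℝ) (hN : 1 ≤ N) :
    Filter.Tendsto (fun M => ∫ ω, truncEnergy α N (fun k => X k ω) M ^ 2 ∂P) Filter.atTop
      (nhds (∫ ω, wassersteinSq X α N ω ^ 2 ∂P)) :=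
  tendsto_integral_of_dominated_convergence (fun _ => 2 ^ 2)
    (fun M => ((measurable_truncEnergy hX α N M).pow_const 2).aestronglyMeasurable)
    (integrable_const _)
    (fun M => ae_of_all _ fun ω => by
      rw [Real.norm_of_nonneg (by positivity)]
      exact pow_le_pow_left₀ (truncEnergy_nonneg _ _ _ _) (truncEnergy_le _ _ _) 2)
    (ae_of_all _ fun ω => (tendsto_truncEnergy X α hN ω).pow 2)

theorem integrable_norm_walkSum_sq (hX : ∀ k, Measurable (X k)) (α : ℝ) (m : ℤ) (N : ℕ) :
    Integrable (fun ω => ‖walkSum α m (fun k => X k ω) N‖ ^ 2) P :=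
  Integrable.of_bound
    ((((isPastFun_walkSum (X := X) α m N).measurable hX).norm.pow_const 2).aestronglyMeasurable)
    ((N : ℝ) ^ 2) (ae_of_all _ fun ω => by
      rw [Real.norm_of_nonneg (by positivity)]
      exact pow_le_pow_left₀ (norm_nonneg _) (norm_walkSum_le _ _ _ _) 2)

theorem integrable_norm_walkSum_sq_mul (hX : ∀ k, Measurable (X k)) (α : ℝ) (m l : ℤ) (N : ℕ) :
    Integrable (fun ω => ‖walkSum α m (fun k => X k ω) N‖ ^ 2 *
      ‖walkSum α l (fun k => X k ω) N‖ ^ 2) P :=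
  (integrable_norm_walkSum_sq hX α l N).bdd_mul (c := (N : ℝ) ^ 2)
    (integrable_norm_walkSum_sq hX α m N).aestronglyMeasurable (ae_of_all _ fun ω => by
      rw [Real.norm_of_nonneg (by positivity)]
      exact pow_le_pow_left₀ (norm_nonneg _) (norm_walkSum_le _ _ _ _) 2)

theorem truncEnergy_eq_sum (α : ℝ) (N : ℕ) (x : ℕ → ℤ) (M : ℕ) :
    truncEnergy α N x M = 1 / (2 * Real.pi ^ 2 * (N : ℝ) ^ 2) *
      ∑ m ∈ Finset.Icc 1 M, 1 / (m : ℝ) ^ 2 * ‖walkSum α m x N‖ ^ 2 := by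
  unfold truncEnergy
  rw [Finset.mul_sum]
  refine Finset.sum_congr rfl fun m _ => ?_
  ring

theorem integral_truncEnergy (hX : ∀ k, Measurable (X k)) (α : ℝ) (N M : ℕ) :
    ∫ ω, truncEnergy α N (fun k => X k ω) M ∂P = 1 / (2 * Real.pi ^ 2 * (N : ℝ) ^ 2) *
      ∑ m ∈ Finset.Icc 1 M, 1 / (m : ℝ) ^ 2 * ∫ ω, ‖walkSum α m (fun k => X k ω) N‖ ^ 2 ∂P := by
  simp_rw [truncEnergy_eq_sum]
  rw [integral_const_mul, integral_finsetSum _ fun (m : ℕ) _ =>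
    (integrable_norm_walkSum_sq hX α m N).const_mul _]
  simp_rw [integral_const_mul]

theorem integral_sq_truncEnergy (hX : ∀ k, Measurable (X k)) (α : ℝ) (N M : ℕ) :
    ∫ ω, truncEnergy α N (fun k => X k ω) M ^ 2 ∂P = (1 / (2 * Real.pi ^ 2 * (N : ℝ) ^ 2)) ^ 2 *
      ∑ m ∈ Finset.Icc 1 M, ∑ l ∈ Finset.Icc 1 M, 1 / (m : ℝ) ^ 2 * (1 / (l : ℝ) ^ 2) *
        ∫ ω, ‖walkSum α m (fun k => X k ω) N‖ ^ 2 * ‖walkSum α l (fun k => X k ω) N‖ ^ 2 ∂P := by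
  have h : ∀ ω, truncEnergy α N (fun k => X k ω) M ^ 2 =
      (1 / (2 * Real.pi ^ 2 * (N : ℝ) ^ 2)) ^ 2 * ∑ m ∈ Finset.Icc 1 M, ∑ l ∈ Finset.Icc 1 M,
        1 / (m : ℝ) ^ 2 * (1 / (l : ℝ) ^ 2) *
        (‖walkSum α m (fun k => X k ω) N‖ ^ 2 * ‖walkSum α l (fun k => X k ω) N‖ ^ 2) := by
    intro ω
    rw [truncEnergy_eq_sum, mul_pow, sq (∑ m ∈ _, _), Finset.sum_mul_sum]
    congr 1
    refine Finset.sum_congr rfl fun m _ => Finset.sum_congr rfl fun l _ => ?_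
    ring
  simp_rw [h]
  rw [integral_const_mul, integral_finsetSum _ fun (m : ℕ) _ => integrable_finsetSum _
    fun (l : ℕ) _ => (integrable_norm_walkSum_sq_mul hX α m l N).const_mul _]
  congr 1
  refine Finset.sum_congr rfl fun m _ => ?_
  rw [integral_finsetSum _ fun (l : ℕ) _ => (integrable_norm_walkSum_sq_mul hX α m l N).const_mul _]
  simp_rw [integral_const_mul]

theorem abs_integral_truncEnergy_sub_le (hX : ∀ k, Measurable (X k))
    (hlaw : ∀ k, P.map (X k) = ν) (hind : iIndepFun X P) (hN : 1 ≤ N) {K M : ℕ} (hKM : K ≤ M) {C : ℝ}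
    (hC : ∑ m ∈ Finset.Icc 1 M, 1 / (m : ℝ) ^ 2 *
      |‖geomTail α ν m N‖ ^ 2 + charVar α ν m * weightSum α ν m N - N * cutRatio α ν K m| ≤
        C * N) :
    |(∫ ω, truncEnergy α N (fun k => X k ω) M ∂P) - 1 / (N : ℝ) * ∑ m ∈ Finset.Icc 1 K,
      1 / (2 * Real.pi ^ 2 * (m : ℝ) ^ 2) * charRatio ν ((m : ℝ) * α)| ≤ C * (1 / (N : ℝ)) := by
  have hN0 : (0 : ℝ) < N := by exact_mod_cast hN
  have h := sum_cutRatio_eq ν α (fun m => 1 / (2 * Real.pi ^ 2 * (m : ℝ) ^ 2)) 1 one_ne_zero hKM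
  simp only [pow_one] at h
  rw [← h, integral_truncEnergy hX]
  simp_rw [integral_norm_walkSum_sq hX hlaw hind]
  have hsplit : 1 / (2 * Real.pi ^ 2 * (N : ℝ) ^ 2) * ∑ m ∈ Finset.Icc 1 M, 1 / (m : ℝ) ^ 2 *
        (‖geomTail α ν m N‖ ^ 2 + charVar α ν m * weightSum α ν m N) -
      1 / (N : ℝ) * ∑ m ∈ Finset.Icc 1 M, 1 / (2 * Real.pi ^ 2 * (m : ℝ) ^ 2) * cutRatio α ν K m =
      1 / (2 * Real.pi ^ 2 * (N : ℝ) ^ 2) * ∑ m ∈ Finset.Icc 1 M, 1 / (m : ℝ) ^ 2 *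
        (‖geomTail α ν m N‖ ^ 2 + charVar α ν m * weightSum α ν m N - N * cutRatio α ν K m) := by
    rw [Finset.mul_sum, Finset.mul_sum, Finset.mul_sum, ← Finset.sum_sub_distrib]
    refine Finset.sum_congr rfl fun m hm => ?_
    have hm0 : (m : ℝ) ≠ 0 := by
      have := (Finset.mem_Icc.mp hm).1
      positivity
    field_simp
  rw [hsplit, abs_mul, abs_of_nonneg (by positivity)]
  have hle : |∑ m ∈ Finset.Icc 1 M, 1 / (m : ℝ) ^ 2 *
      (‖geomTail α ν m N‖ ^ 2 + charVar α ν m * weightSum α ν m N - N * cutRatio α ν K m)| ≤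
      C * N := by
    refine (Finset.abs_sum_le_sum_abs _ _).trans (le_of_eq_of_le ?_ hC)
    refine Finset.sum_congr rfl fun m _ => ?_
    rw [abs_mul, abs_of_nonneg (by positivity : (0 : ℝ) ≤ 1 / (m : ℝ) ^ 2)]
  calc _ ≤ 1 / (N : ℝ) ^ 2 * (C * N) := by
        gcongr ?_ * ?_
        exact one_div_two_mul_pi_sq_le hN
    _ = _ := by field_simp

theorem abs_second_moment_truncEnergy_sub_le (hX : ∀ k, Measurable (X k))
    (hlaw : ∀ k, P.map (X k) = ν) (hind : iIndepFun X P) (hN : 1 ≤ N) {K M : ℕ} (hKM : K ≤ M)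
    {A B C : ℝ}
    (hA : ∑ m ∈ Finset.Icc 1 M, ∑ l ∈ (Finset.Icc 1 M).erase m,
      1 / (m : ℝ) ^ 2 * (1 / (l : ℝ) ^ 2) * stepBound α ν N m l ≤ A * N)
    (hB : ∑ m ∈ Finset.Icc 1 M, 1 / (m : ℝ) ^ 4 * diagBound α ν N m ≤ B * N)
    (hC : ∑ m ∈ Finset.Icc 1 M, 1 / (m : ℝ) ^ 4 *
      |(charVar α ν m * weightSum α ν m N) ^ 2 - (N * cutRatio α ν K m) ^ 2| ≤ C * N ^ 2) :
    |((∫ ω, truncEnergy α N (fun k => X k ω) M ^ 2 ∂P) -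
        (∫ ω, truncEnergy α N (fun k => X k ω) M ∂P) ^ 2) -
      1 / (N : ℝ) ^ 2 * ∑ m ∈ Finset.Icc 1 K,
        1 / (4 * Real.pi ^ 4 * (m : ℝ) ^ 4) * charRatio ν ((m : ℝ) * α) ^ 2| ≤
      (A + B + C) * (1 / (N : ℝ) ^ 2) := by
  have hN0 : (0 : ℝ) < N := by exact_mod_cast hN
  rw [← sum_cutRatio_eq ν α (fun m => 1 / (4 * Real.pi ^ 4 * (m : ℝ) ^ 4)) 2 two_ne_zero hKM,
    integral_truncEnergy hX, integral_sq_truncEnergy hX]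
  set u : ℝ := 1 / (2 * Real.pi ^ 2 * (N : ℝ) ^ 2) with hu
  set e : ℕ → ℝ := fun m => ∫ ω, ‖walkSum α m (fun k => X k ω) N‖ ^ 2 ∂P with he
  set g : ℕ → ℕ → ℝ := fun m l => ∫ ω, ‖walkSum α m (fun k => X k ω) N‖ ^ 2 *
    ‖walkSum α l (fun k => X k ω) N‖ ^ 2 ∂P with hg
  set F : ℕ → ℕ → ℝ := fun m l => 1 / (m : ℝ) ^ 2 * (1 / (l : ℝ) ^ 2) * (g m l - e m * e l) with hF
  set d : ℕ → ℝ := fun m => 1 / (m : ℝ) ^ 4 * (N * cutRatio α ν K m) ^ 2 with hd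
  have hsplit : (u ^ 2 * ∑ m ∈ Finset.Icc 1 M, ∑ l ∈ Finset.Icc 1 M,
        1 / (m : ℝ) ^ 2 * (1 / (l : ℝ) ^ 2) * g m l -
        (u * ∑ m ∈ Finset.Icc 1 M, 1 / (m : ℝ) ^ 2 * e m) ^ 2) -
      1 / (N : ℝ) ^ 2 * ∑ m ∈ Finset.Icc 1 M,
        1 / (4 * Real.pi ^ 4 * (m : ℝ) ^ 4) * cutRatio α ν K m ^ 2 =
      u ^ 2 * (∑ m ∈ Finset.Icc 1 M, ∑ l ∈ Finset.Icc 1 M, F m l - ∑ m ∈ Finset.Icc 1 M, d m) := by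
    have e1 : 1 / (N : ℝ) ^ 2 * ∑ m ∈ Finset.Icc 1 M,
        1 / (4 * Real.pi ^ 4 * (m : ℝ) ^ 4) * cutRatio α ν K m ^ 2 =
        u ^ 2 * ∑ m ∈ Finset.Icc 1 M, d m := by
      rw [Finset.mul_sum, Finset.mul_sum]
      refine Finset.sum_congr rfl fun m hm => ?_
      have hm0 : (m : ℝ) ≠ 0 := by
        have := (Finset.mem_Icc.mp hm).1
        positivity
      simp only [hd, hu]
      field_simp
      ring
    have e2 : ∑ m ∈ Finset.Icc 1 M, ∑ l ∈ Finset.Icc 1 M, F m l =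
        ∑ m ∈ Finset.Icc 1 M, ∑ l ∈ Finset.Icc 1 M, 1 / (m : ℝ) ^ 2 * (1 / (l : ℝ) ^ 2) * g m l -
          (∑ m ∈ Finset.Icc 1 M, 1 / (m : ℝ) ^ 2 * e m) ^ 2 := by
      rw [sq, Finset.sum_mul_sum, ← Finset.sum_sub_distrib]
      refine Finset.sum_congr rfl fun m _ => ?_
      rw [← Finset.sum_sub_distrib]
      refine Finset.sum_congr rfl fun l _ => ?_
      simp only [hF]
      ring
    rw [e1, e2]
    ring
  rw [hsplit, abs_mul, abs_of_nonneg (by positivity)]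
  -- Each covariance is a sum over N steps, which gives the outer factor N; with the O(N) sum of
  -- step bounds the total is O(N²), against a prefactor of order N⁻⁴.
  have hoff : ∑ m ∈ Finset.Icc 1 M, ∑ l ∈ (Finset.Icc 1 M).erase m, |F m l| ≤ N * (A * N) := by
    refine le_trans ?_ (mul_le_mul_of_nonneg_left hA hN0.le)
    rw [Finset.mul_sum]
    refine Finset.sum_le_sum fun m _ => ?_
    rw [Finset.mul_sum]
    refine Finset.sum_le_sum fun l _ => ?_
    simp only [hF]
    rw [abs_mul, abs_of_nonneg (by positivity : (0 : ℝ) ≤ 1 / (m : ℝ) ^ 2 * (1 / (l : ℝ) ^ 2)),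
      mul_left_comm]
    gcongr
    exact abs_covariance_le hX hlaw hind m l
  have hdiag : ∑ m ∈ Finset.Icc 1 M, |F m m - d m| ≤ N * (B * N) + C * N ^ 2 := by
    refine le_trans ?_ (add_le_add (mul_le_mul_of_nonneg_left hB hN0.le) hC)
    rw [Finset.mul_sum, ← Finset.sum_add_distrib]
    refine Finset.sum_le_sum fun m _ => ?_
    have h1 := abs_variance_sub_le (α := α) (N := N) hX hlaw hind m
    -- The variance at m is compared first with v², the square of the leading part of the mean, and
    -- then with the cut-off main term.
    set v := charVar α ν m * weightSum α ν m N
    have h2 : F m m - d m = 1 / (m : ℝ) ^ 4 * ((g m m - e m * e m - v ^ 2) +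
        (v ^ 2 - (N * cutRatio α ν K m) ^ 2)) := by
      simp only [hF, hd]
      ring
    rw [h2, abs_mul, abs_of_nonneg (by positivity : (0 : ℝ) ≤ 1 / (m : ℝ) ^ 4), mul_left_comm,
      ← mul_add]
    gcongr
    exact (abs_add_le _ _).trans (by gcongr)
  have hall := (abs_double_sum_sub_le (Finset.Icc 1 M) F d).trans (add_le_add hoff hdiag)
  calc _ ≤ (1 / (N : ℝ) ^ 2) ^ 2 * (N * (A * N) + (N * (B * N) + C * N ^ 2)) := by
        gcongr ?_ ^ 2 * ?_
        exact one_div_two_mul_pi_sq_le hN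
    _ = _ := by field_simp; ring

end Moments

/-- Modifying each step on a null set does not change the Wasserstein distance almost surely. -/
theorem wassersteinSq_ae_eq {Ω : Type*} [MeasurableSpace Ω] {P : Measure Ω} {X Y : ℕ → Ω → ℤ}
    (h : ∀ k, X k =ᵐ[P] Y k) (α : ℝ) (N : ℕ) : wassersteinSq X α N =ᵐ[P] wassersteinSq Y α N := by
  filter_upwards [ae_all_iff.mpr h] with ω hω
  simp only [wassersteinSq, empiricalMeasure, partialSum, hω]

end Assembly

theorem theorem3 (ν : Measure ℤ) [IsProbabilityMeasure ν] (hν : NondegenerateLaw ν)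
    (α : ℝ) (hα : BadlyApproximable α) :
    ∃ C : ℝ, 0 < C ∧
      ∀ (Ω : Type*) [MeasurableSpace Ω] (P : Measure Ω) [IsProbabilityMeasure P]
        (X : ℕ → Ω → ℤ) (_ : ∀ k, HasLaw (X k) ν P) (_ : iIndepFun X P) (N : ℕ) (_ : 3 ≤ N),
        MemLp (wassersteinSq X α N) 2 P ∧
        |(∫ ω, wassersteinSq X α N ω ∂P) -
            1 / (N : ℝ) * ∑ m ∈ Finset.Icc 1 (Nat.sqrt N),
              1 / (2 * Real.pi ^ 2 * (m : ℝ) ^ 2) * charRatio ν ((m : ℝ) * α)|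
          ≤ C * (1 / (N : ℝ)) ∧
        |variance (wassersteinSq X α N) P -
            1 / (N : ℝ) ^ 2 * ∑ m ∈ Finset.Icc 1 (Nat.sqrt N),
              1 / (4 * Real.pi ^ 4 * (m : ℝ) ^ 4) * charRatio ν ((m : ℝ) * α) ^ 2|
          ≤ C * (Real.log (Real.log (N : ℝ)) ^ 2 / (N : ℝ) ^ 2) := by
  obtain ⟨d, hd, κ, hκ, hlow'⟩ := exists_charVar_lower ν hν
  obtain ⟨c, hc, hβ⟩ := hα.exists_badlyApproximableWith hd
  have hlow := hlow' α
  obtain ⟨C₁, hC₁⟩ := exists_sum_mean_error_le hc hκ hβ hlow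
  obtain ⟨C₂, hC₂⟩ := exists_sum_diag_error_le hc hκ hβ hlow
  set A := 29848 * (4 / κ + 8) ^ 3 * (608 / c ^ 5) ^ 2
  set B := 942 * (4 / κ + 8) ^ 3 * (608 / c ^ 5) ^ 2
  have hlog3 : 1 < Real.log 3 := by
    rw [Real.lt_log_iff_exp_lt (by norm_num)]
    linarith [Real.exp_one_lt_d9]
  -- Positive because e < 3. As log log N ≥ L for N ≥ 3, a variance error O(N⁻²) is absorbed into
  -- the stated one by dividing its constant by L².
  have hL : 0 < Real.log (Real.log 3) := Real.log_pos hlog3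
  set L := Real.log (Real.log 3)
  set C := |C₁| + |A + B + C₂| / L ^ 2 + 1 with hCdef
  refine ⟨C, by positivity, ?_⟩
  intro Ω _ P _ X' hlaw' hind' N hN3
  have hN : 1 ≤ N := by omega
  have hN0 : (0 : ℝ) < N := by exact_mod_cast hN
  -- `HasLaw` only gives almost everywhere measurability, so the steps are replaced by measurable
  -- versions.
  set X : ℕ → Ω → ℤ := fun k => (hlaw' k).aemeasurable.mk (X' k) with hXdef
  have hXX : ∀ k, X' k =ᵐ[P] X k := fun k => (hlaw' k).aemeasurable.ae_eq_mk
  have hX : ∀ k, Measurable (X k) := fun k => (hlaw' k).aemeasurable.measurable_mk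
  have hlaw : ∀ k, P.map (X k) = ν := fun k => by
    rw [← Measure.map_congr (hXX k), (hlaw' k).map_eq]
  have hind : iIndepFun X P := hind'.congr hXX
  have hW := wassersteinSq_ae_eq hXX α N
  have hmem : MemLp (wassersteinSq X α N) 2 P := memLp_wassersteinSq hX α hN
  set K := Nat.sqrt N with hKdef
  have hK : 1 ≤ K := Nat.sqrt_pos.mpr hN
  have hK1 : (1 : ℝ) ≤ K := by exact_mod_cast hK
  have hKN : (K : ℝ) ^ 2 ≤ N := by exact_mod_cast Nat.sqrt_le' N
  have hNK : (N : ℝ) ≤ 4 * (K : ℝ) ^ 2 := by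
    have : (N : ℝ) < ((K : ℝ) + 1) ^ 2 := by exact_mod_cast Nat.lt_succ_sqrt' N
    nlinarith
  refine ⟨hmem.ae_eq hW.symm, ?_, ?_⟩
  · rw [integral_congr_ae hW]
    -- The bound for the truncated energy is uniform in the cutoff M ≥ K and so passes to the limit
    -- M → ∞.
    have hmean := le_of_tendsto (((tendsto_integral_truncEnergy (P := P) hX α hN).sub_const
      (1 / (N : ℝ) * ∑ m ∈ Finset.Icc 1 K,
        1 / (2 * Real.pi ^ 2 * (m : ℝ) ^ 2) * charRatio ν ((m : ℝ) * α))).abs)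
      (Filter.eventually_atTop.mpr ⟨K, fun M hM =>
        abs_integral_truncEnergy_sub_le hX hlaw hind hN hM (hC₁ N K M hK hKN hNK)⟩)
    refine hmean.trans ?_
    gcongr
    have : 0 ≤ |A + B + C₂| / L ^ 2 := by positivity
    linarith [le_abs_self C₁]
  · rw [variance_congr hW, variance_eq_sub hmem]
    have hvar := le_of_tendsto ((((tendsto_integral_sq_truncEnergy (P := P) hX α hN).sub
      ((tendsto_integral_truncEnergy (P := P) hX α hN).pow 2)).sub_const
      (1 / (N : ℝ) ^ 2 * ∑ m ∈ Finset.Icc 1 K,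
        1 / (4 * Real.pi ^ 4 * (m : ℝ) ^ 4) * charRatio ν ((m : ℝ) * α) ^ 2)).abs)
      (Filter.eventually_atTop.mpr ⟨K, fun M hM =>
        abs_second_moment_truncEnergy_sub_le hX hlaw hind hN hM
          (sum_stepBound_le hc hκ hβ hK hKN hNK hlow M)
          (sum_diagBound_le hc hκ hβ hK hKN hNK hlow M) (hC₂ N K M hK hKN hNK)⟩)
    refine hvar.trans ?_
    have hLN : L ≤ Real.log (Real.log N) := by
      have h3 : (3 : ℝ) ≤ N := by exact_mod_cast hN3
      exact Real.log_le_log (by linarith) (Real.log_le_log (by norm_num) h3)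
    calc (A + B + C₂) * (1 / (N : ℝ) ^ 2) ≤ C * L ^ 2 * (1 / (N : ℝ) ^ 2) := by
          gcongr
          have h1 : |A + B + C₂| / L ^ 2 ≤ C := by linarith [abs_nonneg C₁]
          have h2 := (div_le_iff₀ (by positivity)).mp h1
          linarith [le_abs_self (A + B + C₂)]
      _ = C * (L ^ 2 / (N : ℝ) ^ 2) := by ring
      _ ≤ _ := by gcongr
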